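/- Let $P$ be a smooth manifold with a Dirac structure $L\subset TP\oplus T^*P$ (a maximal isotropic subbundle for $\langle X_1\oplus\xi_1,X_2\oplus\xi_2\rangle_+=\frac12(\xi_1(X_2)+\xi_2(X_1))$ whose sections are closed under the Courant bracket); $\rho:L\to TP$ denotes the projection and $\Upsilon$ the restriction to $L$ of $\langle X_1\oplus\xi_1,X_2\oplus\xi_2\rangle_-=\frac12(\xi_1(X_2)-\xi_2(X_1))$. A smooth function $g:P\to\mathbb R$ is admissible if there is a smooth vector field $X_g$ (a hamiltonian vector field of $g$) such that $X_g\oplus dg$ is a section of $L$; $C^\infty_{adm}(P)$ is the space of these, with bracket $\{f,g\}=X_g\cdot f$. Let $\pi:Q\to P$ be a principal $U(1)$-bundle, let $E$ be the generator of the action (of period one), $\sigma$ a connection form with $\sigma(E)=1$ and $d\sigma=\pi^*\Omega$, and $\beta$ a smooth section of $L^*$ with $\rho^*\Omega=\Upsilon+d_L\beta$. Write $X^H$ for the horizontal lift of $X$. Let $\bar L\subset(TQ\times\mathbb R)\oplus(T^*Q\times\mathbb R)$ be the direct sum of $$\{(X^H+\langle X\oplus\xi,\beta\rangle E,0)\oplus(\pi^*\xi,0):X\oplus\xi\in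 L\}$$ and of the lines generated by $(-E,0)\oplus(0,1)$ and $(-A^H,1)\oplus(\sigma-\pi^*\alpha,0)$, where $A\oplus\alpha$ is isotropic with $\beta=2\langle A\oplus\alpha,\cdot\rangle_+|_L$ ($\bar L$ does not depend on the choice of $A\oplus\alpha$). A hamiltonian pair of $h\in C^\infty(Q)$ is a smooth vector field $X_h$ and a smooth function $\varphi_h$ such that $(X_h,\varphi_h)\oplus(dh,h)$ is a section of $\bar L$. For $U\subset P$ open, a smooth function $\phi:\pi^{-1}(U)\to\mathbb C$ is basic if $X\cdot\phi+f\phi=0$ for all $(X,f)\in\bar L\cap(TQ\times\mathbb R)$, and for such $h$ and $\phi$ put $\{h,\phi\}=-(X_h\cdot\phi+\varphi_h\phi)$. Then $(C^\infty_{adm}(P),\{\cdot,\cdot\})$ is a well-defined real Lie algebra, the basic functions form a sheaf of complex algebras $C^\infty_{bas}(Q,\mathbb C)_{P\text{-}loc}$ on $P$, and, for every admissible $g$, the function $\pi^*g$ has a hamiltonian pair. The map $$g\longmapsto\{\pi^*g,\cdot\}$$ is well defined (independent of the hamiltonian pair) and is a homomorphism of real Lie algebras from $C^\infty_{adm}(P)$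 to the derivations of this sheaf, i.e. a representation of $C^\infty_{adm}(P)$ on it. For $n\in\mathbb Z$ let $H^n_{bas}(U)$ be the space of basic functions $\phi$ on $\pi^{-1}(U)$ with $E\cdot\phi=2\pi i n\,\phi$. Every eigenvalue of $E$ on the basic functions on $\pi^{-1}(U)$ is of the form $2\pi i n$ with $n\in\mathbb Z$, and every basic $\phi$ is, uniquely, a pointwise unconditionally convergent sum $\phi=\sum_{n\in\mathbb Z}\phi_n$ with $\phi_n\in H^n_{bas}(U)$. The representation preserves every $H^n_{bas}$, and $\{\pi^*g,\phi\}=\sum_n\{\pi^*g,\phi_n\}$ pointwise. Finally, identify the smooth sections $s$ over $U$ of the line bundle $K=Q\times_{U(1)}\mathbb C$ with the smooth functions $\bar s:\pi^{-1}(U)\to\mathbb C$ with $\bar s(z\cdot q)=z^{-1}\bar s(q)$ for $z\in U(1)$; let $\nabla$ be the connection induced by $\sigma$, $\overline{\nabla_Xs}=X^H\cdot\bar s$, and put $D_{X\oplus\xi}=\nabla_X-2\pi i\langle X\oplus\xi,\beta\rangle$ for $X\oplus\xi\in L$. Then $H^{-1}_{bas}(U)$ is the space of sections $s$ with $D_{Y\oplus0}s=0$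 for all $Y\in L\cap TP$, and on it $g$ acts by the usual prequantization operator $$\hat g\,s=-(D_{X_g\oplus dg}s+2\pi i\,g\,s)=-\big[\nabla_{X_g}s-2\pi i(\langle X_g\oplus dg,\beta\rangle-g)s\big].$$ -/

import Mathlib

open scoped Manifold ContDiff Topology

noncomputable section

namespace DiracPrequantization

section Tensors

variable {E : Type*} [NormedAddCommGroup E] [NormedSpace ℝ E]
  {P : Type*} [TopologicalSpace P] [ChartedSpace E P]

/-- The cotangent space `T*_p P`. -/
abbrev Cotangent (E : Type*) [NormedAddCommGroup E] [NormedSpace ℝ E]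
    {P : Type*} [TopologicalSpace P] [ChartedSpace E P] (p : P) : Type _ :=
  TangentSpace 𝓘(ℝ, E) p →L[ℝ] ℝ

/-- The fibre `T_p P ⊕ T*_p P`. -/
abbrev Generalized (E : Type*) [NormedAddCommGroup E] [NormedSpace ℝ E]
    {P : Type*} [TopologicalSpace P] [ChartedSpace E P] (p : P) : Type _ :=
  TangentSpace 𝓘(ℝ, E) p × Cotangent E p

/-- Smoothness, over the set `s`, of a vector field. -/
def SmoothFieldOn [IsManifold 𝓘(ℝ, E) ∞ P] (X : ∀ p : P, TangentSpace 𝓘(ℝ, E) p)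
    (s : Set P) : Prop :=
  ContMDiffOn 𝓘(ℝ, E) (𝓘(ℝ, E).prod 𝓘(ℝ, E)) ∞
    (fun p => Bundle.TotalSpace.mk' E p (X p)) s

/-- Smoothness, over the set `s`, of a 1-form (a section of the cotangent bundle). -/
def SmoothFormOn [IsManifold 𝓘(ℝ, E) ∞ P] (ξ : ∀ p : P, Cotangent E p) (s : Set P) : Prop :=
  ContMDiffOn 𝓘(ℝ, E) (𝓘(ℝ, E).prod 𝓘(ℝ, E →L[ℝ] ℝ)) ∞
    (fun p => Bundle.TotalSpace.mk' (E →L[ℝ] ℝ)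
      (E := fun q : P => TangentSpace 𝓘(ℝ, E) q →L[ℝ] ℝ) p (ξ p)) s

/-- Smoothness, over the set `s`, of a section of `TP ⊕ T*P`. -/
def SmoothGenOn [IsManifold 𝓘(ℝ, E) ∞ P] (e : ∀ p : P, Generalized E p) (s : Set P) : Prop :=
  SmoothFieldOn (fun p => (e p).1) s ∧ SmoothFormOn (fun p => (e p).2) s

/-- The exterior derivative `dξ` of a 1-form, computed in the preferred chart `φ` at `p`:
`dξ(v, w) = D_v ξ (w) - D_w ξ (v)`, where `ξ` is written in the chart as `(φ⁻¹)^* ξ`. -/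
def extDer (ξ : ∀ p : P, Cotangent E p) (p : P) :
    TangentSpace 𝓘(ℝ, E) p →L[ℝ] TangentSpace 𝓘(ℝ, E) p →L[ℝ] ℝ :=
  let φ := extChartAt 𝓘(ℝ, E) p
  let ξφ : E → E →L[ℝ] ℝ := fun y => (ξ (φ.symm y)).comp (mfderiv 𝓘(ℝ, E) 𝓘(ℝ, E) φ.symm y)
  let D : E →L[ℝ] E →L[ℝ] ℝ := fderiv ℝ ξφ (φ p)
  let A : E →L[ℝ] E := mfderiv 𝓘(ℝ, E) 𝓘(ℝ, E) φ p
  let B : E →L[ℝ] E →L[ℝ] ℝ := (D - D.flip).bilinearComp A A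
  B

/-- The Lie derivative of a 1-form, `L_X ξ = i_X dξ + d(i_X ξ)`. -/
def lieDerForm (X : ∀ p : P, TangentSpace 𝓘(ℝ, E) p) (ξ : ∀ p : P, Cotangent E p) (p : P) :
    Cotangent E p :=
  extDer ξ p (X p) + mvfderiv 𝓘(ℝ, E) (fun q => ξ q (X q)) p

/-- The symmetric pairing `⟨X₁ ⊕ ξ₁, X₂ ⊕ ξ₂⟩₊ = ½ (ξ₁(X₂) + ξ₂(X₁))`. -/
def pairPlus {p : P} (a b : Generalized E p) : ℝ := (1 / 2) * (a.2 b.1 + b.2 a.1)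

/-- The antisymmetric pairing `⟨X₁ ⊕ ξ₁, X₂ ⊕ ξ₂⟩₋ = ½ (ξ₁(X₂) - ξ₂(X₁))`. -/
def pairMinus {p : P} (a b : Generalized E p) : ℝ := (1 / 2) * (a.2 b.1 - b.2 a.1)

/-- The Courant bracket of two sections of `TP ⊕ T*P`. -/
def courant (a b : ∀ p : P, Generalized E p) (p : P) : Generalized E p :=
  (VectorField.mlieBracket 𝓘(ℝ, E) (fun q => (a q).1) (fun q => (b q).1) p,
    lieDerForm (fun q => (a q).1) (fun q => (b q).2) p
      - lieDerForm (fun q => (b q).1) (fun q => (a q).2) p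
      + (1 / 2 : ℝ) • mvfderiv 𝓘(ℝ, E) (fun q => (a q).2 (b q).1 - (b q).2 (a q).1) p)

/-- A subspace of `T_p P ⊕ T*_p P` is isotropic if `⟨·,·⟩₊` vanishes on it. -/
def IsIsotropic {p : P} (W : Submodule ℝ (Generalized E p)) : Prop :=
  ∀ a ∈ W, ∀ b ∈ W, pairPlus a b = 0

end Tensors

section Dirac

variable {E : Type*} [NormedAddCommGroup E] [NormedSpace ℝ E]
  {P : Type*} [TopologicalSpace P] [ChartedSpace E P] [IsManifold 𝓘(ℝ, E) ∞ P]

/-- A Dirac structure on `P`: a smooth maximal isotropic subbundle of `TP ⊕ T*P` whose space of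
sections is closed under the Courant bracket.  (A maximal isotropic subspace of
`T_p P ⊕ T*_p P` has dimension `dim P`, so this is the rank of the subbundle.) -/
structure DiracStructure (E : Type*) [NormedAddCommGroup E] [NormedSpace ℝ E]
    (P : Type*) [TopologicalSpace P] [ChartedSpace E P] [IsManifold 𝓘(ℝ, E) ∞ P] where
  fiber : ∀ p : P, Submodule ℝ (Generalized E p)
  maximal_isotropic : ∀ p, Maximal IsIsotropic (fiber p)
  exists_frame : ∀ p : P, ∃ U : Set P, IsOpen U ∧ p ∈ U ∧
    ∃ e : Fin (Module.finrank ℝ E) → ∀ q : P, Generalized E q,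
      (∀ i, SmoothGenOn (e i) U) ∧
      ∀ q ∈ U, LinearIndependent ℝ (fun i => e i q) ∧
        Submodule.span ℝ (Set.range fun i => e i q) = fiber q
  courant_mem : ∀ a b : ∀ p : P, Generalized E p,
    SmoothGenOn a Set.univ → SmoothGenOn b Set.univ →
    (∀ p, a p ∈ fiber p) → (∀ p, b p ∈ fiber p) → ∀ p, courant a b p ∈ fiber p

namespace DiracStructure

variable (L : DiracStructure E P)

/-- The space `Γ(L)` of smooth sections of `L`. -/
def Sections : Type _ :=
  {a : ∀ p : P, Generalized E p // SmoothGenOn a Set.univ ∧ ∀ p, a p ∈ L.fiber p}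

variable {L}

/-- The value at `p` of a section of `L`, as an element of `L_p`. -/
def Sections.val (a : L.Sections) (p : P) : L.fiber p := ⟨a.1 p, a.2.2 p⟩

/-- The value at `p` of the Courant bracket of two sections of `L`, as an element of `L_p`. -/
def Sections.bracket (a b : L.Sections) (p : P) : L.fiber p :=
  ⟨courant a.1 b.1 p, L.courant_mem a.1 b.1 a.2.1 b.2.1 a.2.2 b.2.2 p⟩

variable (L)

/-- `β` is a (smooth) section of `L^*`, i.e. a 1-cochain of the Lie algebroid `L`. -/
def IsCochain (β : ∀ p : P, L.fiber p →ₗ[ℝ] ℝ) : Prop :=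
  ∀ a : L.Sections, ContMDiff 𝓘(ℝ, E) 𝓘(ℝ, ℝ) ∞ (fun p => β p (a.val p))

/-- The Lie algebroid differential of a 1-cochain of `L`:
`d_L β (a, b) = ρ(a) · β(b) - ρ(b) · β(a) - β([a, b])`. -/
def algebroidDiff (β : ∀ p : P, L.fiber p →ₗ[ℝ] ℝ) (a b : L.Sections) (p : P) : ℝ :=
  mvfderiv 𝓘(ℝ, E) (fun q => β q (b.val q)) p (a.1 p).1
    - mvfderiv 𝓘(ℝ, E) (fun q => β q (a.val q)) p (b.1 p).1
    - β p (a.bracket b p)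

/-- `X` is a hamiltonian vector field of `g`: `X` is smooth and `X ⊕ dg` is a section of `L`. -/
def IsHamiltonian (X : ∀ p : P, TangentSpace 𝓘(ℝ, E) p) (g : P → ℝ) : Prop :=
  SmoothFieldOn X Set.univ ∧ ∀ p, (X p, mvfderiv 𝓘(ℝ, E) g p) ∈ L.fiber p

end DiracStructure

end Dirac

section Smoothness

variable {E : Type*} [NormedAddCommGroup E] [NormedSpace ℝ E]
  {P : Type*} [TopologicalSpace P] [ChartedSpace E P] [IsManifold 𝓘(ℝ, E) ∞ P]

lemma SmoothFieldOn.add {X Y : ∀ p : P, TangentSpace 𝓘(ℝ, E) p} {s : Set P}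
    (hX : SmoothFieldOn X s) (hY : SmoothFieldOn Y s) :
    SmoothFieldOn (fun p => X p + Y p) s :=
  ContMDiffOn.add_section hX hY

lemma SmoothFieldOn.const_smul {X : ∀ p : P, TangentSpace 𝓘(ℝ, E) p} {s : Set P}
    (c : ℝ) (hX : SmoothFieldOn X s) : SmoothFieldOn (fun p => c • X p) s :=
  ContMDiffOn.const_smul_section hX

lemma smoothFieldOn_zero {s : Set P} :
    SmoothFieldOn (fun p : P => (0 : TangentSpace 𝓘(ℝ, E) p)) s :=
  (Bundle.contMDiff_zeroSection ℝ (TangentSpace 𝓘(ℝ, E) : P → Type _)).contMDiffOn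

end Smoothness

section Admissible

variable {E : Type*} [NormedAddCommGroup E] [NormedSpace ℝ E]
  {P : Type*} [TopologicalSpace P] [ChartedSpace E P] [IsManifold 𝓘(ℝ, E) ∞ P]

/-- The real vector space `C^∞_adm(P)` of admissible functions: the smooth real functions that
have a hamiltonian vector field. -/
def DiracStructure.Adm (L : DiracStructure E P) :
    Submodule ℝ C^∞⟮𝓘(ℝ, E), P; 𝓘(ℝ, ℝ), ℝ⟯ where
  carrier := {g | ∃ X, L.IsHamiltonian X g}
  zero_mem' := by
    refine ⟨fun _ => 0, smoothFieldOn_zero, fun p => ?_⟩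
    have : mvfderiv 𝓘(ℝ, E) (⇑(0 : C^∞⟮𝓘(ℝ, E), P; 𝓘(ℝ, ℝ), ℝ⟯)) p = 0 := by
      rw [ContMDiffMap.coe_zero]; exact mvfderiv_zero
    rw [this]; exact (L.fiber p).zero_mem
  add_mem' := by
    rintro f g ⟨X, hX, hXL⟩ ⟨Y, hY, hYL⟩
    refine ⟨fun p => X p + Y p, hX.add hY, fun p => ?_⟩
    have hf := (f.contMDiff p).mdifferentiableAt (by simp)
    have hg := (g.contMDiff p).mdifferentiableAt (by simp)
    have : mvfderiv 𝓘(ℝ, E) (⇑(f + g)) p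
        = mvfderiv 𝓘(ℝ, E) f p + mvfderiv 𝓘(ℝ, E) g p := by
      rw [ContMDiffMap.coe_add]; exact mvfderiv_add hf hg
    rw [this]; exact (L.fiber p).add_mem (hXL p) (hYL p)
  smul_mem' := by
    rintro c f ⟨X, hX, hXL⟩
    refine ⟨fun p => c • X p, hX.const_smul c, fun p => ?_⟩
    have hf := (f.contMDiff p).mdifferentiableAt (by simp)
    have : mvfderiv 𝓘(ℝ, E) (⇑(c • f)) p = c • mvfderiv 𝓘(ℝ, E) f p := by
      have h := mvfderiv_smul (I := 𝓘(ℝ, E)) (a := fun _ : P => c) (x := p) (g := f)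
        mdifferentiableAt_const hf
      rw [mvfderiv_const] at h
      have e : (⇑(c • f) : P → ℝ) = (fun _ : P => c) • ⇑f := by ext; simp
      rw [e, h]; ext; simp
    rw [this]; exact (L.fiber p).smul_mem c (hXL p)

end Admissible

section Bundle

variable {F : Type*} [NormedAddCommGroup F] [NormedSpace ℝ F]
  {Q : Type*} [TopologicalSpace Q] [ChartedSpace F Q]
  [MulAction Circle Q]

/-- The infinitesimal generator of the `U(1)`-action, with `U(1) = ℝ/ℤ` parametrized by
`t ↦ exp(2πit)`: `E_q = d/dt|_{t=0} (exp(2πit) · q)`. -/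
def generator (F : Type*) [NormedAddCommGroup F] [NormedSpace ℝ F]
    {Q : Type*} [TopologicalSpace Q] [ChartedSpace F Q] [MulAction Circle Q] (q : Q) :
    TangentSpace 𝓘(ℝ, F) q :=
  let v : F := mfderiv 𝓘(ℝ, ℝ) 𝓘(ℝ, F)
    (fun t : ℝ => Circle.exp (2 * Real.pi * t) • q) (0 : ℝ) (1 : ℝ)
  v

/-- A smooth principal `U(1)`-bundle `π : Q → P`.  Local triviality is in terms of smooth
equivariant local trivializations; freeness of the action and its transitivity on the fibres
follow. -/
structure PrincipalCircleBundle (E : Type*) [NormedAddCommGroup E] [NormedSpace ℝ E]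
    (P : Type*) [TopologicalSpace P] [ChartedSpace E P]
    (F : Type*) [NormedAddCommGroup F] [NormedSpace ℝ F]
    (Q : Type*) [TopologicalSpace Q] [ChartedSpace F Q] [MulAction Circle Q] where
  proj : Q → P
  contMDiff_proj : ContMDiff 𝓘(ℝ, F) 𝓘(ℝ, E) ∞ proj
  contMDiff_action : ContMDiff ((𝓡 1).prod 𝓘(ℝ, F)) 𝓘(ℝ, F) ∞
    (fun x : Circle × Q => x.1 • x.2)
  proj_smul : ∀ (z : Circle) (q : Q), proj (z • q) = proj q
  exists_trivialization : ∀ p : P, ∃ e : Bundle.Trivialization Circle proj,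
    p ∈ e.baseSet ∧
    ContMDiffOn 𝓘(ℝ, F) (𝓘(ℝ, E).prod (𝓡 1)) ∞ e e.source ∧
    ContMDiffOn (𝓘(ℝ, E).prod (𝓡 1)) 𝓘(ℝ, F) ∞ e.toOpenPartialHomeomorph.symm e.target ∧
    ∀ (z : Circle), ∀ q ∈ e.source, (e (z • q)).2 = z * (e q).2

/-- A connection form on `π : Q → P`: an invariant smooth 1-form `σ` with `σ(E) = 1`. -/
structure IsConnectionForm [IsManifold 𝓘(ℝ, F) ∞ Q] (σ : ∀ q : Q, Cotangent F q) : Prop where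
  smooth : SmoothFormOn σ Set.univ
  apply_generator : ∀ q, σ q (generator F q) = 1
  invariant : ∀ (z : Circle) (q : Q) (v : TangentSpace 𝓘(ℝ, F) q),
    σ (z • q) (mfderiv 𝓘(ℝ, F) 𝓘(ℝ, F) (fun r : Q => z • r) q v) = σ q v

end Bundle

section Prequantization

variable {E : Type*} [NormedAddCommGroup E] [NormedSpace ℝ E]
  {P : Type*} [TopologicalSpace P] [ChartedSpace E P] [IsManifold 𝓘(ℝ, E) ∞ P]
  {F : Type*} [NormedAddCommGroup F] [NormedSpace ℝ F]
  {Q : Type*} [TopologicalSpace Q] [ChartedSpace F Q] [IsManifold 𝓘(ℝ, F) ∞ Q]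
  [MulAction Circle Q]

/-- Prequantization data for a Dirac manifold `(P, L)`: a principal `U(1)`-bundle `π : Q → P`,
a connection form `σ` on it with curvature `Ω`, i.e. `dσ = π^* Ω`, and a section `β` of `L^*` such
that `ρ^* Ω = Υ + d_L β`, where `ρ : L → TP` is the anchor and `Υ` is the restriction of `⟨·,·⟩₋`
to `L`.  (As the curvature of a connection form normalized by `σ(E) = 1`, where `E` has period
one, `Ω` is automatically a smooth, alternating, closed and integral 2-form.) -/
structure Prequantization (L : DiracStructure E P) (F : Type*) [NormedAddCommGroup F]
    [NormedSpace ℝ F] (Q : Type*) [TopologicalSpace Q] [ChartedSpace F Q]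
    [IsManifold 𝓘(ℝ, F) ∞ Q] [MulAction Circle Q] extends PrincipalCircleBundle E P F Q where
  σ : ∀ q : Q, Cotangent F q
  isConnectionForm : IsConnectionForm σ
  Ω : ∀ p : P, TangentSpace 𝓘(ℝ, E) p →L[ℝ] TangentSpace 𝓘(ℝ, E) p →L[ℝ] ℝ
  curvature : ∀ (q : Q) (v w : TangentSpace 𝓘(ℝ, F) q), extDer σ q v w =
    Ω (proj q) (mfderiv 𝓘(ℝ, F) 𝓘(ℝ, E) proj q v) (mfderiv 𝓘(ℝ, F) 𝓘(ℝ, E) proj q w)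
  β : ∀ p : P, L.fiber p →ₗ[ℝ] ℝ
  isCochain : L.IsCochain β
  condition : ∀ (a b : L.Sections) (p : P),
    Ω p (a.1 p).1 (b.1 p).1 = pairMinus (a.1 p) (b.1 p) + L.algebroidDiff β a b p

/-- The fibre `(T_q Q × ℝ) ⊕ (T*_q Q × ℝ)` of `𝓔¹(Q)`. -/
abbrev ExtGeneralized (F : Type*) [NormedAddCommGroup F] [NormedSpace ℝ F]
    {Q : Type*} [TopologicalSpace Q] [ChartedSpace F Q] (q : Q) : Type _ :=
  (TangentSpace 𝓘(ℝ, F) q × ℝ) × (Cotangent F q × ℝ)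

namespace Prequantization

variable {L : DiracStructure E P} (𝒬 : Prequantization L F Q)

/-- The differential `π_* : T_q Q → T_{π(q)} P`. -/
def dproj (q : Q) : TangentSpace 𝓘(ℝ, F) q →L[ℝ] TangentSpace 𝓘(ℝ, E) (𝒬.proj q) :=
  mfderiv 𝓘(ℝ, F) 𝓘(ℝ, E) 𝒬.proj q

/-- The horizontal lift `X^H` at `q` of a tangent vector `X` at `π(q)`: the vector with
`π_* X^H = X` and `σ(X^H) = 0`, obtained by inverting
`(π_*, σ) : T_q Q ≃ T_{π(q)} P × ℝ`. -/
def horLift (q : Q) (X : TangentSpace 𝓘(ℝ, E) (𝒬.proj q)) : TangentSpace 𝓘(ℝ, F) q :=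
  ((𝒬.dproj q).prod (𝒬.σ q)).inverse (X, 0)

/-- The fibre at `q` of the Dirac-Jacobi structure `L̄` on `Q`: the sum of
`{(X^H + ⟨X ⊕ ξ, β⟩ E, 0) ⊕ (π^*ξ, 0) : X ⊕ ξ ∈ L}` and of the lines generated by
`(-E, 0) ⊕ (0, 1)` and `(-A^H, 1) ⊕ (σ - π^*α, 0)`, where `A ⊕ α` is isotropic and
`β = 2⟨A ⊕ α, ·⟩₊` on `L`.  Different choices of `A ⊕ α` differ by elements of `ker β ⊆ L` and
therefore give the same sum, so that all of them may be included. -/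
def Lbar (q : Q) : Submodule ℝ (ExtGeneralized F q) :=
  Submodule.span ℝ
      {w | ∃ a : L.fiber (𝒬.proj q),
        w = ((𝒬.horLift q a.1.1 + 𝒬.β _ a • generator F q, 0), (a.1.2.comp (𝒬.dproj q), 0))}
    ⊔ Submodule.span ℝ {((-generator F q, 0), (0, 1))}
    ⊔ Submodule.span ℝ
      {w | ∃ c : Generalized E (𝒬.proj q), pairPlus c c = 0 ∧
        (∀ a : L.fiber (𝒬.proj q), 𝒬.β _ a = 2 * pairPlus c a.1) ∧
        w = ((-𝒬.horLift q c.1, 1), (𝒬.σ q - c.2.comp (𝒬.dproj q), 0))}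

/-- `(X, u)` is a hamiltonian pair `(X_h, φ_h)` of the function `h` on the Dirac-Jacobi manifold
`(Q, L̄)`: `X` and `u` are smooth and `(X, u) ⊕ (dh, h)` is a section of `L̄`. -/
def IsHamiltonianPair (X : ∀ q : Q, TangentSpace 𝓘(ℝ, F) q) (u : Q → ℝ) (h : Q → ℝ) : Prop :=
  SmoothFieldOn X Set.univ ∧ ContMDiff 𝓘(ℝ, F) 𝓘(ℝ, ℝ) ∞ u ∧
    ∀ q, ((X q, u q), (mvfderiv 𝓘(ℝ, F) h q, h q)) ∈ 𝒬.Lbar q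

/-- The set `π⁻¹(U)`, as a type. -/
def Over (U : TopologicalSpace.Opens P) : Type _ := {q : Q // 𝒬.proj q ∈ U}

variable {𝒬} in
/-- A complex function on `π⁻¹(U)`, extended by zero; only its values on the open set
`π⁻¹(U)` are relevant. -/
def ext {U : TopologicalSpace.Opens P} (φ : 𝒬.Over U → ℂ) : Q → ℂ :=
  Function.extend (Subtype.val : 𝒬.Over U → Q) φ 0

variable {𝒬} in
/-- Smoothness of a complex function on `π⁻¹(U)`. -/
def IsSmooth {U : TopologicalSpace.Opens P} (φ : 𝒬.Over U → ℂ) : Prop :=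
  ContMDiffOn 𝓘(ℝ, F) 𝓘(ℝ, ℂ) ∞ (ext φ) (𝒬.proj ⁻¹' U)

variable {𝒬} in
/-- The differential at `q` of a complex function on `π⁻¹(U)`. -/
def der {U : TopologicalSpace.Opens P} (φ : 𝒬.Over U → ℂ) (q : 𝒬.Over U) :
    TangentSpace 𝓘(ℝ, F) q.1 →L[ℝ] ℂ :=
  mvfderiv 𝓘(ℝ, F) (ext φ) q.1

variable {𝒬} in
/-- A function `φ` on `π⁻¹(U)` is basic if it is smooth and `X · φ + φ f = 0` for all elements
`(X, f)` of `L̄ ∩ (TQ × ℝ)`. -/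
def IsBasic {U : TopologicalSpace.Opens P} (φ : 𝒬.Over U → ℂ) : Prop :=
  IsSmooth φ ∧ ∀ (q : 𝒬.Over U) (X : TangentSpace 𝓘(ℝ, F) q.1) (f : ℝ),
    (((X, f), (0, 0)) : ExtGeneralized F q.1) ∈ 𝒬.Lbar q.1 → der φ q X + φ q * f = 0

/-! ### Basic functions form a sheaf of algebras -/

section Helpers

variable {U V : TopologicalSpace.Opens P}

lemma isOpen_over : IsOpen (𝒬.proj ⁻¹' (U : Set P)) :=
  U.isOpen.preimage 𝒬.contMDiff_proj.continuous

variable {𝒬}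

lemma ext_apply (φ : 𝒬.Over U → ℂ) (q : 𝒬.Over U) : ext φ q.1 = φ q :=
  Subtype.val_injective.extend_apply φ 0 q

lemma IsSmooth.mdifferentiableAt {φ : 𝒬.Over U → ℂ} (h : IsSmooth φ) (q : 𝒬.Over U) :
    MDifferentiableAt 𝓘(ℝ, F) 𝓘(ℝ, ℂ) (ext φ) q.1 :=
  (h.contMDiffAt (𝒬.isOpen_over.mem_nhds q.2)).mdifferentiableAt (by simp)

lemma ext_add (φ ψ : 𝒬.Over U → ℂ) : ext (φ + ψ) = ext φ + ext ψ := by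
  funext q
  by_cases h : 𝒬.proj q ∈ U
  · change ext (φ + ψ) q = ext φ q + ext ψ q
    rw [show ext (φ + ψ) q = _ from ext_apply (φ + ψ) ⟨q, h⟩,
      show ext φ q = _ from ext_apply φ ⟨q, h⟩, show ext ψ q = _ from ext_apply ψ ⟨q, h⟩]
    rfl
  · have h' : ¬ ∃ a : 𝒬.Over U, a.1 = q := by rintro ⟨a, rfl⟩; exact h a.2
    have h0 : ∀ χ : 𝒬.Over U → ℂ, ext χ q = 0 := fun χ => Function.extend_apply' _ _ _ h'
    change ext (φ + ψ) q = ext φ q + ext ψ q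
    simp [h0]

lemma ext_mul (φ ψ : 𝒬.Over U → ℂ) : ext (φ * ψ) = ext φ * ext ψ := by
  funext q
  by_cases h : 𝒬.proj q ∈ U
  · change ext (φ * ψ) q = ext φ q * ext ψ q
    rw [show ext (φ * ψ) q = _ from ext_apply (φ * ψ) ⟨q, h⟩,
      show ext φ q = _ from ext_apply φ ⟨q, h⟩, show ext ψ q = _ from ext_apply ψ ⟨q, h⟩]
    rfl
  · have h' : ¬ ∃ a : 𝒬.Over U, a.1 = q := by rintro ⟨a, rfl⟩; exact h a.2
    have h0 : ∀ χ : 𝒬.Over U → ℂ, ext χ q = 0 := fun χ => Function.extend_apply' _ _ _ h'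
    change ext (φ * ψ) q = ext φ q * ext ψ q
    simp [h0]

lemma ext_eqOn {φ : 𝒬.Over U → ℂ} {g : Q → ℂ} (h : ∀ q : 𝒬.Over U, φ q = g q.1) :
    Set.EqOn (ext φ) g (𝒬.proj ⁻¹' U) := fun q hq =>
  (ext_apply φ ⟨q, hq⟩).trans (h ⟨q, hq⟩)

lemma der_eq_of_forall {φ : 𝒬.Over U → ℂ} {g : Q → ℂ} (h : ∀ q : 𝒬.Over U, φ q = g q.1)
    (q : 𝒬.Over U) : der φ q = mvfderiv 𝓘(ℝ, F) g q.1 := by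
  have e : ext φ =ᶠ[𝓝 q.1] g := (ext_eqOn h).eventuallyEq_of_mem (𝒬.isOpen_over.mem_nhds q.2)
  unfold der mvfderiv
  rw [e.eq_of_nhds, e.mfderiv_eq]

lemma der_add {φ ψ : 𝒬.Over U → ℂ} (hφ : IsSmooth φ) (hψ : IsSmooth ψ) (q : 𝒬.Over U) :
    der (φ + ψ) q = der φ q + der ψ q := by
  unfold der
  rw [ext_add]
  exact mvfderiv_add (hφ.mdifferentiableAt q) (hψ.mdifferentiableAt q)

lemma der_mul {φ ψ : 𝒬.Over U → ℂ} (hφ : IsSmooth φ) (hψ : IsSmooth ψ) (q : 𝒬.Over U)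
    (v : TangentSpace 𝓘(ℝ, F) q.1) :
    der (φ * ψ) q v = φ q * der ψ q v + ψ q * der φ q v := by
  have h := ((hφ.mdifferentiableAt q).hasMFDerivAt.mul
    (hψ.mdifferentiableAt q).hasMFDerivAt).mfderiv
  rw [← ext_mul] at h
  have h' : der (φ * ψ) q v = ext φ q.1 * der ψ q v + ext ψ q.1 * der φ q v :=
    congrArg (fun T : F →L[ℝ] ℂ => T v) h
  rwa [ext_apply φ, ext_apply ψ] at h'

lemma isSmooth_const (c : ℂ) : IsSmooth (fun _ : 𝒬.Over U => c) :=
  contMDiffOn_const.congr (ext_eqOn (g := fun _ => c) fun _ => rfl)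

lemma der_const (c : ℂ) (q : 𝒬.Over U) : der (fun _ : 𝒬.Over U => c) q = 0 := by
  rw [der_eq_of_forall (g := fun _ => c) (fun _ => rfl)]
  exact mvfderiv_const c

lemma IsSmooth.add {φ ψ : 𝒬.Over U → ℂ} (hφ : IsSmooth φ) (hψ : IsSmooth ψ) :
    IsSmooth (φ + ψ) := by
  unfold IsSmooth; rw [ext_add]; exact ContMDiffOn.add hφ hψ

lemma IsSmooth.mul {φ ψ : 𝒬.Over U → ℂ} (hφ : IsSmooth φ) (hψ : IsSmooth ψ) :
    IsSmooth (φ * ψ) := by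
  unfold IsSmooth; rw [ext_mul]
  exact (contDiff_mul (𝕜 := ℝ) (𝔸 := ℂ) (n := ∞)).contMDiff.comp_contMDiffOn
    (ContMDiffOn.prodMk_space hφ hψ)

variable (𝒬)

/-- The generator of the action is vertical. -/
lemma dproj_generator (q : Q) : 𝒬.dproj q (generator F q) = 0 := by
  have hc : MDifferentiableAt 𝓘(ℝ, ℝ) 𝓘(ℝ, F)
      (fun t : ℝ => Circle.exp (2 * Real.pi * t) • q) (0 : ℝ) := by
    have h1 : ContMDiff 𝓘(ℝ, ℝ) (𝓡 1) ∞ (fun t : ℝ => Circle.exp (2 * Real.pi * t)) :=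
      contMDiff_circleExp.comp (contDiff_const.mul contDiff_id).contMDiff
    have h2 : ContMDiff 𝓘(ℝ, ℝ) 𝓘(ℝ, F) ∞
        (fun t : ℝ => Circle.exp (2 * Real.pi * t) • q) :=
      𝒬.contMDiff_action.comp (h1.prodMk contMDiff_const)
    exact (h2 0).mdifferentiableAt (by simp)
  have hq : Circle.exp (2 * Real.pi * 0) • q = q := by simp
  have hp : MDifferentiableAt 𝓘(ℝ, F) 𝓘(ℝ, E) 𝒬.proj q :=
    (𝒬.contMDiff_proj q).mdifferentiableAt (by simp)
  have key := mfderiv_comp_of_eq (x := (0 : ℝ)) (I := 𝓘(ℝ, ℝ)) (I' := 𝓘(ℝ, F))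
    (I'' := 𝓘(ℝ, E)) (y := q) hp hc hq
  rw [hq] at key
  have hconst : (𝒬.proj ∘ fun t : ℝ => Circle.exp (2 * Real.pi * t) • q)
      = fun _ => 𝒬.proj q := by
    funext t; exact 𝒬.proj_smul _ _
  rw [hconst, mfderiv_const] at key
  exact (congrArg (fun T : ℝ →L[ℝ] E => T 1) key).symm

/-- An element `(X, f) ⊕ (ξ, g)` of `L̄` satisfies `ξ(E) = f`. -/
lemma apply_generator_of_mem_Lbar {q : Q} {w : ExtGeneralized F q} (hw : w ∈ 𝒬.Lbar q) :
    w.2.1 (generator F q) = w.1.2 := by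
  let W : Submodule ℝ (ExtGeneralized F q) :=
    { carrier := {w | w.2.1 (generator F q) = w.1.2}
      zero_mem' := by simp
      add_mem' := by
        intro a b ha hb
        simp only [Set.mem_ofPred_eq] at ha hb ⊢
        simp [ha, hb]
      smul_mem' := by
        intro c a ha
        simp only [Set.mem_ofPred_eq] at ha ⊢
        simp [ha] }
  have hE := 𝒬.dproj_generator q
  have hσ := 𝒬.isConnectionForm.apply_generator q
  have hle : 𝒬.Lbar q ≤ W := by
    refine sup_le (sup_le (Submodule.span_le.2 ?_) (Submodule.span_le.2 ?_))
      (Submodule.span_le.2 ?_)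
    · rintro _ ⟨a, rfl⟩
      change (a.1.2.comp (𝒬.dproj q)) (generator F q) = 0
      simp [hE]
    · rintro _ rfl
      change (0 : Cotangent F q) (generator F q) = 0
      simp
    · rintro _ ⟨c, -, -, rfl⟩
      change (𝒬.σ q - c.2.comp (𝒬.dproj q)) (generator F q) = 1
      simp [hE, hσ]
  exact hle hw

/-- `L̄ ∩ (TQ × ℝ)` is contained in `TQ`. -/
lemma eq_zero_of_mem_Lbar {q : Q} {X : TangentSpace 𝓘(ℝ, F) q} {f : ℝ}
    (h : (((X, f), (0, 0)) : ExtGeneralized F q) ∈ 𝒬.Lbar q) : f = 0 := by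
  simpa using (𝒬.apply_generator_of_mem_Lbar h).symm

/-- The algebra `C^∞_bas(π⁻¹(U), ℂ)` of complex basic functions on `π⁻¹(U)`, i.e. the sections
over `U` of the sheaf `C^∞_bas(Q, ℂ)_{P-loc}`. -/
def Bas (U : TopologicalSpace.Opens P) : Subalgebra ℂ (𝒬.Over U → ℂ) where
  carrier := {φ | IsBasic φ}
  algebraMap_mem' c := by
    refine ⟨isSmooth_const c, fun q X f h => ?_⟩
    have h0 := 𝒬.eq_zero_of_mem_Lbar h
    have : der ((algebraMap ℂ (𝒬.Over U → ℂ)) c) q = 0 := der_const c q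
    simp [this, h0]
  add_mem' := by
    rintro φ ψ ⟨hφ, hφ'⟩ ⟨hψ, hψ'⟩
    refine ⟨hφ.add hψ, fun q X f h => ?_⟩
    have h1 := hφ' q X f h
    have h2 := hψ' q X f h
    rw [der_add hφ hψ, add_apply, Pi.add_apply]
    linear_combination h1 + h2
  mul_mem' := by
    rintro φ ψ ⟨hφ, hφ'⟩ ⟨hψ, hψ'⟩
    refine ⟨hφ.mul hψ, fun q X f h => ?_⟩
    have h1 := hφ' q X f h
    have h2 := hψ' q X f h
    have h0 := 𝒬.eq_zero_of_mem_Lbar h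
    subst h0
    rw [der_mul hφ hψ]
    simp only [Complex.ofReal_zero, mul_zero, add_zero] at h1 h2 ⊢
    simp [h1, h2]

variable {𝒬}

/-- Restriction of functions from `π⁻¹(U)` to `π⁻¹(V)`. -/
def resFun (h : V ≤ U) (φ : 𝒬.Over U → ℂ) : 𝒬.Over V → ℂ := fun q => φ ⟨q.1, h q.2⟩

lemma isBasic_resFun (h : V ≤ U) {φ : 𝒬.Over U → ℂ} (hφ : IsBasic φ) :
    IsBasic (resFun h φ) := by
  have e : ∀ q : 𝒬.Over V, resFun h φ q = ext φ q.1 := fun q => (ext_apply φ ⟨q.1, h q.2⟩).symm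
  refine ⟨?_, fun q X f hX => ?_⟩
  · exact (ContMDiffOn.mono hφ.1 (Set.preimage_mono h)).congr (ext_eqOn e)
  · rw [der_eq_of_forall e]
    exact hφ.2 ⟨q.1, h q.2⟩ X f hX

variable (𝒬) in
/-- The restriction map of the sheaf of complex basic functions. -/
def res (h : V ≤ U) : 𝒬.Bas U →ₐ[ℂ] 𝒬.Bas V where
  toFun φ := ⟨resFun h φ.1, isBasic_resFun h φ.2⟩
  map_one' := rfl
  map_mul' _ _ := rfl
  map_zero' := rfl
  map_add' _ _ := rfl
  commutes' _ := rfl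

end Helpers

/-- The derivations `Der(C^∞_bas(Q, ℂ)_{P-loc})` of the sheaf of complex basic functions:
families of `ℂ`-linear derivations of the algebras of sections that are compatible with the
restriction maps.  The vector space operations and the Lie bracket (the commutator) are those of
the derivations of each algebra of sections. -/
structure SheafDer where
  app : ∀ U : TopologicalSpace.Opens P, Derivation ℂ (𝒬.Bas U) (𝒬.Bas U)
  res_app : ∀ (U V : TopologicalSpace.Opens P) (h : V ≤ U) (φ : 𝒬.Bas U),
    app V (𝒬.res h φ) = 𝒬.res h (app U φ)

/-- The space `H^n_bas` over `U`: the eigenspace of the generator `E` of the `U(1)`-action on the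
complex basic functions on `π⁻¹(U)` for the eigenvalue `2πin`. -/
def eigenspace (n : ℤ) (U : TopologicalSpace.Opens P) : Submodule ℂ (𝒬.Bas U) where
  carrier := {φ | ∀ q : 𝒬.Over U,
    der φ.1 q (generator F q.1) = 2 * Real.pi * Complex.I * n * φ.1 q}
  zero_mem' := by
    intro q
    have : der (0 : 𝒬.Over U → ℂ) q = 0 := der_const 0 q
    simp [this]
  add_mem' := by
    intro φ ψ hφ hψ q
    change der (φ.1 + ψ.1) q _ = _ * (φ.1 q + ψ.1 q)
    rw [der_add φ.2.1 ψ.2.1, add_apply, hφ q, hψ q, mul_add]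
  smul_mem' := by
    intro c φ hφ q
    change der ((fun _ : 𝒬.Over U => c) * φ.1) q _ = _ * (c * φ.1 q)
    rw [der_mul (isSmooth_const c) φ.2.1, hφ q, der_const]
    simp
    ring

variable {𝒬} in
/-- `φ(z · q) = z⁻¹ φ(q)` for `z ∈ U(1)`. The smooth functions on `π⁻¹(U)` with this property are
the smooth sections over `U` of the hermitian line bundle `K = Q ×_{U(1)} ℂ`, where `φ`
corresponds to the section `s` with `s(π(q)) = [q, φ(q)]`. -/
def IsAntiequivariant {U : TopologicalSpace.Opens P} (φ : 𝒬.Over U → ℂ) : Prop :=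
  ∀ (z : Circle) (q : 𝒬.Over U),
    φ ⟨z • q.1, (𝒬.proj_smul z q.1).symm ▸ q.2⟩ = (z : ℂ)⁻¹ * φ q

variable {𝒬} in
/-- The covariant derivative `∇_X` on `K` that the connection form `σ` induces, in terms of
antiequivariant functions: the derivative along the horizontal lift of `X`. -/
def covDer {U : TopologicalSpace.Opens P} (φ : 𝒬.Over U → ℂ) (q : 𝒬.Over U)
    (X : TangentSpace 𝓘(ℝ, E) (𝒬.proj q.1)) : ℂ :=
  der φ q (𝒬.horLift q.1 X)

variable {𝒬} in
/-- The `L`-connection `D_a = ∇_{ρ(a)} - 2πi ⟨a, β⟩` on `K`, in terms of antiequivariant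
functions. -/
def connL {U : TopologicalSpace.Opens P} (φ : 𝒬.Over U → ℂ) (q : 𝒬.Over U)
    (a : L.fiber (𝒬.proj q.1)) : ℂ :=
  covDer φ q a.1.1 - 2 * Real.pi * Complex.I * 𝒬.β _ a * φ q

end Prequantization

end Prequantization

end DiracPrequantization

end

open DiracPrequantization

noncomputable section

namespace DiracPrequantization

/-! Everything on `Q` is expressed through vector fields of the form `V = X^H + u E`. Such a field
is determined by `X` and `u`, because `(π_*, σ)` is an isomorphism on each tangent space
(`dprojσ_bijective`, `tangent_ext`). Cartan's formula for `dσ = π^*Ω` shows that the bracket of two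
such fields lifts `[X, Y]` and has vertical part `V·w - W·u - Ω(X, Y)` (`IsLift.mlieBracket`). If
`X`, `Y` come from sections `a`, `b` of `L` and the vertical parts are `⟨a, β⟩ + f` and `⟨b, β⟩ +
g`, then `ρ^*Ω = Υ + d_L β` turns this into `⟨[a, b], β⟩ + ρ(a)·g - ρ(b)·f - Υ(a, b)`
(`IsLift.mlieBracket_sections`).

On `P`, isotropy reduces the Courant bracket of `X_g ⊕ dg` with `Y ⊕ η` to `[X_g, Y] ⊕ L_{X_g} η`
(`IsHamiltonian.courant_eq`). So `[X_g, X_f]` is a hamiltonian field of `{f, g}`; isotropy also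
makes the bracket skew and independent of choices, and the Jacobi identity is the commutator
formula. On `Q`, the function `π^*g` has the pair consisting of `X_g^H + (⟨X_g ⊕ dg, β⟩ - g) E` and
`0`. Two pairs differ by an element of `L̄ ∩ (TQ × ℝ)`, which annihilates basic functions, so all
pairs act alike (`der_hamLift`). The bracket formula shows that these lifts close up under brackets
exactly as the functions do (`mlieBracket_admLift`); this is the representation property.

The hard point is that the operators preserve basic functions (`isBasic_der_hamLift`). Basic means
annihilated by the lifts of `L ∩ TP` (`mem_Lbar_pure`), but the rank of `L ∩ TP` may jump, so its
elements need not extend to sections of it, and commuting vector fields is not enough. Instead, take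
a frame `a_i = Y_i ⊕ η_i` of `L` and follow an integral curve of the hamiltonian lift `V`. The
brackets of `X_g ⊕ dg` with the frame are combinations of the frame, so the `η_i` and the
derivatives of `φ` along the lifts of the `a_i` satisfy linear differential equations with the same
coefficient matrix, the second one having `V·φ` as a source. A relation `∑ s_i η_i = 0` is an
element of `L ∩ TP`; transported by the dual equation it remains a relation, along which `φ` has
derivative zero, and differentiating this at time zero gives the claim for `V·φ`
(`transport_kernel`, `transport_frame`).

The decomposition is Fourier analysis on the orbits. The coefficients are integrals over the circle;
they are smooth by differentiation under the integral sign, and basic because the action preserves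
`L ∩ TP`, `β` and `σ`. Two derivatives along `E` give decay of order `n⁻²`, hence absolute
convergence (`summable_coef`, `hasSum_coef`). Any other decomposition has the same terms by
dominated convergence (`coef_eq_of_hasSum`). The hamiltonian lifts are invariant under the circle
and so commute with taking coefficients. For `n = -1`, the derivative along `E` is multiplication by
`-2πi`, which turns the derivative along `X^H + ⟨a, β⟩ E` into `D_a` (`connL_eq`). -/

lemma two_le_infty : (2 : ℕ∞ω) ≤ ∞ :=
  WithTop.coe_le_coe.2 (le_top : (2 : ℕ∞) ≤ ⊤)

lemma three_le_infty : (3 : ℕ∞ω) ≤ ∞ :=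
  WithTop.coe_le_coe.2 (le_top : (3 : ℕ∞) ≤ ⊤)

/-! ### Vector fields, 1-forms and brackets in charts -/

section ChartCalculus

variable {E : Type*} [NormedAddCommGroup E] [NormedSpace ℝ E]
  {P : Type*} [TopologicalSpace P] [ChartedSpace E P]

/-- The differential at `p` of the preferred chart at `x`, as an endomorphism of the model. -/
def chartDer (E : Type*) [NormedAddCommGroup E] [NormedSpace ℝ E]
    {P : Type*} [TopologicalSpace P] [ChartedSpace E P] (x p : P) : E →L[ℝ] E :=
  let A : E →L[ℝ] E := mfderiv 𝓘(ℝ, E) 𝓘(ℝ, E) (extChartAt 𝓘(ℝ, E) x) p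
  A

/-- The differential at `y` of the inverse of the preferred chart at `x`. -/
def chartSymmDer (E : Type*) [NormedAddCommGroup E] [NormedSpace ℝ E]
    {P : Type*} [TopologicalSpace P] [ChartedSpace E P] (x : P) (y : E) : E →L[ℝ] E :=
  let A : E →L[ℝ] E := mfderiv 𝓘(ℝ, E) 𝓘(ℝ, E) (extChartAt 𝓘(ℝ, E) x).symm y
  A

/-- The vector field `X` in the preferred chart at `x`. -/
def chartField (x : P) (X : ∀ p : P, TangentSpace 𝓘(ℝ, E) p) (y : E) : E :=
  let p := (extChartAt 𝓘(ℝ, E) x).symm y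
  chartDer E x p (X p)

/-- The 1-form `ξ` in the preferred chart at `x`. -/
def chartForm (x : P) (ξ : ∀ p : P, Cotangent E p) (y : E) : E →L[ℝ] ℝ :=
  let A : E →L[ℝ] ℝ := ξ ((extChartAt 𝓘(ℝ, E) x).symm y)
  A.comp (chartSymmDer E x y)

variable [IsManifold 𝓘(ℝ, E) ∞ P]

lemma mdifferentiableAt_chart {x p : P} (hp : p ∈ (extChartAt 𝓘(ℝ, E) x).source) :
    MDifferentiableAt 𝓘(ℝ, E) 𝓘(ℝ, E) (extChartAt 𝓘(ℝ, E) x) p :=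
  ((contMDiffAt_extChartAt' (n := ∞) (by simpa using hp)).mdifferentiableAt (by simp))

lemma contMDiffOn_chart_symm (x : P) :
    ContMDiffOn 𝓘(ℝ, E) 𝓘(ℝ, E) ∞ (extChartAt 𝓘(ℝ, E) x).symm (extChartAt 𝓘(ℝ, E) x).target :=
  contMDiffOn_extChartAt_symm x

lemma mdifferentiableAt_chart_symm {x : P} {y : E} (hy : y ∈ (extChartAt 𝓘(ℝ, E) x).target) :
    MDifferentiableAt 𝓘(ℝ, E) 𝓘(ℝ, E) (extChartAt 𝓘(ℝ, E) x).symm y :=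
  ((contMDiffOn_chart_symm x).contMDiffAt
    ((isOpen_extChartAt_target x).mem_nhds hy)).mdifferentiableAt (by simp)

lemma chartSymmDer_chartDer {x p : P} (hp : p ∈ (extChartAt 𝓘(ℝ, E) x).source) (v : E) :
    chartSymmDer E x (extChartAt 𝓘(ℝ, E) x p) (chartDer E x p v) = v := by
  have h1 := mdifferentiableAt_chart hp
  have h2 := mdifferentiableAt_chart_symm ((extChartAt 𝓘(ℝ, E) x).map_source hp)
  have h := mfderiv_comp p h2 h1
  have e : ((extChartAt 𝓘(ℝ, E) x).symm ∘ extChartAt 𝓘(ℝ, E) x) =ᶠ[𝓝 p] id := by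
    filter_upwards [(isOpen_extChartAt_source x).mem_nhds hp] with q hq
    exact (extChartAt 𝓘(ℝ, E) x).left_inv hq
  rw [e.mfderiv_eq, mfderiv_id] at h
  exact (congrArg (fun T : E →L[ℝ] E => T v) h).symm

lemma chartDer_chartSymmDer {x : P} {y : E} (hy : y ∈ (extChartAt 𝓘(ℝ, E) x).target) (v : E) :
    chartDer E x ((extChartAt 𝓘(ℝ, E) x).symm y) (chartSymmDer E x y v) = v := by
  have h1 := mdifferentiableAt_chart_symm hy
  have h2 := mdifferentiableAt_chart ((extChartAt 𝓘(ℝ, E) x).map_target hy)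
  have h := mfderiv_comp y h2 h1
  have e : (extChartAt 𝓘(ℝ, E) x ∘ (extChartAt 𝓘(ℝ, E) x).symm) =ᶠ[𝓝 y] id := by
    filter_upwards [(isOpen_extChartAt_target x).mem_nhds hy] with q hq
    exact (extChartAt 𝓘(ℝ, E) x).right_inv hq
  rw [e.mfderiv_eq, mfderiv_id] at h
  exact (congrArg (fun T : E →L[ℝ] E => T v) h).symm

/-- Smoothness of sections is defined through bundle trivializations; this and
`trivializationAt_snd` identify those of the tangent bundle with differentials of charts. -/
lemma mfderiv_chart_symm_eq {x p : P} (hp : p ∈ (extChartAt 𝓘(ℝ, E) x).source) (v : E) :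
    chartSymmDer E x (extChartAt 𝓘(ℝ, E) x p) v =
      Bundle.Trivialization.symmL ℝ (trivializationAt E (TangentSpace 𝓘(ℝ, E)) x) p v := by
  have : IsManifold 𝓘(ℝ, E) 1 P := .of_le (n := ∞) (by simp)
  rw [extChartAt_source] at hp
  have h := TangentBundle.symmL_trivializationAt (I := 𝓘(ℝ, E)) hp
  simp only [modelWithCornersSelf_coe, Set.range_id, mfderivWithin_univ] at h
  exact (congrArg (fun T : E →L[ℝ] E => T v) h).symm

lemma trivializationAt_snd {x p : P} (hp : p ∈ (extChartAt 𝓘(ℝ, E) x).source)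
    (v : TangentSpace 𝓘(ℝ, E) p) :
    (trivializationAt E (TangentSpace 𝓘(ℝ, E)) x (Bundle.TotalSpace.mk' E p v)).2
      = chartDer E x p v := by
  have : IsManifold 𝓘(ℝ, E) 1 P := .of_le (n := ∞) (by simp)
  rw [extChartAt_source] at hp
  have h := TangentBundle.continuousLinearMapAt_trivializationAt (I := 𝓘(ℝ, E)) hp
  have h' := congrArg (fun T : E →L[ℝ] E => T v) h
  refine Eq.trans ?_ h'
  have h3 := congrFun (Bundle.Trivialization.continuousLinearMapAt_apply ℝ
    (trivializationAt E (TangentSpace 𝓘(ℝ, E)) x) p) v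
  refine Eq.trans ?_ h3.symm
  rw [Bundle.Trivialization.coe_linearMapAt_of_mem]
  simpa using hp

/-- A vector field is smooth iff it is so in the chart. -/
lemma smoothFieldOn_iff {X : ∀ p : P, TangentSpace 𝓘(ℝ, E) p} {s : Set P}
    (hs : IsOpen s) {x : P} (hsx : s ⊆ (extChartAt 𝓘(ℝ, E) x).source) :
    SmoothFieldOn X s ↔ ContMDiffOn 𝓘(ℝ, E) 𝓘(ℝ, E) ∞ (fun p => chartDer E x p (X p)) s := by
  have := fun p hp => trivializationAt_snd (hsx hp) (X p)
  rw [← contMDiffOn_congr this]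
  exact Bundle.Trivialization.contMDiffOn_section_iff (n := ∞) (IB := 𝓘(ℝ, E)) (s := X) (a := s)
    (trivializationAt E (TangentSpace 𝓘(ℝ, E) : P → Type _) x) hs (by simpa using hsx)

omit [IsManifold 𝓘(ℝ, E) ∞ P] in
lemma chartField_chart {x p : P} (hp : p ∈ (extChartAt 𝓘(ℝ, E) x).source)
    (X : ∀ p : P, TangentSpace 𝓘(ℝ, E) p) :
    chartField x X (extChartAt 𝓘(ℝ, E) x p) = chartDer E x p (X p) := by
  change (fun q => chartDer E x q (X q)) _ = _
  rw [(extChartAt 𝓘(ℝ, E) x).left_inv hp]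

/-- The part of the chart target that lies over `s`. -/
def chartDom (x : P) (s : Set P) : Set E :=
  (extChartAt 𝓘(ℝ, E) x).target ∩ (extChartAt 𝓘(ℝ, E) x).symm ⁻¹' s

omit [IsManifold 𝓘(ℝ, E) ∞ P] in
lemma isOpen_chartDom (x : P) {s : Set P} (hs : IsOpen s) :
    IsOpen (chartDom (E := E) x s) :=
  (continuousOn_extChartAt_symm x).isOpen_inter_preimage (isOpen_extChartAt_target x) hs

omit [IsManifold 𝓘(ℝ, E) ∞ P] in
lemma mem_chartDom {x p : P} {s : Set P} (hp : p ∈ (extChartAt 𝓘(ℝ, E) x).source) (hs : p ∈ s) :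
    extChartAt 𝓘(ℝ, E) x p ∈ chartDom (E := E) x s := by
  refine ⟨(extChartAt 𝓘(ℝ, E) x).map_source hp, ?_⟩
  rw [Set.mem_preimage, (extChartAt 𝓘(ℝ, E) x).left_inv hp]
  exact hs

lemma contDiffOn_chart {G : Type*} [NormedAddCommGroup G] [NormedSpace ℝ G] {f : P → G} {s : Set P}
    (hf : ContMDiffOn 𝓘(ℝ, E) 𝓘(ℝ, G) ∞ f s) (x : P) :
    ContDiffOn ℝ ∞ (f ∘ (extChartAt 𝓘(ℝ, E) x).symm) (chartDom x s) := by
  rw [← contMDiffOn_iff_contDiffOn]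
  exact hf.comp ((contMDiffOn_chart_symm x).mono Set.inter_subset_left) Set.inter_subset_right

lemma contMDiffOn_of_chart {G : Type*} [NormedAddCommGroup G] [NormedSpace ℝ G] {f : P → G}
    {s : Set P} {x : P} (hsx : s ⊆ (extChartAt 𝓘(ℝ, E) x).source) {g : E → G}
    (hg : ContDiffOn ℝ ∞ g (chartDom x s))
    (hfg : ∀ p ∈ s, f p = g (extChartAt 𝓘(ℝ, E) x p)) :
    ContMDiffOn 𝓘(ℝ, E) 𝓘(ℝ, G) ∞ f s := by
  refine (ContMDiffOn.comp (g := g) (contMDiffOn_iff_contDiffOn.2 hg)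
    (contMDiffOn_extChartAt.mono ?_) fun p hp => mem_chartDom (hsx hp) hp).congr hfg
  simpa using hsx

lemma contDiffOn_chartField {X : ∀ p : P, TangentSpace 𝓘(ℝ, E) p} {s : Set P} (hs : IsOpen s)
    (hX : SmoothFieldOn X s) (x : P) : ContDiffOn ℝ ∞ (chartField x X) (chartDom x s) := by
  have ho := hs.inter (isOpen_extChartAt_source (I := 𝓘(ℝ, E)) x)
  have h1 : SmoothFieldOn X (s ∩ (extChartAt 𝓘(ℝ, E) x).source) :=
    ContMDiffOn.mono hX Set.inter_subset_left
  refine (contDiffOn_chart ((smoothFieldOn_iff ho Set.inter_subset_right).1 h1) x).mono ?_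
  exact fun y hy => ⟨hy.1, hy.2, (extChartAt 𝓘(ℝ, E) x).map_target hy.1⟩

/-- The differential of a vector valued function, as a continuous linear map on the model. -/
def pder {G : Type*} [NormedAddCommGroup G] [NormedSpace ℝ G] (f : P → G) (p : P) : E →L[ℝ] G :=
  let A : E →L[ℝ] G := mfderiv 𝓘(ℝ, E) 𝓘(ℝ, G) f p
  A

lemma pder_eq {G : Type*} [NormedAddCommGroup G] [NormedSpace ℝ G] {f : P → G} {x p : P}
    (hf : MDifferentiableAt 𝓘(ℝ, E) 𝓘(ℝ, G) f p) (hp : p ∈ (extChartAt 𝓘(ℝ, E) x).source) (v : E) :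
    pder f p v = fderiv ℝ (f ∘ (extChartAt 𝓘(ℝ, E) x).symm) (extChartAt 𝓘(ℝ, E) x p)
      (chartDer E x p v) := by
  have hy := (extChartAt 𝓘(ℝ, E) x).map_source hp
  have h2 := mdifferentiableAt_chart_symm hy
  have h := mfderiv_comp_of_eq (x := extChartAt 𝓘(ℝ, E) x p) (y := p) hf h2
    ((extChartAt 𝓘(ℝ, E) x).left_inv hp)
  rw [mfderiv_eq_fderiv, (extChartAt 𝓘(ℝ, E) x).left_inv hp] at h
  have h' := congrArg (fun T : E →L[ℝ] G => T (chartDer E x p v)) h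
  refine Eq.trans ?_ h'.symm
  exact congrArg (pder f p) (chartSymmDer_chartDer hp v).symm

omit [IsManifold 𝓘(ℝ, E) ∞ P] in
lemma contMDiffOn_mdifferentiableAt {G : Type*} [NormedAddCommGroup G] [NormedSpace ℝ G] {f : P → G}
    {s : Set P} (hs : IsOpen s) (hf : ContMDiffOn 𝓘(ℝ, E) 𝓘(ℝ, G) ∞ f s) {p : P} (hp : p ∈ s) :
    MDifferentiableAt 𝓘(ℝ, E) 𝓘(ℝ, G) f p :=
  (hf.contMDiffAt (hs.mem_nhds hp)).mdifferentiableAt (by simp)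

/-- The derivative of a smooth function along a smooth vector field is smooth. -/
lemma SmoothFieldOn.contMDiffOn_mvfderiv {G : Type*} [NormedAddCommGroup G] [NormedSpace ℝ G]
    {f : P → G} {s : Set P} {X : ∀ p : P, TangentSpace 𝓘(ℝ, E) p} (hs : IsOpen s)
    (hX : SmoothFieldOn X s) (hf : ContMDiffOn 𝓘(ℝ, E) 𝓘(ℝ, G) ∞ f s) :
    ContMDiffOn 𝓘(ℝ, E) 𝓘(ℝ, G) ∞ (fun p => mvfderiv 𝓘(ℝ, E) f p (X p)) s := by
  suffices H : ∀ x : P, ContMDiffOn 𝓘(ℝ, E) 𝓘(ℝ, G) ∞ (fun p => mvfderiv 𝓘(ℝ, E) f p (X p))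
      (s ∩ (extChartAt 𝓘(ℝ, E) x).source) by
    intro x hx
    have ho := hs.inter (isOpen_extChartAt_source (I := 𝓘(ℝ, E)) x)
    exact ((H x).contMDiffAt (ho.mem_nhds ⟨hx, mem_extChartAt_source x⟩)).contMDiffWithinAt
  intro x
  refine contMDiffOn_of_chart (x := x) (g := fun y =>
    fderiv ℝ (f ∘ (extChartAt 𝓘(ℝ, E) x).symm) y (chartField x X y)) Set.inter_subset_right ?_ ?_
  · have ho := isOpen_chartDom (E := E) x hs
    refine ContDiffOn.mono (s := chartDom x s) ?_
      (Set.inter_subset_inter_right _ (Set.preimage_mono Set.inter_subset_left))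
    exact ((contDiffOn_chart hf x).fderiv_of_isOpen ho (by simp)).clm_apply
      (contDiffOn_chartField hs hX x)
  · rintro p ⟨hp, hpx⟩
    refine (pder_eq (contMDiffOn_mdifferentiableAt hs hf hp) hpx (X p)).trans ?_
    rw [chartField_chart hpx]

/-- The pairing of a smooth 1-form with a smooth vector field is smooth. -/
lemma SmoothFormOn.apply {X : ∀ p : P, TangentSpace 𝓘(ℝ, E) p} {s : Set P}
    {ξ : ∀ p : P, Cotangent E p} (hξ : SmoothFormOn ξ s) (hX : SmoothFieldOn X s) :
    ContMDiffOn 𝓘(ℝ, E) 𝓘(ℝ, ℝ) ∞ (fun p => ξ p (X p)) s := by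
  have := ContMDiffOn.clm_bundle_apply (F₁ := E) (F₂ := ℝ) (n := ∞)
    (E₁ := (TangentSpace 𝓘(ℝ, E) : P → Type _)) (E₂ := Bundle.Trivial P ℝ) (b := fun p => p)
    (ϕ := ξ) (v := X) (IM := 𝓘(ℝ, E)) (IB := 𝓘(ℝ, E)) (s := s) hξ hX
  exact fun x hx => ((Bundle.contMDiffWithinAt_totalSpace).1 (this x hx)).2

/-- A 1-form is smooth iff it is so in the chart. -/
lemma smoothFormOn_iff {ξ : ∀ p : P, Cotangent E p} {s : Set P}
    (hs : IsOpen s) {x : P} (hsx : s ⊆ (extChartAt 𝓘(ℝ, E) x).source) :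
    SmoothFormOn ξ s ↔ ContMDiffOn 𝓘(ℝ, E) 𝓘(ℝ, E →L[ℝ] ℝ) ∞
      (fun p => (ξ p : E →L[ℝ] ℝ).comp (chartSymmDer E x (extChartAt 𝓘(ℝ, E) x p))) s := by
  have : ∀ p ∈ s, (trivializationAt (E →L[ℝ] ℝ) (fun q : P => TangentSpace 𝓘(ℝ, E) q →L[ℝ] ℝ) x
      (Bundle.TotalSpace.mk' (E →L[ℝ] ℝ)
      (E := fun q : P => TangentSpace 𝓘(ℝ, E) q →L[ℝ] ℝ) p (ξ p))).2 =
      (ξ p : E →L[ℝ] ℝ).comp (chartSymmDer E x (extChartAt 𝓘(ℝ, E) x p)) := by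
    intro p hp
    ext v
    change _ = ξ p (chartSymmDer E x (extChartAt 𝓘(ℝ, E) x p) v)
    rw [mfderiv_chart_symm_eq (hsx hp)]
    have h := hom_trivializationAt_apply (σ := RingHom.id ℝ) (F₁ := E) (F₂ := ℝ)
      (E₁ := (TangentSpace 𝓘(ℝ, E) : P → Type _)) (E₂ := Bundle.Trivial P ℝ) x
      (Bundle.TotalSpace.mk' (E →L[ℝ] ℝ) (E := fun q : P => TangentSpace 𝓘(ℝ, E) q →L[ℝ] ℝ) p (ξ p))
    have h' := congrArg (fun T : P × (E →L[ℝ] ℝ) => T.2 v) h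
    refine h'.trans ?_
    have hb : p ∈ (trivializationAt E (TangentSpace 𝓘(ℝ, E) : P → Type _) x).baseSet := by
      simpa using hsx hp
    change (((Bundle.Trivial.trivialization P ℝ).continuousLinearMapAt ℝ p).comp
      ((ξ p).comp ((trivializationAt E (TangentSpace 𝓘(ℝ, E) : P → Type _) x).symmL ℝ p))) v = _
    rw [Bundle.Trivial.continuousLinearMapAt_trivialization]
    rfl
  rw [← contMDiffOn_congr this]
  refine Bundle.Trivialization.contMDiffOn_section_iff (n := ∞) (IB := 𝓘(ℝ, E)) (s := ξ) (a := s)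
    (trivializationAt (E →L[ℝ] ℝ) (fun q : P => TangentSpace 𝓘(ℝ, E) q →L[ℝ] ℝ) x) hs ?_
  intro p hp
  have hb : p ∈ (trivializationAt E (TangentSpace 𝓘(ℝ, E) : P → Type _) x).baseSet := by
    simpa using hsx hp
  exact ⟨hb, trivial⟩

omit [IsManifold 𝓘(ℝ, E) ∞ P] in
lemma chartForm_chart {x p : P} (hp : p ∈ (extChartAt 𝓘(ℝ, E) x).source)
    (ξ : ∀ p : P, Cotangent E p) :
    chartForm x ξ (extChartAt 𝓘(ℝ, E) x p)
      = (ξ p : E →L[ℝ] ℝ).comp (chartSymmDer E x (extChartAt 𝓘(ℝ, E) x p)) := by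
  change (fun q => (ξ q : E →L[ℝ] ℝ).comp (chartSymmDer E x (extChartAt 𝓘(ℝ, E) x p))) _ = _
  rw [(extChartAt 𝓘(ℝ, E) x).left_inv hp]

lemma contDiffOn_chartForm {ξ : ∀ p : P, Cotangent E p} {s : Set P} (hs : IsOpen s)
    (hξ : SmoothFormOn ξ s) (x : P) : ContDiffOn ℝ ∞ (chartForm x ξ) (chartDom x s) := by
  have ho := hs.inter (isOpen_extChartAt_source (I := 𝓘(ℝ, E)) x)
  have h1 : SmoothFormOn ξ (s ∩ (extChartAt 𝓘(ℝ, E) x).source) :=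
    ContMDiffOn.mono hξ Set.inter_subset_left
  refine ((contDiffOn_chart ((smoothFormOn_iff ho Set.inter_subset_right).1 h1) x).mono ?_).congr ?_
  · exact fun y hy => ⟨hy.1, hy.2, (extChartAt 𝓘(ℝ, E) x).map_target hy.1⟩
  · intro y hy
    have := chartForm_chart ((extChartAt 𝓘(ℝ, E) x).map_target hy.1) ξ
    rw [(extChartAt 𝓘(ℝ, E) x).right_inv hy.1] at this
    rw [this, Function.comp_apply, (extChartAt 𝓘(ℝ, E) x).right_inv hy.1]

/-- The differential of a smooth function is a smooth 1-form. -/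
lemma smoothFormOn_mvfderiv {f : P → ℝ} {s : Set P} (hs : IsOpen s)
    (hf : ContMDiffOn 𝓘(ℝ, E) 𝓘(ℝ, ℝ) ∞ f s) :
    SmoothFormOn (fun p => mvfderiv 𝓘(ℝ, E) f p) s := by
  suffices H : ∀ x : P, SmoothFormOn (fun p => mvfderiv 𝓘(ℝ, E) f p)
      (s ∩ (extChartAt 𝓘(ℝ, E) x).source) by
    intro x hx
    have ho := hs.inter (isOpen_extChartAt_source (I := 𝓘(ℝ, E)) x)
    exact (ContMDiffOn.contMDiffAt (H x)
      (ho.mem_nhds ⟨hx, mem_extChartAt_source x⟩)).contMDiffWithinAt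
  intro x
  have ho := hs.inter (isOpen_extChartAt_source (I := 𝓘(ℝ, E)) x)
  rw [smoothFormOn_iff ho Set.inter_subset_right]
  refine contMDiffOn_of_chart (x := x) (g := fun y =>
    fderiv ℝ (f ∘ (extChartAt 𝓘(ℝ, E) x).symm) y) Set.inter_subset_right ?_ ?_
  · have ho := isOpen_chartDom (E := E) x hs
    refine ContDiffOn.mono (s := chartDom x s) ?_
      (Set.inter_subset_inter_right _ (Set.preimage_mono Set.inter_subset_left))
    exact (contDiffOn_chart hf x).fderiv_of_isOpen ho (by simp)
  · rintro p ⟨hp, hpx⟩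
    ext v
    refine (pder_eq (contMDiffOn_mdifferentiableAt hs hf hp) hpx _).trans ?_
    have := chartDer_chartSymmDer ((extChartAt 𝓘(ℝ, E) x).map_source hpx) v
    rw [(extChartAt 𝓘(ℝ, E) x).left_inv hpx] at this
    exact congrArg (fderiv ℝ (f ∘ (extChartAt 𝓘(ℝ, E) x).symm) (extChartAt 𝓘(ℝ, E) x p)) this

/-- The Lie bracket of vector fields in the chart. -/
lemma chartDer_mlieBracket (X Y : ∀ p : P, TangentSpace 𝓘(ℝ, E) p) (x : P) :
    chartDer E x x (VectorField.mlieBracket 𝓘(ℝ, E) X Y x) =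
      VectorField.lieBracket ℝ (chartField x X) (chartField x Y) (extChartAt 𝓘(ℝ, E) x x) := by
  -- The manifold bracket is defined by pulling back along the inverse chart, which uses the inverse
  -- of its differential. That inverse is the differential of the chart, so the pullbacks are the
  -- chart expressions near the point.
  have key : ∀ X : ∀ p : P, TangentSpace 𝓘(ℝ, E) p,
      VectorField.mpullbackWithin 𝓘(ℝ, E) 𝓘(ℝ, E) (extChartAt 𝓘(ℝ, E) x).symm X
        (Set.range 𝓘(ℝ, E)) =ᶠ[𝓝 (extChartAt 𝓘(ℝ, E) x x)] chartField x X := by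
    intro X
    filter_upwards [extChartAt_target_mem_nhds (I := 𝓘(ℝ, E)) x] with y hy
    have h1 : ∀ v : E, chartSymmDer E x y (chartDer E x ((extChartAt 𝓘(ℝ, E) x).symm y) v) = v := by
      intro v
      have := chartSymmDer_chartDer ((extChartAt 𝓘(ℝ, E) x).map_target hy) v
      rwa [(extChartAt 𝓘(ℝ, E) x).right_inv hy] at this
    have h2 : (chartSymmDer E x y).inverse = chartDer E x ((extChartAt 𝓘(ℝ, E) x).symm y) :=
      ContinuousLinearMap.inverse_eq (by ext v; exact h1 v)
        (by ext v; exact chartDer_chartSymmDer hy v)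
    rw [VectorField.mpullbackWithin_apply]
    simp only [modelWithCornersSelf_coe, Set.range_id, mfderivWithin_univ]
    exact congrArg (fun T : E →L[ℝ] E => T (X ((extChartAt 𝓘(ℝ, E) x).symm y))) h2
  have h := VectorField.mlieBracketWithin_apply (I := 𝓘(ℝ, E)) (V := X) (W := Y) (s := Set.univ)
    (x₀ := x)
  have hx := mem_extChartAt_source (I := 𝓘(ℝ, E)) x
  rw [VectorField.mlieBracketWithin_univ] at h
  simp only [Set.preimage_univ, Set.univ_inter] at h
  have h2 : (chartDer E x x).inverse = chartSymmDer E x (extChartAt 𝓘(ℝ, E) x x) :=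
    ContinuousLinearMap.inverse_eq
      (by
        ext v
        have := chartDer_chartSymmDer ((extChartAt 𝓘(ℝ, E) x).map_source hx) v
        rwa [(extChartAt 𝓘(ℝ, E) x).left_inv hx] at this)
      (by ext v; exact chartSymmDer_chartDer hx v)
  have h3 : VectorField.lieBracketWithin ℝ
      (VectorField.mpullbackWithin 𝓘(ℝ, E) 𝓘(ℝ, E) (extChartAt 𝓘(ℝ, E) x).symm X
        (Set.range 𝓘(ℝ, E)))
      (VectorField.mpullbackWithin 𝓘(ℝ, E) 𝓘(ℝ, E) (extChartAt 𝓘(ℝ, E) x).symm Y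
        (Set.range 𝓘(ℝ, E))) (Set.range 𝓘(ℝ, E)) (extChartAt 𝓘(ℝ, E) x x) =
      VectorField.lieBracket ℝ (chartField x X) (chartField x Y) (extChartAt 𝓘(ℝ, E) x x) := by
    simp only [modelWithCornersSelf_coe, Set.range_id]
    refine (congrFun (VectorField.lieBracketWithin_univ (𝕜 := ℝ) (E := E)) _).trans ?_
    have hX := key X
    have hY := key Y
    simp only [modelWithCornersSelf_coe, Set.range_id] at hX hY
    exact Filter.EventuallyEq.lieBracket_vectorField_eq (𝕜 := ℝ) hX hY
  rw [h, ← h3]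
  have h4 : ∀ w : E, chartDer E x x ((chartDer E x x).inverse w) = w := by
    intro w
    rw [h2]
    have := chartDer_chartSymmDer ((extChartAt 𝓘(ℝ, E) x).map_source hx) w
    rwa [(extChartAt 𝓘(ℝ, E) x).left_inv hx] at this
  exact h4 _

/-- The Lie bracket of vector fields is the commutator of the derivations. -/
lemma mvfderiv_mlieBracket {G : Type*} [NormedAddCommGroup G] [NormedSpace ℝ G]
    {f : P → G} {s : Set P} {X Y : ∀ p : P, TangentSpace 𝓘(ℝ, E) p} (hs : IsOpen s)
    (hX : SmoothFieldOn X s) (hY : SmoothFieldOn Y s) (hf : ContMDiffOn 𝓘(ℝ, E) 𝓘(ℝ, G) ∞ f s)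
    {p : P} (hp : p ∈ s) :
    mvfderiv 𝓘(ℝ, E) f p (VectorField.mlieBracket 𝓘(ℝ, E) X Y p) =
      mvfderiv 𝓘(ℝ, E) (fun q => mvfderiv 𝓘(ℝ, E) f q (Y q)) p (X p)
        - mvfderiv 𝓘(ℝ, E) (fun q => mvfderiv 𝓘(ℝ, E) f q (X q)) p (Y p) := by
  have hpp := mem_extChartAt_source (I := 𝓘(ℝ, E)) p
  set φ := extChartAt 𝓘(ℝ, E) p with hφ
  have hU := isOpen_chartDom (E := E) p hs
  have hpU : φ p ∈ chartDom p s := mem_chartDom hpp hp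
  have hUn := hU.mem_nhds hpU
  have hf' := (contDiffOn_chart hf p).contDiffAt hUn
  have hdf := (hf'.fderiv_right (m := ∞) (by simp)).differentiableAt (by simp)
  have key : ∀ (Z W : ∀ p : P, TangentSpace 𝓘(ℝ, E) p), SmoothFieldOn Z s → 
      mvfderiv 𝓘(ℝ, E) (fun q => mvfderiv 𝓘(ℝ, E) f q (Z q)) p (W p) =
      fderiv ℝ (fun y => fderiv ℝ (f ∘ φ.symm) y (chartField p Z y)) (φ p) (chartField p W (φ p)) := by
    intro Z W hZ
    rw [chartField_chart hpp]
    have h0 := SmoothFieldOn.contMDiffOn_mvfderiv hs hZ hf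
    refine (pder_eq (contMDiffOn_mdifferentiableAt hs h0 hp) hpp (W p)).trans ?_
    congr 1
    apply Filter.EventuallyEq.fderiv_eq
    filter_upwards [hUn] with y hy
    have hys := φ.map_target hy.1
    refine (pder_eq (contMDiffOn_mdifferentiableAt hs hf hy.2) hys _).trans ?_
    rw [← hφ, φ.right_inv hy.1]
    rfl
  have hXd := ((contDiffOn_chartField hs hX p).contDiffAt hUn).differentiableAt (by simp)
  have hYd := ((contDiffOn_chartField hs hY p).contDiffAt hUn).differentiableAt (by simp)
  rw [key X Y hX, key Y X hY]
  refine (pder_eq (contMDiffOn_mdifferentiableAt hs hf hp) hpp _).trans ?_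
  rw [chartDer_mlieBracket, fderiv_clm_apply hdf hXd, fderiv_clm_apply hdf hYd]
  -- The second-order terms of the two iterated derivatives cancel by symmetry of the second
  -- derivative; the first-order terms form the bracket.
  have hsymm := (hf'.isSymmSndFDerivAt (by simpa using two_le_infty)) (chartField p X (φ p)) (chartField p Y (φ p))
  simp only [VectorField.lieBracket, map_sub, add_apply,
    ContinuousLinearMap.comp_apply, ContinuousLinearMap.flip_apply, ← hφ] at hsymm ⊢
  rw [hsymm]
  abel

/-- Cartan's formula for the exterior derivative of a 1-form. -/
lemma extDer_apply {ξ : ∀ p : P, Cotangent E p} {s : Set P}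
    {X Y : ∀ p : P, TangentSpace 𝓘(ℝ, E) p} (hs : IsOpen s)
    (hξ : SmoothFormOn ξ s) (hX : SmoothFieldOn X s) (hY : SmoothFieldOn Y s) {p : P} (hp : p ∈ s) :
    extDer ξ p (X p) (Y p) = mvfderiv 𝓘(ℝ, E) (fun q => ξ q (Y q)) p (X p)
        - mvfderiv 𝓘(ℝ, E) (fun q => ξ q (X q)) p (Y p)
        - ξ p (VectorField.mlieBracket 𝓘(ℝ, E) X Y p) := by
  have hpp := mem_extChartAt_source (I := 𝓘(ℝ, E)) p
  set φ := extChartAt 𝓘(ℝ, E) p with hφ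
  have hU := isOpen_chartDom (E := E) p hs
  have hpU : φ p ∈ chartDom p s := mem_chartDom hpp hp
  have hUn := hU.mem_nhds hpU
  have hdξ := ((contDiffOn_chartForm hs hξ p).contDiffAt hUn).differentiableAt (by simp)
  have pair : ∀ (Z : ∀ p : P, TangentSpace 𝓘(ℝ, E) p), ∀ y ∈ chartDom p s,
      ξ (φ.symm y) (Z (φ.symm y)) = chartForm p ξ y (chartField p Z y) := by
    intro Z y hy
    have := chartSymmDer_chartDer (φ.map_target hy.1) (Z (φ.symm y))
    rw [← hφ, φ.right_inv hy.1] at this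
    exact (congrArg (ξ (φ.symm y)) this).symm
  have key : ∀ (Z W : ∀ p : P, TangentSpace 𝓘(ℝ, E) p), SmoothFieldOn Z s → 
      mvfderiv 𝓘(ℝ, E) (fun q => ξ q (Z q)) p (W p) =
      fderiv ℝ (fun y => chartForm p ξ y (chartField p Z y)) (φ p) (chartField p W (φ p)) := by
    intro Z W hZ
    rw [chartField_chart hpp]
    refine (pder_eq (contMDiffOn_mdifferentiableAt hs (hξ.apply hZ) hp) hpp (W p)).trans ?_
    congr 1
    apply Filter.EventuallyEq.fderiv_eq
    filter_upwards [hUn] with y hy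
    exact pair Z y hy
  have hXd := ((contDiffOn_chartField hs hX p).contDiffAt hUn).differentiableAt (by simp)
  have hYd := ((contDiffOn_chartField hs hY p).contDiffAt hUn).differentiableAt (by simp)
  rw [key X Y hX, key Y X hY, fderiv_clm_apply hdξ hXd, fderiv_clm_apply hdξ hYd]
  -- `extDer` is computed in the preferred chart at `p` itself, the chart used here, so no
  -- invariance under changes of chart is needed.
  have h1 : extDer ξ p (X p) (Y p) = fderiv ℝ (chartForm p ξ) (φ p) (chartField p X (φ p))
      (chartField p Y (φ p)) - fderiv ℝ (chartForm p ξ) (φ p) (chartField p Y (φ p))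
      (chartField p X (φ p)) := by
    rw [chartField_chart hpp, chartField_chart hpp]
    rfl
  have h2 : ξ p (VectorField.mlieBracket 𝓘(ℝ, E) X Y p) = chartForm p ξ (φ p)
      (VectorField.lieBracket ℝ (chartField p X) (chartField p Y) (φ p)) := by
    rw [← chartDer_mlieBracket, chartForm_chart hpp]
    exact (congrArg (ξ p) (chartSymmDer_chartDer hpp _)).symm
  rw [h1, h2]
  simp only [VectorField.lieBracket, map_sub, add_apply,
    ContinuousLinearMap.comp_apply, ContinuousLinearMap.flip_apply]
  abel

lemma SmoothFieldOn.mlieBracket [CompleteSpace E] {s : Set P}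
    {X Y : ∀ p : P, TangentSpace 𝓘(ℝ, E) p} (hs : IsOpen s)
    (hX : SmoothFieldOn X s) (hY : SmoothFieldOn Y s) :
    SmoothFieldOn (VectorField.mlieBracket 𝓘(ℝ, E) X Y) s := by
  have : IsManifold 𝓘(ℝ, E) (minSmoothness ℝ 3) P :=
    .of_le (n := ∞) (by simpa using three_le_infty)
  have : IsManifold 𝓘(ℝ, E) ((∞ : ℕ∞ω) + 1) P := .of_le (n := ∞) (by simp)
  intro p hp
  exact (ContMDiffAt.mlieBracket_vectorField (m := ⊤) (n := ⊤)
    (ContMDiffOn.contMDiffAt hX (hs.mem_nhds hp))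
    (ContMDiffOn.contMDiffAt hY (hs.mem_nhds hp)) (by simp)).contMDiffWithinAt

end ChartCalculus

/-! ### Lie derivatives of 1-forms -/

section Forms

variable {E : Type*} [NormedAddCommGroup E] [NormedSpace ℝ E]
  {P : Type*} [TopologicalSpace P] [ChartedSpace E P]

/-- The coordinate vector field with constant value `v` in the preferred chart at `x`. -/
def coordField (x : P) (v : E) (p : P) : TangentSpace 𝓘(ℝ, E) p :=
  chartSymmDer E x (extChartAt 𝓘(ℝ, E) x p) v

variable [IsManifold 𝓘(ℝ, E) ∞ P]

lemma chartDer_coordField {x p : P} (hp : p ∈ (extChartAt 𝓘(ℝ, E) x).source) (v : E) :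
    chartDer E x p (coordField x v p) = v := by
  have := chartDer_chartSymmDer ((extChartAt 𝓘(ℝ, E) x).map_source hp) v
  rwa [(extChartAt 𝓘(ℝ, E) x).left_inv hp] at this

lemma coordField_chartDer {x p : P} (hp : p ∈ (extChartAt 𝓘(ℝ, E) x).source)
    (v : TangentSpace 𝓘(ℝ, E) p) : coordField x (chartDer E x p v) p = v :=
  chartSymmDer_chartDer hp v

lemma smoothFieldOn_coordField (x : P) (v : E) :
    SmoothFieldOn (coordField x v) (extChartAt 𝓘(ℝ, E) x).source := by
  rw [smoothFieldOn_iff (isOpen_extChartAt_source x) subset_rfl]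
  exact contMDiffOn_const.congr fun p hp => chartDer_coordField hp v

/-- Every tangent vector extends to a smooth vector field near its base point. -/
lemma exists_smoothFieldOn (p : P) (v : TangentSpace 𝓘(ℝ, E) p) :
    ∃ (s : Set P) (V : ∀ p : P, TangentSpace 𝓘(ℝ, E) p), IsOpen s ∧ p ∈ s ∧
      SmoothFieldOn V s ∧ V p = v :=
  ⟨_, _, isOpen_extChartAt_source (I := 𝓘(ℝ, E)) p, mem_extChartAt_source p,
    smoothFieldOn_coordField p (chartDer E p p v), coordField_chartDer (mem_extChartAt_source p) v⟩

lemma contMDiffOn_chart (x : P) : ContMDiffOn 𝓘(ℝ, E) 𝓘(ℝ, E) ∞ (extChartAt 𝓘(ℝ, E) x)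
    (extChartAt 𝓘(ℝ, E) x).source := by
  simpa using contMDiffOn_extChartAt (I := 𝓘(ℝ, E)) (n := ∞) (x := x)

/-- Lie derivative of a 1-form, evaluated on a vector field. -/
lemma lieDerForm_apply {ξ : ∀ p : P, Cotangent E p} {s : Set P}
    {X Y : ∀ p : P, TangentSpace 𝓘(ℝ, E) p} (hs : IsOpen s)
    (hξ : SmoothFormOn ξ s) (hX : SmoothFieldOn X s) (hY : SmoothFieldOn Y s) {p : P} (hp : p ∈ s) :
    lieDerForm X ξ p (Y p) = mvfderiv 𝓘(ℝ, E) (fun q => ξ q (Y q)) p (X p)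
      - ξ p (VectorField.mlieBracket 𝓘(ℝ, E) X Y p) := by
  have h := extDer_apply hs hξ hX hY hp
  change extDer ξ p (X p) (Y p) + mvfderiv 𝓘(ℝ, E) (fun q => ξ q (X q)) p (Y p) = _
  rw [h]
  ring

/-- `L_X df = d(X · f)`. -/
lemma lieDerForm_mvfderiv {f : P → ℝ} {s : Set P}
    {X : ∀ p : P, TangentSpace 𝓘(ℝ, E) p} (hs : IsOpen s)
    (hf : ContMDiffOn 𝓘(ℝ, E) 𝓘(ℝ, ℝ) ∞ f s) (hX : SmoothFieldOn X s) {p : P} (hp : p ∈ s) :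
    lieDerForm X (fun q => mvfderiv 𝓘(ℝ, E) f q) p
      = mvfderiv 𝓘(ℝ, E) (fun q => mvfderiv 𝓘(ℝ, E) f q (X q)) p := by
  ext v
  obtain ⟨t, V, ht, hpt, hV, rfl⟩ := exists_smoothFieldOn p v
  have ho := hs.inter ht
  have hf' := hf.mono (Set.inter_subset_left (s := s) (t := t))
  have hX' : SmoothFieldOn X (s ∩ t) := ContMDiffOn.mono hX Set.inter_subset_left
  have hV' : SmoothFieldOn V (s ∩ t) := ContMDiffOn.mono hV Set.inter_subset_right
  rw [lieDerForm_apply ho (smoothFormOn_mvfderiv ho hf') hX' hV' ⟨hp, hpt⟩,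
    mvfderiv_mlieBracket ho hX' hV' hf' ⟨hp, hpt⟩]
  ring

end Forms

/-! ### The Lie algebra of admissible functions -/

namespace DiracStructure

variable {E : Type*} [NormedAddCommGroup E] [NormedSpace ℝ E]
  {P : Type*} [TopologicalSpace P] [ChartedSpace E P] [IsManifold 𝓘(ℝ, E) ∞ P]
  {L : DiracStructure E P}

/-- Isotropy, in the form that makes the bracket of admissible functions skew and independent of the
hamiltonian fields. -/
lemma pairing_eq_neg {p : P} {a b : Generalized E p} (ha : a ∈ L.fiber p) (hb : b ∈ L.fiber p) :
    a.2 b.1 = - b.2 a.1 := by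
  have h := (L.maximal_isotropic p).prop a ha b hb
  simp only [pairPlus] at h
  linarith

lemma smooth_apply {X : ∀ p : P, TangentSpace 𝓘(ℝ, E) p} (hX : SmoothFieldOn X Set.univ)
    {G : Type*} [NormedAddCommGroup G] [NormedSpace ℝ G] {f : P → G}
    (hf : ContMDiff 𝓘(ℝ, E) 𝓘(ℝ, G) ∞ f) :
    ContMDiff 𝓘(ℝ, E) 𝓘(ℝ, G) ∞ (fun p => mvfderiv 𝓘(ℝ, E) f p (X p)) := by
  rw [← contMDiffOn_univ] at hf ⊢
  exact hX.contMDiffOn_mvfderiv isOpen_univ hf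

/-- The section `X ⊕ dg` of `L` that is given by a hamiltonian vector field `X` of `g`. -/
def IsHamiltonian.section {X : ∀ p : P, TangentSpace 𝓘(ℝ, E) p} {g : P → ℝ}
    (h : L.IsHamiltonian X g) (hg : ContMDiff 𝓘(ℝ, E) 𝓘(ℝ, ℝ) ∞ g) : L.Sections :=
  ⟨fun p => (X p, mvfderiv 𝓘(ℝ, E) g p),
    ⟨h.1, smoothFormOn_mvfderiv isOpen_univ hg.contMDiffOn⟩, h.2⟩

/-- The Courant bracket of `X ⊕ dg` with a section of `L`. -/
lemma IsHamiltonian.courant_eq {X : ∀ p : P, TangentSpace 𝓘(ℝ, E) p} {g : P → ℝ}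
    (h : L.IsHamiltonian X g) (hg : ContMDiff 𝓘(ℝ, E) 𝓘(ℝ, ℝ) ∞ g) (b : L.Sections) (p : P) :
    courant (h.section hg).1 b.1 p =
      (VectorField.mlieBracket 𝓘(ℝ, E) X (fun q => (b.1 q).1) p,
        lieDerForm X (fun q => (b.1 q).2) p) := by
  refine Prod.ext rfl ?_
  change lieDerForm X (fun q => (b.1 q).2) p
      - lieDerForm (fun q => (b.1 q).1) (fun q => mvfderiv 𝓘(ℝ, E) g q) p
      + (1 / 2 : ℝ) • mvfderiv 𝓘(ℝ, E)
        (fun q => mvfderiv 𝓘(ℝ, E) g q (b.1 q).1 - (b.1 q).2 (X q)) p = _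
  rw [lieDerForm_mvfderiv isOpen_univ hg.contMDiffOn b.2.1.1 (Set.mem_univ p)]
  have hd : MDifferentiableAt 𝓘(ℝ, E) 𝓘(ℝ, ℝ) (fun q => mvfderiv 𝓘(ℝ, E) g q (b.1 q).1) p :=
    (smooth_apply b.2.1.1 hg p).mdifferentiableAt (by simp)
  -- By isotropy the exact term of the Courant bracket is `d(Y·g)`, which cancels `-L_Y dg`.
  have e : (fun q => mvfderiv 𝓘(ℝ, E) g q (b.1 q).1 - (b.1 q).2 (X q))
      = (fun q => mvfderiv 𝓘(ℝ, E) g q (b.1 q).1) + fun q => mvfderiv 𝓘(ℝ, E) g q (b.1 q).1 := by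
    funext q
    have := pairing_eq_neg (h.2 q) (b.2.2 q)
    simp only [Pi.add_apply] at this ⊢
    linarith
  rw [e, mvfderiv_add hd hd]
  module

/-- The Lie bracket of hamiltonian vector fields is hamiltonian. -/
lemma IsHamiltonian.mlieBracket [CompleteSpace E] {X Y : ∀ p : P, TangentSpace 𝓘(ℝ, E) p}
    {g f : P → ℝ} (hX : L.IsHamiltonian X g) (hg : ContMDiff 𝓘(ℝ, E) 𝓘(ℝ, ℝ) ∞ g)
    (hY : L.IsHamiltonian Y f) (hf : ContMDiff 𝓘(ℝ, E) 𝓘(ℝ, ℝ) ∞ f) :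
    L.IsHamiltonian (VectorField.mlieBracket 𝓘(ℝ, E) X Y)
      (fun p => mvfderiv 𝓘(ℝ, E) f p (X p)) := by
  refine ⟨hX.1.mlieBracket isOpen_univ hY.1, fun p => ?_⟩
  have h := (Sections.bracket (hX.section hg) (hY.section hf) p).2
  change courant _ _ p ∈ _ at h
  rw [hX.courant_eq hg] at h
  rwa [← lieDerForm_mvfderiv isOpen_univ hf.contMDiffOn hX.1 (Set.mem_univ p)]

/-- A hamiltonian vector field of an admissible function. -/
def Adm.ham (g : L.Adm) : ∀ p : P, TangentSpace 𝓘(ℝ, E) p := g.2.choose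

lemma Adm.isHamiltonian_ham (g : L.Adm) : L.IsHamiltonian (Adm.ham g) g.1 := g.2.choose_spec

/-- The bracket `{f, g} = X_g · f` of admissible functions. -/
def Adm.bracketFun [CompleteSpace E] (f g : L.Adm) : L.Adm :=
  ⟨⟨fun p => mvfderiv 𝓘(ℝ, E) f.1 p (Adm.ham g p),
    smooth_apply (Adm.isHamiltonian_ham g).1 f.1.contMDiff⟩,
    _, (Adm.isHamiltonian_ham g).mlieBracket g.1.contMDiff (Adm.isHamiltonian_ham f)
      f.1.contMDiff⟩

lemma Adm.ext_iff_apply {f g : L.Adm} (h : ∀ p, f.1 p = g.1 p) : f = g :=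
  Subtype.ext (ContMDiffMap.ext h)

lemma mvfderiv_adm_add (f g : L.Adm) (p : P) :
    mvfderiv 𝓘(ℝ, E) (f + g).1 p = mvfderiv 𝓘(ℝ, E) f.1 p + mvfderiv 𝓘(ℝ, E) g.1 p := by
  have hf := (f.1.contMDiff p).mdifferentiableAt (by simp)
  have hg := (g.1.contMDiff p).mdifferentiableAt (by simp)
  change mvfderiv 𝓘(ℝ, E) (⇑(f.1 + g.1)) p = _
  rw [ContMDiffMap.coe_add]
  exact mvfderiv_add hf hg

lemma mvfderiv_adm_smul (c : ℝ) (f : L.Adm) (p : P) :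
    mvfderiv 𝓘(ℝ, E) (c • f).1 p = c • mvfderiv 𝓘(ℝ, E) f.1 p := by
  have hf := (f.1.contMDiff p).mdifferentiableAt (by simp)
  have h := mvfderiv_smul (I := 𝓘(ℝ, E)) (a := fun _ : P => c) (x := p) (g := f.1)
    mdifferentiableAt_const hf
  rw [mvfderiv_const] at h
  have e : (⇑(c • f).1 : P → ℝ) = (fun _ : P => c) • ⇑f.1 := by ext; simp
  rw [e, h]; ext; simp

/-- By isotropy `X·f = -X_f·g` for one fixed hamiltonian field `X_f` of `f`, and the right-hand side
does not see which field of `g` was chosen. -/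
lemma Adm.bracketFun_apply [CompleteSpace E] (f g : L.Adm) {X : ∀ p : P, TangentSpace 𝓘(ℝ, E) p}
    (hX : L.IsHamiltonian X g.1) (p : P) :
    (Adm.bracketFun f g).1 p = mvfderiv 𝓘(ℝ, E) f.1 p (X p) := by
  change mvfderiv 𝓘(ℝ, E) f.1 p (Adm.ham g p) = _
  have h1 := pairing_eq_neg ((Adm.isHamiltonian_ham f).2 p) ((Adm.isHamiltonian_ham g).2 p)
  have h2 := pairing_eq_neg ((Adm.isHamiltonian_ham f).2 p) (hX.2 p)
  exact h1.trans h2.symm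

lemma Adm.bracketFun_swap [CompleteSpace E] (f g : L.Adm) (p : P) :
    (Adm.bracketFun f g).1 p = - (Adm.bracketFun g f).1 p :=
  pairing_eq_neg ((Adm.isHamiltonian_ham f).2 p) ((Adm.isHamiltonian_ham g).2 p)

/-- The bracket of admissible functions as a bilinear map. -/
def Adm.bracket [CompleteSpace E] : L.Adm →ₗ[ℝ] L.Adm →ₗ[ℝ] L.Adm :=
  have hadd : ∀ f₁ f₂ g : L.Adm, Adm.bracketFun (f₁ + f₂) g
      = Adm.bracketFun f₁ g + Adm.bracketFun f₂ g := fun f₁ f₂ g =>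
    Adm.ext_iff_apply fun p => by
      change mvfderiv 𝓘(ℝ, E) (f₁ + f₂).1 p (Adm.ham g p) = _
      rw [mvfderiv_adm_add]; rfl
  have hsmul : ∀ (c : ℝ) (f g : L.Adm), Adm.bracketFun (c • f) g
      = c • Adm.bracketFun f g := fun c f g =>
    Adm.ext_iff_apply fun p => by
      change mvfderiv 𝓘(ℝ, E) (c • f).1 p (Adm.ham g p) = _
      rw [mvfderiv_adm_smul]; rfl
  LinearMap.mk₂ ℝ Adm.bracketFun hadd hsmul
    (fun f g₁ g₂ => Adm.ext_iff_apply fun p => by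
      rw [Adm.bracketFun_swap, hadd]
      have h1 := Adm.bracketFun_swap f g₁ p
      have h2 := Adm.bracketFun_swap f g₂ p
      change -((Adm.bracketFun g₁ f).1 p + (Adm.bracketFun g₂ f).1 p)
        = (Adm.bracketFun f g₁).1 p + (Adm.bracketFun f g₂).1 p
      rw [h1, h2]; ring)
    (fun c f g => Adm.ext_iff_apply fun p => by
      rw [Adm.bracketFun_swap, hsmul]
      have h1 := Adm.bracketFun_swap f g p
      change -(c * (Adm.bracketFun g f).1 p) = c * (Adm.bracketFun f g).1 p
      rw [h1]; ring)

lemma Adm.bracket_apply [CompleteSpace E] (f g : L.Adm) {X : ∀ p : P, TangentSpace 𝓘(ℝ, E) p}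
    (hX : L.IsHamiltonian X g.1) (p : P) :
    (Adm.bracket f g).1 p = mvfderiv 𝓘(ℝ, E) f.1 p (X p) :=
  Adm.bracketFun_apply f g hX p

lemma Adm.bracket_swap [CompleteSpace E] (f g : L.Adm) (p : P) :
    (Adm.bracket f g).1 p = - (Adm.bracket g f).1 p :=
  Adm.bracketFun_swap f g p

lemma Adm.bracket_self [CompleteSpace E] (f : L.Adm) : Adm.bracket f f = 0 :=
  Adm.ext_iff_apply fun p => by
    have := Adm.bracket_swap f f p
    change (Adm.bracket f f).1 p = 0
    linarith

/-- The Lie bracket of hamiltonian vector fields of `g` and `f` is one of `{f, g}`. -/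
lemma Adm.isHamiltonian_bracket [CompleteSpace E] {f g : L.Adm}
    {X Y : ∀ p : P, TangentSpace 𝓘(ℝ, E) p} (hX : L.IsHamiltonian X g.1)
    (hY : L.IsHamiltonian Y f.1) :
    L.IsHamiltonian (VectorField.mlieBracket 𝓘(ℝ, E) X Y) (Adm.bracket f g).1 := by
  have h := hX.mlieBracket g.1.contMDiff hY f.1.contMDiff
  rwa [show (fun p => mvfderiv 𝓘(ℝ, E) f.1 p (X p)) = (Adm.bracket f g).1 from
    funext fun p => (Adm.bracket_apply f g hX p).symm] at h

/-- Since `[X_h, X_g]` is a hamiltonian field of `{g, h}`, the commutator formula gives `{f, {g, h}}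
= {{f, g}, h} - {{f, h}, g}`; skewness does the rest. -/
lemma Adm.bracket_jacobi [CompleteSpace E] (f g h : L.Adm) :
    Adm.bracket f (Adm.bracket g h)
      = Adm.bracket (Adm.bracket f g) h + Adm.bracket g (Adm.bracket f h) :=
  Adm.ext_iff_apply fun p => by
    have hg := Adm.isHamiltonian_ham g
    have hh := Adm.isHamiltonian_ham h
    have h1 := Adm.bracket_apply f (Adm.bracket g h) (Adm.isHamiltonian_bracket hh hg) p
    rw [mvfderiv_mlieBracket isOpen_univ hh.1 hg.1 f.1.contMDiff.contMDiffOn (Set.mem_univ p)] at h1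
    have h2 := Adm.bracket_apply (Adm.bracket f g) h hh p
    have h3 := Adm.bracket_apply (Adm.bracket f h) g hg p
    rw [show ((Adm.bracket f g).1 : P → ℝ) = fun p => mvfderiv 𝓘(ℝ, E) f.1 p (Adm.ham g p) from
      funext fun p => Adm.bracket_apply f g hg p] at h2
    rw [show ((Adm.bracket f h).1 : P → ℝ) = fun p => mvfderiv 𝓘(ℝ, E) f.1 p (Adm.ham h p) from
      funext fun p => Adm.bracket_apply f h hh p] at h3
    change _ = (Adm.bracket (Adm.bracket f g) h).1 p + (Adm.bracket g (Adm.bracket f h)).1 p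
    rw [h1, h2, Adm.bracket_swap g, h3]
    ring

end DiracStructure

/-! ### Lifts of vector fields to the principal bundle -/

namespace Prequantization

variable {E : Type*} [NormedAddCommGroup E] [NormedSpace ℝ E]
  {P : Type*} [TopologicalSpace P] [ChartedSpace E P] [IsManifold 𝓘(ℝ, E) ∞ P]
  {F : Type*} [NormedAddCommGroup F] [NormedSpace ℝ F]
  {Q : Type*} [TopologicalSpace Q] [ChartedSpace F Q] [IsManifold 𝓘(ℝ, F) ∞ Q]
  [MulAction Circle Q] {L : DiracStructure E P} (𝒬 : Prequantization L F Q)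

lemma mdifferentiableAt_proj (q : Q) : MDifferentiableAt 𝓘(ℝ, F) 𝓘(ℝ, E) 𝒬.proj q :=
  (𝒬.contMDiff_proj q).mdifferentiableAt (by simp)

section Trivialization

variable (e : Bundle.Trivialization Circle 𝒬.proj)
  (h1 : ContMDiffOn 𝓘(ℝ, F) (𝓘(ℝ, E).prod (𝓡 1)) ∞ e e.source)
  (h2 : ContMDiffOn (𝓘(ℝ, E).prod (𝓡 1)) 𝓘(ℝ, F) ∞ e.toOpenPartialHomeomorph.symm e.target)
include h1 h2

/-- In a local trivialization, the differential of the projection is the first projection. -/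
lemma exists_equiv_dproj {q : Q} (hq : q ∈ e.source) :
    ∃ (A : F →L[ℝ] E × EuclideanSpace ℝ (Fin 1)) (B : E × EuclideanSpace ℝ (Fin 1) →L[ℝ] F),
      (∀ v, B (A v) = v) ∧ (∀ w, A (B w) = w) ∧ ∀ v : F, 𝒬.dproj q v = (A v).1 := by
  have hes : IsOpen e.source := e.open_source
  have het : IsOpen e.target := e.open_target
  have hqt : e q ∈ e.target := e.map_source hq
  have hd1 : MDifferentiableAt 𝓘(ℝ, F) (𝓘(ℝ, E).prod (𝓡 1)) e q :=
    (h1.contMDiffAt (hes.mem_nhds hq)).mdifferentiableAt (by simp)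
  have hd2 : MDifferentiableAt (𝓘(ℝ, E).prod (𝓡 1)) 𝓘(ℝ, F) e.toOpenPartialHomeomorph.symm (e q) :=
    (h2.contMDiffAt (het.mem_nhds hqt)).mdifferentiableAt (by simp)
  let A : F →L[ℝ] E × EuclideanSpace ℝ (Fin 1) := mfderiv 𝓘(ℝ, F) (𝓘(ℝ, E).prod (𝓡 1)) e q
  let B : E × EuclideanSpace ℝ (Fin 1) →L[ℝ] F :=
    mfderiv (𝓘(ℝ, E).prod (𝓡 1)) 𝓘(ℝ, F) e.toOpenPartialHomeomorph.symm (e q)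
  have hsymm : e.toOpenPartialHomeomorph.symm (e q) = q := e.left_inv hq
  refine ⟨A, B, ?_, ?_, ?_⟩
  · have h := mfderiv_comp q hd2 hd1
    have he : (e.toOpenPartialHomeomorph.symm ∘ e) =ᶠ[𝓝 q] id := by
      filter_upwards [hes.mem_nhds hq] with r hr
      exact e.left_inv hr
    rw [he.mfderiv_eq, mfderiv_id] at h
    exact fun v => (congrArg (fun T : F →L[ℝ] F => T v) h).symm
  · have h := mfderiv_comp_of_eq (x := e q) (y := q) hd1 hd2 hsymm
    have he : (e ∘ e.toOpenPartialHomeomorph.symm) =ᶠ[𝓝 (e q)] id := by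
      filter_upwards [het.mem_nhds hqt] with r hr
      exact e.right_inv hr
    rw [he.mfderiv_eq, mfderiv_id, hsymm] at h
    exact fun w => (congrArg (fun T : (E × EuclideanSpace ℝ (Fin 1)) →L[ℝ]
      (E × EuclideanSpace ℝ (Fin 1)) => T w) h).symm
  · have h := mfderiv_comp q (mdifferentiableAt_fst (I := 𝓘(ℝ, E)) (I' := 𝓡 1) (x := e q)) hd1
    have he : (Prod.fst ∘ e) =ᶠ[𝓝 q] 𝒬.proj := by
      filter_upwards [hes.mem_nhds hq] with r hr
      exact e.coe_fst hr
    rw [he.mfderiv_eq, mfderiv_fst] at h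
    exact fun v => (congrArg (fun T : F →L[ℝ] E => T v) h)

end Trivialization

/-- The map `(π_*, σ)` on `T_q Q`. -/
def dprojσ (q : Q) : F →L[ℝ] E × ℝ :=
  let A : F →L[ℝ] E × ℝ := (𝒬.dproj q).prod (𝒬.σ q)
  A

lemma σ_generator (q : Q) : 𝒬.σ q (generator F q) = 1 :=
  𝒬.isConnectionForm.apply_generator q

lemma dprojσ_generator (q : Q) : 𝒬.dprojσ q (generator F q) = (0, 1) :=
  Prod.ext (𝒬.dproj_generator q) (𝒬.σ_generator q)

/-- A trivialization shows that `π_*` is onto with one-dimensional kernel. The generator lies in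
this kernel and is nonzero because `σ(E) = 1`, so it spans the kernel and `σ` supplies the missing
coordinate. -/
lemma dprojσ_bijective (q : Q) : Function.Bijective (𝒬.dprojσ q) := by
  obtain ⟨e, he, h1, h2, -⟩ := 𝒬.exists_trivialization (𝒬.proj q)
  obtain ⟨A, B, hBA, hAB, hp⟩ := 𝒬.exists_equiv_dproj e h1 h2 (e.mem_source.2 he)
  replace hp : ∀ v, (𝒬.dprojσ q v).1 = (A v).1 := hp
  obtain ⟨g, hg⟩ : ∃ g : F, 𝒬.dprojσ q g = (0, 1) := ⟨_, 𝒬.dprojσ_generator q⟩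
  constructor
  · rw [injective_iff_map_eq_zero]
    intro v hv
    have hv1 : (A v).1 = 0 := by rw [← hp, hv]; rfl
    have hE1 : (A g).1 = 0 := by rw [← hp, hg]
    have hE2 : (A g).2 0 ≠ 0 := by
      intro h0
      have hA : A g = 0 := by
        refine Prod.ext hE1 ?_
        ext i
        rw [Subsingleton.elim i 0]
        exact h0
      have h3 : g = 0 := by rw [← hBA g, hA, map_zero]
      rw [h3, map_zero] at hg
      exact zero_ne_one (congrArg Prod.snd hg)
    -- Both vectors have zero base component, and the fibre component is a single number, nonzero
    -- for `g`.
    have key : v = ((A v).2 0 / (A g).2 0) • g := by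
      have h : A v = A (((A v).2 0 / (A g).2 0) • g) := by
        rw [map_smul]
        refine Prod.ext ?_ ?_
        · rw [hv1, Prod.smul_fst, hE1, smul_zero]
        · ext i
          rw [Subsingleton.elim i 0]
          simp only [Prod.smul_snd, PiLp.smul_apply, smul_eq_mul]
          field_simp
      rw [← hBA v, h, hBA, ← h]
    have h5 : (A v).2 0 / (A g).2 0 = 0 := by
      rw [key, map_smul, hg] at hv
      simpa using congrArg Prod.snd hv
    rw [key, h5, zero_smul]
  · rintro ⟨X, r⟩
    -- The first summand has the right projection; the multiple of the generator corrects the value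
    -- of `σ` without changing it.
    refine ⟨B (X, 0) + (r - (𝒬.dprojσ q (B (X, 0))).2) • g, ?_⟩
    rw [map_add, map_smul, hg]
    refine Prod.ext ?_ ?_
    · rw [Prod.fst_add, hp, hAB]
      simp
    · simp

/-- A tangent vector of `Q` is determined by its projection to `P` and the value of `σ`. -/
lemma tangent_ext {q : Q} {v w : F} (h1 : (𝒬.dproj q v : E) = 𝒬.dproj q w)
    (h2 : 𝒬.σ q v = 𝒬.σ q w) : v = w :=
  (𝒬.dprojσ_bijective q).1 (Prod.ext h1 h2)

variable [FiniteDimensional ℝ F]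

/-- `horLift` is defined by `ContinuousLinearMap.inverse`, which is zero on maps that are not
invertible; this is what gives it its meaning. -/
lemma dprojσ_isInvertible (q : Q) : (𝒬.dprojσ q).IsInvertible :=
  ⟨(LinearEquiv.ofBijective (𝒬.dprojσ q : F →ₗ[ℝ] E × ℝ)
    (𝒬.dprojσ_bijective q)).toContinuousLinearEquiv, by ext v <;> rfl⟩

lemma dprojσ_horLift (q : Q) (X : TangentSpace 𝓘(ℝ, E) (𝒬.proj q)) :
    𝒬.dprojσ q (𝒬.horLift q X) = (X, 0) := by
  have h := (𝒬.dprojσ_isInvertible q).self_comp_inverse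
  exact congrArg (fun T : (E × ℝ) →L[ℝ] (E × ℝ) => T (X, 0)) h

lemma dproj_horLift (q : Q) (X : TangentSpace 𝓘(ℝ, E) (𝒬.proj q)) :
    𝒬.dproj q (𝒬.horLift q X) = X :=
  congrArg Prod.fst (𝒬.dprojσ_horLift q X)

lemma σ_horLift (q : Q) (X : TangentSpace 𝓘(ℝ, E) (𝒬.proj q)) :
    𝒬.σ q (𝒬.horLift q X) = 0 :=
  congrArg Prod.snd (𝒬.dprojσ_horLift q X)

omit [FiniteDimensional ℝ F] in
/-- `V` is the vector field on `Q` that projects to `X` and satisfies `σ(V) = u`,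
i.e. `V = X^H + u E`. -/
structure IsLift (V : ∀ q : Q, TangentSpace 𝓘(ℝ, F) q)
    (X : ∀ p : P, TangentSpace 𝓘(ℝ, E) p) (u : Q → ℝ) : Prop where
  dproj : ∀ q, 𝒬.dproj q (V q) = X (𝒬.proj q)
  σ : ∀ q, 𝒬.σ q (V q) = u q

/-- The vector field `X^H + u E`. -/
def lift (X : ∀ p : P, TangentSpace 𝓘(ℝ, E) p) (u : Q → ℝ) (q : Q) : TangentSpace 𝓘(ℝ, F) q :=
  𝒬.horLift q (X (𝒬.proj q)) + u q • generator F q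

lemma isLift_lift (X : ∀ p : P, TangentSpace 𝓘(ℝ, E) p) (u : Q → ℝ) :
    𝒬.IsLift (𝒬.lift X u) X u where
  dproj q := by
    rw [lift, map_add, map_smul, 𝒬.dproj_generator, 𝒬.dproj_horLift, smul_zero, add_zero]
  σ q := by
    rw [lift, map_add, map_smul, 𝒬.σ_generator, 𝒬.σ_horLift, zero_add, smul_eq_mul, mul_one]

variable {𝒬}

omit [FiniteDimensional ℝ F] in
lemma IsLift.unique {V W : ∀ q : Q, TangentSpace 𝓘(ℝ, F) q}
    {X : ∀ p : P, TangentSpace 𝓘(ℝ, E) p} {u : Q → ℝ} (hV : 𝒬.IsLift V X u)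
    (hW : 𝒬.IsLift W X u) (q : Q) : V q = W q :=
  𝒬.tangent_ext ((hV.dproj q).trans (hW.dproj q).symm) ((hV.σ q).trans (hW.σ q).symm)

/-- In charts `V` solves a linear system `A V = r`, with `A` the expression of `(π_*, σ)` and `r`
that of `(X ∘ π, u)`. Both are smooth, and inversion is smooth at invertible maps. -/
lemma IsLift.smooth {V : ∀ q : Q, TangentSpace 𝓘(ℝ, F) q}
    {X : ∀ p : P, TangentSpace 𝓘(ℝ, E) p} {u : Q → ℝ} (hV : 𝒬.IsLift V X u)
    (hX : SmoothFieldOn X Set.univ) (hu : ContMDiff 𝓘(ℝ, F) 𝓘(ℝ, ℝ) ∞ u) :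
    SmoothFieldOn V Set.univ := by
  intro q₀ _
  set φ := extChartAt 𝓘(ℝ, F) q₀ with hφ
  set ψ := extChartAt 𝓘(ℝ, E) (𝒬.proj q₀) with hψ
  let t : Set Q := 𝒬.proj ⁻¹' ψ.source
  let s : Set Q := φ.source ∩ t
  have ht : IsOpen t := (isOpen_extChartAt_source (𝒬.proj q₀)).preimage
    𝒬.contMDiff_proj.continuous
  have hs : IsOpen s := (isOpen_extChartAt_source q₀).inter ht
  have hq₀ : q₀ ∈ s := ⟨mem_extChartAt_source q₀, mem_extChartAt_source (𝒬.proj q₀)⟩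
  suffices H : SmoothFieldOn V s from
    (ContMDiffOn.contMDiffAt H (hs.mem_nhds hq₀)).contMDiffWithinAt
  rw [smoothFieldOn_iff hs Set.inter_subset_left]
  have hψπ : ContMDiffOn 𝓘(ℝ, F) 𝓘(ℝ, E) ∞ (ψ ∘ 𝒬.proj) t :=
    (contMDiffOn_chart (𝒬.proj q₀)).comp 𝒬.contMDiff_proj.contMDiffOn fun q hq => hq
  -- the map `(π_*, σ)` in the charts
  let A : F → F →L[ℝ] E × ℝ := fun y =>
    (fderiv ℝ ((ψ ∘ 𝒬.proj) ∘ φ.symm) y).prod (chartForm q₀ 𝒬.σ y)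
  let r : F → E × ℝ := fun y => (chartDer E (𝒬.proj q₀) (𝒬.proj (φ.symm y))
    (X (𝒬.proj (φ.symm y))), u (φ.symm y))
  have hdom := isOpen_chartDom (E := F) q₀ ht
  have hA : ContDiffOn ℝ ∞ A (chartDom q₀ t) :=
    (ContinuousLinearMap.prodₗᵢ (𝕜 := ℝ) (E := F) (F := E) (G := ℝ) ℝ).contDiff.comp_contDiffOn
      (((contDiffOn_chart hψπ q₀).fderiv_of_isOpen hdom (by simp)).prodMk
        (contDiffOn_chartForm ht (ContMDiffOn.mono 𝒬.isConnectionForm.smooth (Set.subset_univ _)) q₀))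
  have hr : ContDiffOn ℝ ∞ r (chartDom q₀ t) := by
    have h1 : ContMDiffOn 𝓘(ℝ, E) 𝓘(ℝ, E) ∞
        (fun p => chartDer E (𝒬.proj q₀) p (X p)) ψ.source :=
      (smoothFieldOn_iff (isOpen_extChartAt_source _) subset_rfl).1
        (ContMDiffOn.mono hX (Set.subset_univ _))
    have h2 : ContMDiffOn 𝓘(ℝ, F) 𝓘(ℝ, E) ∞
        (fun q => chartDer E (𝒬.proj q₀) (𝒬.proj q) (X (𝒬.proj q))) t :=
      h1.comp 𝒬.contMDiff_proj.contMDiffOn fun q hq => hq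
    exact (contDiffOn_chart h2 q₀).prodMk
      (contDiffOn_chart (hu.contMDiffOn (s := t)) q₀)
  have hAeq : ∀ q ∈ s, ∀ v : F, A (φ q) (chartDer F q₀ q v) =
      (chartDer E (𝒬.proj q₀) (𝒬.proj q) (𝒬.dprojσ q v).1, (𝒬.dprojσ q v).2) := by
    rintro q ⟨hqφ, hqt⟩ v
    refine Prod.ext ?_ ?_
    · have hd := contMDiffOn_mdifferentiableAt ht hψπ hqt
      refine (pder_eq hd hqφ v).symm.trans ?_
      have h := mfderiv_comp q (mdifferentiableAt_chart hqt) (𝒬.mdifferentiableAt_proj q)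
      exact congrArg (fun T : F →L[ℝ] E => T v) h
    · change chartForm q₀ 𝒬.σ (φ q) (chartDer F q₀ q v) = _
      rw [chartForm_chart hqφ]
      exact congrArg (𝒬.σ q) (chartSymmDer_chartDer hqφ v)
  -- The differentials of the charts of `Q` and `P` are bijective, so bijectivity passes from `(π_*,
  -- σ)` to `A`.
  have hAinv : ∀ y ∈ chartDom q₀ t, (A y).IsInvertible := by
    intro y hy
    have hq : φ.symm y ∈ s := ⟨φ.map_target hy.1, hy.2⟩
    have hAy := hAeq _ hq
    rw [φ.right_inv hy.1] at hAy
    have hbij : Function.Bijective (A y) := by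
      constructor
      · rw [injective_iff_map_eq_zero]
        intro v hv
        have h0 := hAy (chartSymmDer F q₀ y v)
        rw [chartDer_chartSymmDer hy.1, hv] at h0
        have h1 : (𝒬.dprojσ (φ.symm y) (chartSymmDer F q₀ y v)).1 = 0 := by
          have h3 : chartDer E (𝒬.proj q₀) (𝒬.proj (φ.symm y))
              (𝒬.dprojσ (φ.symm y) (chartSymmDer F q₀ y v)).1 = 0 := (congrArg Prod.fst h0).symm
          rw [← chartSymmDer_chartDer hq.2 (𝒬.dprojσ (φ.symm y) (chartSymmDer F q₀ y v)).1, h3,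
            map_zero]
        have h2 : chartSymmDer F q₀ y v = 0 := (𝒬.dprojσ_bijective _).1 (by
          rw [map_zero]
          exact Prod.ext h1 (congrArg Prod.snd h0).symm)
        rw [← chartDer_chartSymmDer hy.1 v, h2, map_zero]
      · rintro ⟨X, c⟩
        obtain ⟨v, hv⟩ := (𝒬.dprojσ_bijective (φ.symm y)).2
          (chartSymmDer E (𝒬.proj q₀) (ψ (𝒬.proj (φ.symm y))) X, c)
        refine ⟨chartDer F q₀ (φ.symm y) v, (hAy v).trans ?_⟩
        rw [hv]
        exact Prod.ext (chartDer_coordField hq.2 X) rfl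
    exact ⟨(LinearEquiv.ofBijective (A y : F →ₗ[ℝ] E × ℝ) hbij).toContinuousLinearEquiv,
      by ext v <;> rfl⟩
  refine contMDiffOn_of_chart (x := q₀) (g := fun y => (A y).inverse (r y))
    Set.inter_subset_left ?_ ?_
  · refine ContDiffOn.mono (s := chartDom q₀ t) ?_
      (Set.inter_subset_inter_right _ (Set.preimage_mono Set.inter_subset_right))
    refine ContDiffOn.clm_apply ?_ hr
    intro y hy
    obtain ⟨e, he⟩ := hAinv y hy
    have h1 := contDiffAt_map_inverse (𝕜 := ℝ) (n := ∞) e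
    rw [he] at h1
    exact h1.comp_contDiffWithinAt y (hA y hy)
  · rintro q hq
    have h1 : A (φ q) (chartDer F q₀ q (V q)) = r (φ q) := by
      refine (hAeq q hq (V q)).trans ?_
      have e2 : r (φ q) = (chartDer E (𝒬.proj q₀) (𝒬.proj q) (X (𝒬.proj q)), u q) := by
        change (fun q => (chartDer E (𝒬.proj q₀) (𝒬.proj q) (X (𝒬.proj q)), u q)) (φ.symm (φ q)) = _
        rw [φ.left_inv hq.1]
      rw [e2]
      exact Prod.ext (congrArg (chartDer E (𝒬.proj q₀) (𝒬.proj q)) (hV.dproj q)) (hV.σ q)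
    have hqd : φ q ∈ chartDom q₀ t := mem_chartDom hq.1 hq.2
    rw [← h1]
    have h2 := (hAinv _ hqd).inverse_comp_self
    exact (congrArg (fun T : F →L[ℝ] F => T (chartDer F q₀ q (V q))) h2).symm

end Prequantization

lemma mvfderiv_congr {F : Type*} [NormedAddCommGroup F] [NormedSpace ℝ F]
    {Q : Type*} [TopologicalSpace Q] [ChartedSpace F Q]
    {G : Type*} [NormedAddCommGroup G] [NormedSpace ℝ G] {f g : Q → G} {q : Q}
    (h : f =ᶠ[𝓝 q] g) : mvfderiv 𝓘(ℝ, F) f q = mvfderiv 𝓘(ℝ, F) g q := by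
  unfold mvfderiv
  rw [h.eq_of_nhds, h.mfderiv_eq]

/-! ### Brackets of lifts and curvature -/

namespace Prequantization

variable {E : Type*} [NormedAddCommGroup E] [NormedSpace ℝ E]
  {P : Type*} [TopologicalSpace P] [ChartedSpace E P] [IsManifold 𝓘(ℝ, E) ∞ P]
  {F : Type*} [NormedAddCommGroup F] [NormedSpace ℝ F]
  {Q : Type*} [TopologicalSpace Q] [ChartedSpace F Q] [IsManifold 𝓘(ℝ, F) ∞ Q]
  [MulAction Circle Q] {L : DiracStructure E P} (𝒬 : Prequantization L F Q)

lemma mvfderiv_comp_proj {G : Type*} [NormedAddCommGroup G] [NormedSpace ℝ G] {f : P → G} {q : Q}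
    (hf : MDifferentiableAt 𝓘(ℝ, E) 𝓘(ℝ, G) f (𝒬.proj q)) (v : TangentSpace 𝓘(ℝ, F) q) :
    mvfderiv 𝓘(ℝ, F) (fun q => f (𝒬.proj q)) q v
      = mvfderiv 𝓘(ℝ, E) f (𝒬.proj q) (𝒬.dproj q v) := by
  have h := mfderiv_comp q hf (𝒬.mdifferentiableAt_proj q)
  exact congrArg (fun T : F →L[ℝ] G => T v) h

variable {𝒬}

/-- The bracket of lifts is a lift of the bracket; its vertical part involves the curvature. -/
lemma IsLift.mlieBracket {V W : ∀ q : Q, TangentSpace 𝓘(ℝ, F) q}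
    {X Y : ∀ p : P, TangentSpace 𝓘(ℝ, E) p} {u w : Q → ℝ}
    (hV : 𝒬.IsLift V X u) (hW : 𝒬.IsLift W Y w)
    (hVs : SmoothFieldOn V Set.univ) (hWs : SmoothFieldOn W Set.univ)
    (hXs : SmoothFieldOn X Set.univ) (hYs : SmoothFieldOn Y Set.univ) :
    𝒬.IsLift (VectorField.mlieBracket 𝓘(ℝ, F) V W) (VectorField.mlieBracket 𝓘(ℝ, E) X Y)
      (fun q => mvfderiv 𝓘(ℝ, F) w q (V q) - mvfderiv 𝓘(ℝ, F) u q (W q)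
        - 𝒬.Ω (𝒬.proj q) (X (𝒬.proj q)) (Y (𝒬.proj q))) := by
  constructor
  · intro q
    set ψ := extChartAt 𝓘(ℝ, E) (𝒬.proj q) with hψ
    have hs : IsOpen ψ.source := isOpen_extChartAt_source _
    have ht : IsOpen (𝒬.proj ⁻¹' ψ.source) := hs.preimage 𝒬.contMDiff_proj.continuous
    have hp : 𝒬.proj q ∈ ψ.source := mem_extChartAt_source _
    have hf : ContMDiffOn 𝓘(ℝ, E) 𝓘(ℝ, E) ∞ ψ ψ.source := contMDiffOn_chart _
    have hfπ : ContMDiffOn 𝓘(ℝ, F) 𝓘(ℝ, E) ∞ (fun r => ψ (𝒬.proj r)) (𝒬.proj ⁻¹' ψ.source) :=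
      hf.comp 𝒬.contMDiff_proj.contMDiffOn fun q hq => hq
    have hfd : ∀ r ∈ ψ.source, MDifferentiableAt 𝓘(ℝ, E) 𝓘(ℝ, E) ψ r := fun r hr =>
      contMDiffOn_mdifferentiableAt hs hf hr
    -- The chart `ψ` of `P` serves as a vector-valued test function: the commutator formula for `ψ ∘
    -- π` on `Q` is compared with the one for `ψ` on `P`, and the differential of `ψ` is injective.
    have h1 := mvfderiv_mlieBracket ht (ContMDiffOn.mono hVs (Set.subset_univ _))
      (ContMDiffOn.mono hWs (Set.subset_univ _)) hfπ (p := q) hp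
    have hXs' : SmoothFieldOn X ψ.source := ContMDiffOn.mono hXs (Set.subset_univ _)
    have hYs' : SmoothFieldOn Y ψ.source := ContMDiffOn.mono hYs (Set.subset_univ _)
    have h2 := mvfderiv_mlieBracket hs hXs' hYs' hf hp
    have key : ∀ (Z : ∀ q : Q, TangentSpace 𝓘(ℝ, F) q) (A : ∀ p : P, TangentSpace 𝓘(ℝ, E) p)
        (_ : SmoothFieldOn A ψ.source) (_ : ∀ q, 𝒬.dproj q (Z q) = A (𝒬.proj q))
        (v : TangentSpace 𝓘(ℝ, F) q),
        mvfderiv 𝓘(ℝ, F) (fun r => mvfderiv 𝓘(ℝ, F) (fun r => ψ (𝒬.proj r)) r (Z r)) q v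
        = mvfderiv 𝓘(ℝ, E) (fun p => mvfderiv 𝓘(ℝ, E) ψ p (A p)) (𝒬.proj q) (𝒬.dproj q v) := by
      intro Z A hA hZA v
      rw [← mvfderiv_comp_proj 𝒬
        (contMDiffOn_mdifferentiableAt hs (hA.contMDiffOn_mvfderiv hs hf) hp)]
      refine congrArg (fun T : F →L[ℝ] E => T v) (mvfderiv_congr ?_)
      filter_upwards [ht.mem_nhds hp] with r hr
      rw [mvfderiv_comp_proj 𝒬 (hfd _ hr), hZA]
    rw [key W Y hYs' hW.dproj, key V X hXs' hV.dproj, mvfderiv_comp_proj 𝒬 (hfd _ hp),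
      hV.dproj, hW.dproj, ← h2] at h1
    have h3 := congrArg (chartSymmDer E (𝒬.proj q) (ψ (𝒬.proj q))) h1
    exact (chartSymmDer_chartDer hp _).symm.trans (h3.trans (chartSymmDer_chartDer hp _))
  · intro q
    -- Cartan's formula for `σ`, in which `dσ(V, W)` is the curvature, is solved for `σ([V, W])`.
    have h := extDer_apply isOpen_univ 𝒬.isConnectionForm.smooth hVs hWs (Set.mem_univ q)
    rw [𝒬.curvature, show (fun q => 𝒬.σ q (W q)) = w from funext hW.σ,
      show (fun q => 𝒬.σ q (V q)) = u from funext hV.σ] at h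
    have e1 : mfderiv 𝓘(ℝ, F) 𝓘(ℝ, E) 𝒬.proj q (V q) = X (𝒬.proj q) := hV.dproj q
    have e2 : mfderiv 𝓘(ℝ, F) 𝓘(ℝ, E) 𝒬.proj q (W q) = Y (𝒬.proj q) := hW.dproj q
    rw [e1, e2] at h
    linarith

/-- The value of `β` on a section of `L`. -/
def betaFun (𝒬 : Prequantization L F Q) (a : L.Sections) (p : P) : ℝ := 𝒬.β p (a.val p)

lemma contMDiff_betaFun (a : L.Sections) : ContMDiff 𝓘(ℝ, E) 𝓘(ℝ, ℝ) ∞ (𝒬.betaFun a) :=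
  𝒬.isCochain a

/-- The bracket of lifts of sections of `L`, with vertical parts given by `β` up to functions
on `P`. -/
lemma IsLift.mlieBracket_sections {a b : L.Sections} {V W : ∀ q : Q, TangentSpace 𝓘(ℝ, F) q}
    {f g : P → ℝ} (hf : ContMDiff 𝓘(ℝ, E) 𝓘(ℝ, ℝ) ∞ f) (hg : ContMDiff 𝓘(ℝ, E) 𝓘(ℝ, ℝ) ∞ g)
    (hV : 𝒬.IsLift V (fun p => (a.1 p).1) (fun q => 𝒬.betaFun a (𝒬.proj q) + f (𝒬.proj q)))
    (hW : 𝒬.IsLift W (fun p => (b.1 p).1) (fun q => 𝒬.betaFun b (𝒬.proj q) + g (𝒬.proj q)))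
    (hVs : SmoothFieldOn V Set.univ) (hWs : SmoothFieldOn W Set.univ) :
    𝒬.IsLift (VectorField.mlieBracket 𝓘(ℝ, F) V W) (fun p => (courant a.1 b.1 p).1)
      (fun q => 𝒬.β _ (a.bracket b (𝒬.proj q)) +
        (mvfderiv 𝓘(ℝ, E) g (𝒬.proj q) (a.1 (𝒬.proj q)).1
          - mvfderiv 𝓘(ℝ, E) f (𝒬.proj q) (b.1 (𝒬.proj q)).1
          - pairMinus (a.1 (𝒬.proj q)) (b.1 (𝒬.proj q)))) := by
  have h := hV.mlieBracket hW hVs hWs a.2.1.1 b.2.1.1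
  refine ⟨h.dproj, fun q => (h.σ q).trans ?_⟩
  -- The derivatives of the `β`-parts add up to `d_L β(a, b) + ⟨[a, b], β⟩`; subtracting `Ω = Υ +
  -- d_L β` leaves `⟨[a, b], β⟩ - Υ(a, b)`.
  have hc := 𝒬.condition a b (𝒬.proj q)
  have hd : ∀ {k : P → ℝ}, ContMDiff 𝓘(ℝ, E) 𝓘(ℝ, ℝ) ∞ k → ∀ p,
      MDifferentiableAt 𝓘(ℝ, E) 𝓘(ℝ, ℝ) k p := fun hk p => (hk p).mdifferentiableAt (by simp)
  have key : ∀ (c : L.Sections) {k : P → ℝ}, ContMDiff 𝓘(ℝ, E) 𝓘(ℝ, ℝ) ∞ k →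
      ∀ v : TangentSpace 𝓘(ℝ, F) q,
      mvfderiv 𝓘(ℝ, F) (fun q => 𝒬.betaFun c (𝒬.proj q) + k (𝒬.proj q)) q v
      = mvfderiv 𝓘(ℝ, E) (𝒬.betaFun c) (𝒬.proj q) (𝒬.dproj q v)
        + mvfderiv 𝓘(ℝ, E) k (𝒬.proj q) (𝒬.dproj q v) := by
    intro c k hk v
    have hβ := hd (contMDiff_betaFun (𝒬 := 𝒬) c)
    refine (𝒬.mvfderiv_comp_proj (f := 𝒬.betaFun c + k) ((hβ _).add (hd hk _)) v).trans ?_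
    rw [mvfderiv_add (hβ _) (hd hk _)]
    rfl
  rw [key b hg, key a hf, hV.dproj, hW.dproj, hc]
  have hdiff : L.algebroidDiff 𝒬.β a b (𝒬.proj q) =
      mvfderiv 𝓘(ℝ, E) (𝒬.betaFun b) (𝒬.proj q) (a.1 (𝒬.proj q)).1
        - mvfderiv 𝓘(ℝ, E) (𝒬.betaFun a) (𝒬.proj q) (b.1 (𝒬.proj q)).1
        - 𝒬.β (𝒬.proj q) (a.bracket b (𝒬.proj q)) := rfl
  rw [hdiff]
  ring

end Prequantization

/-! ### Self-orthogonality of `L` -/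

namespace DiracStructure

/-- The symmetric pairing as a bilinear form. -/
def pairForm (E : Type*) [NormedAddCommGroup E] [NormedSpace ℝ E] : LinearMap.BilinForm ℝ (E × (E →L[ℝ] ℝ)) :=
  LinearMap.mk₂ ℝ (fun a b => (1 / 2) * (a.2 b.1 + b.2 a.1))
    (fun a b c => by simp only [Prod.fst_add, Prod.snd_add, map_add, add_apply]; ring)
    (fun r a b => by
      simp only [Prod.smul_fst, Prod.smul_snd, map_smul, smul_apply, smul_eq_mul]; ring)
    (fun a b c => by simp only [Prod.fst_add, Prod.snd_add, map_add, add_apply]; ring)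
    (fun r a b => by
      simp only [Prod.smul_fst, Prod.smul_snd, map_smul, smul_apply, smul_eq_mul]; ring)

lemma pairForm_apply {E : Type*} [NormedAddCommGroup E] [NormedSpace ℝ E] (a b : E × (E →L[ℝ] ℝ)) :
    pairForm E a b = (1 / 2) * (a.2 b.1 + b.2 a.1) := rfl

lemma pairForm_nondegenerate (E : Type*) [NormedAddCommGroup E] [NormedSpace ℝ E]
    [FiniteDimensional ℝ E] : (pairForm E).Nondegenerate := by
  have hsep : ∀ v : E, (∀ f : E →L[ℝ] ℝ, f v = 0) → v = 0 := fun v hv =>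
    (Module.forall_dual_apply_eq_zero_iff ℝ v).1 fun f => hv (LinearMap.toContinuousLinearMap f)
  have hsymm : ∀ a b, pairForm E a b = pairForm E b a := fun a b => by
    simp only [pairForm_apply]; ring
  have hl : (pairForm E).SeparatingLeft := by
    intro a ha
    refine Prod.ext (hsep _ fun f => ?_) (ContinuousLinearMap.ext fun v => ?_)
    · have := ha (0, f)
      simpa [pairForm_apply] using this
    · have := ha (v, 0)
      simpa [pairForm_apply] using this
  exact ⟨hl, fun a ha => hl a fun b => (hsymm a b).trans (ha b)⟩

variable {E : Type*} [NormedAddCommGroup E] [NormedSpace ℝ E]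
  {P : Type*} [TopologicalSpace P] [ChartedSpace E P] [IsManifold 𝓘(ℝ, E) ∞ P]
  {L : DiracStructure E P}

lemma finrank_fiber [FiniteDimensional ℝ E] (p : P) :
    Module.finrank ℝ (L.fiber p) = Module.finrank ℝ E := by
  obtain ⟨U, -, hp, e, -, he⟩ := L.exists_frame p
  obtain ⟨hli, hspan⟩ := he p hp
  rw [← hspan, finrank_span_eq_card hli, Fintype.card_fin]

/-- `L_p` is its own orthogonal complement. -/
lemma mem_fiber_of_orthogonal [FiniteDimensional ℝ E] {p : P} {x : Generalized E p}
    (h : ∀ a ∈ L.fiber p, pairPlus x a = 0) : x ∈ L.fiber p := by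
  let W : Submodule ℝ (E × (E →L[ℝ] ℝ)) := L.fiber p
  have hW : Module.finrank ℝ W = Module.finrank ℝ E := finrank_fiber p
  have h1 := LinearMap.BilinForm.finrank_orthogonal (pairForm_nondegenerate E) W
  have h2 : Module.finrank ℝ (E × (E →L[ℝ] ℝ)) = Module.finrank ℝ E + Module.finrank ℝ E := by
    rw [Module.finrank_prod,
      ← (LinearMap.toContinuousLinearMap : (E →ₗ[ℝ] ℝ) ≃ₗ[ℝ] E →L[ℝ] ℝ).finrank_eq]
    congr 1
    exact Subspace.dual_finrank_eq
  have hle : W ≤ LinearMap.BilinForm.orthogonal (pairForm E) W := fun a ha b hb =>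
    (L.maximal_isotropic p).prop b hb a ha
  -- Nondegeneracy gives the complement dimension `2n - n = n`, the rank of `L`, so the inclusion is
  -- an equality.
  have heq : W = LinearMap.BilinForm.orthogonal (pairForm E) W :=
    Submodule.eq_of_le_of_finrank_eq hle (by rw [h1, h2, hW]; omega)
  have hx : x ∈ LinearMap.BilinForm.orthogonal (pairForm E) W := by
    intro a ha
    have := h a ha
    change (1 / 2) * (a.2 x.1 + x.2 a.1) = 0
    exact (congrArg _ (add_comm _ _)).trans this
  rw [← heq] at hx
  exact hx

end DiracStructure

/-! ### The intersection of `L̄` with `TQ × ℝ` -/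

namespace Prequantization

variable {E : Type*} [NormedAddCommGroup E] [NormedSpace ℝ E]
  {P : Type*} [TopologicalSpace P] [ChartedSpace E P] [IsManifold 𝓘(ℝ, E) ∞ P]
  [FiniteDimensional ℝ E] {F : Type*} [NormedAddCommGroup F] [NormedSpace ℝ F]
  {Q : Type*} [TopologicalSpace Q] [ChartedSpace F Q] [IsManifold 𝓘(ℝ, F) ∞ Q]
  [MulAction Circle Q] {L : DiracStructure E P} (𝒬 : Prequantization L F Q)

/-- The admissible choices of `A ⊕ α` differ by elements of `ker β`. -/
lemma exists_reference (p : P) : ∃ c₀ : Generalized E p, ∀ c : Generalized E p,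
    pairPlus c c = 0 → (∀ a : L.fiber p, 𝒬.β _ a = 2 * pairPlus c a.1) →
    ∃ l : L.fiber p, l.1 = c₀ - c ∧ 𝒬.β _ l = 0 := by
  by_cases hex : ∃ c₀ : Generalized E p,
    pairPlus c₀ c₀ = 0 ∧ (∀ a : L.fiber p, 𝒬.β _ a = 2 * pairPlus c₀ a.1)
  · obtain ⟨c₀, h0, h0'⟩ := hex
    refine ⟨c₀, fun c hc hc' => ?_⟩
    have hlin : ∀ a b d : Generalized E p, pairPlus (a - b) d = pairPlus a d - pairPlus b d := by
      intro a b d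
      simp only [pairPlus, Prod.fst_sub, Prod.snd_sub, map_sub, sub_apply]
      ring
    have hsymm : ∀ a b : Generalized E p, pairPlus a b = pairPlus b a := by
      intro a b
      simp only [pairPlus]
      ring
    have horth : ∀ a ∈ L.fiber p, pairPlus (c₀ - c) a = 0 := by
      intro a ha
      have e1 := h0' ⟨a, ha⟩
      have e2 := hc' ⟨a, ha⟩
      rw [hlin]
      simp only at e1 e2
      linarith
    -- Two representatives of `β` differ by an element orthogonal to `L_p`, which is its own
    -- orthogonal complement.
    have hmem : c₀ - c ∈ L.fiber p := DiracStructure.mem_fiber_of_orthogonal horth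
    refine ⟨⟨c₀ - c, hmem⟩, rfl, ?_⟩
    -- As `c₀`, `c` and `c₀ - c` are all isotropic, `⟨c₀, c⟩₊ = 0`, and therefore `β(c₀ - c) = 2⟨c₀,
    -- c₀ - c⟩₊ = 0`.
    have hquad := horth _ hmem
    rw [h0', hsymm]
    rw [hlin, hsymm c₀, hsymm c, hlin, hlin, h0, hc, hsymm c c₀] at hquad
    change 2 * pairPlus (c₀ - c) c₀ = 0
    rw [hlin, h0, hsymm c c₀]
    linarith
  -- Without an isotropic representative of `β` the requirement on `c₀` is vacuous, and any value
  -- serves.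
  · refine ⟨0, fun c hc hc' => (hex ⟨c, hc, hc'⟩).elim⟩


variable {𝒬} in
/-- A vector `(Y, f)` of `L̄ ∩ (TQ × ℝ)` comes from `L ∩ TP`. -/
lemma mem_Lbar_pure {q : Q} {Y : TangentSpace 𝓘(ℝ, F) q} {f : ℝ} [FiniteDimensional ℝ F] :
    (((Y, f), (0, 0)) : ExtGeneralized F q) ∈ 𝒬.Lbar q ↔ f = 0 ∧ ∃ a : L.fiber (𝒬.proj q),
      a.1.2 = 0 ∧ 𝒬.dproj q Y = a.1.1 ∧ 𝒬.σ q Y = 𝒬.β _ a := by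
  constructor
  · intro h
    obtain ⟨c₀, hc₀⟩ := 𝒬.exists_reference (𝒬.proj q)
    -- A parametrization of `L̄` with a single reference `c₀`: `t` is the coefficient of the third
    -- line, `w.2.2` that of the second, and `a` absorbs the differences between the choices of `A ⊕
    -- α`.
    let W : Submodule ℝ (ExtGeneralized F q) :=
      { carrier := {w | ∃ (a : L.fiber (𝒬.proj q)) (t : ℝ),
          𝒬.dproj q w.1.1 = a.1.1 - t • c₀.1 ∧ 𝒬.σ q w.1.1 = 𝒬.β _ a - w.2.2 ∧ w.1.2 = t ∧
          w.2.1 = a.1.2.comp (𝒬.dproj q) + t • (𝒬.σ q - c₀.2.comp (𝒬.dproj q))}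
        zero_mem' := ⟨0, 0, by simp, by simp, by simp, by simp⟩
        add_mem' := by
          rintro x y ⟨a, t, h1, h2, h3, h4⟩ ⟨b, s, k1, k2, k3, k4⟩
          refine ⟨a + b, t + s, ?_, ?_, ?_, ?_⟩
          · rw [Prod.fst_add, Prod.fst_add, map_add, h1, k1]
            simp only [Submodule.coe_add, Prod.fst_add]
            module
          · rw [Prod.fst_add, Prod.fst_add, map_add, h2, k2, map_add, Prod.snd_add, Prod.snd_add]
            ring
          · rw [Prod.fst_add, Prod.snd_add, h3, k3]
          · rw [Prod.snd_add, Prod.fst_add, h4, k4]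
            simp only [Submodule.coe_add, Prod.snd_add, ContinuousLinearMap.add_comp]
            module
        smul_mem' := by
          rintro r x ⟨a, t, h1, h2, h3, h4⟩
          refine ⟨r • a, r * t, ?_, ?_, ?_, ?_⟩
          · rw [Prod.smul_fst, Prod.smul_fst, map_smul, h1]
            simp only [Submodule.coe_smul, Prod.smul_fst]
            module
          · rw [Prod.smul_fst, Prod.smul_fst, map_smul, h2, map_smul, Prod.smul_snd, Prod.smul_snd]
            simp only [smul_eq_mul]
            ring
          · rw [Prod.smul_fst, Prod.smul_snd, h3, smul_eq_mul]
          · rw [Prod.smul_snd, Prod.smul_fst, h4]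
            simp only [Submodule.coe_smul, Prod.smul_snd, ContinuousLinearMap.smul_comp]
            module }
    have hle : 𝒬.Lbar q ≤ W := by
      refine sup_le (sup_le (Submodule.span_le.2 ?_) (Submodule.span_le.2 ?_))
        (Submodule.span_le.2 ?_)
      · rintro _ ⟨a, rfl⟩
        refine ⟨a, 0, ?_, ?_, rfl, ?_⟩
        · simp [𝒬.dproj_generator, 𝒬.dproj_horLift]
        · simp [𝒬.σ_generator, 𝒬.σ_horLift]
        · simp
      · rintro _ rfl
        refine ⟨0, 0, ?_, ?_, rfl, ?_⟩
        · simp [𝒬.dproj_generator]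
        · simp [𝒬.σ_generator]
        · simp
      · rintro _ ⟨c, hc, hc', rfl⟩
        obtain ⟨l, hl, hl'⟩ := hc₀ c hc hc'
        refine ⟨l, 1, ?_, ?_, rfl, ?_⟩
        · simp [𝒬.dproj_horLift, hl]
        · simp [𝒬.σ_horLift, hl']
        · rw [hl]
          simp [ContinuousLinearMap.sub_comp]
    obtain ⟨a, t, h1, h2, h3, h4⟩ := hle h
    have hf := 𝒬.eq_zero_of_mem_Lbar h
    subst hf
    simp only at h1 h2 h3 h4
    subst h3
    simp only [zero_smul, sub_zero, add_zero] at h1 h2 h4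
    refine ⟨rfl, a, ?_, h1, h2⟩
    ext v
    -- Horizontal lifts are test vectors that recover `ξ` from `π^*ξ`.
    have h5 := congrArg (fun T : F →L[ℝ] ℝ => T (𝒬.horLift q v)) h4
    change (0 : ℝ) = a.1.2 (𝒬.dproj q (𝒬.horLift q v)) at h5
    rw [𝒬.dproj_horLift] at h5
    exact h5.symm
  · rintro ⟨rfl, a, ha, h1, h2⟩
    refine Submodule.mem_sup_left (Submodule.mem_sup_left (Submodule.subset_span ⟨a, ?_⟩))
    have hY : Y = 𝒬.horLift q a.1.1 + 𝒬.β _ a • generator F q := by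
      refine 𝒬.tangent_ext (q := q) ?_ ?_
      · rw [h1, map_add, map_smul, 𝒬.dproj_generator, 𝒬.dproj_horLift, smul_zero, add_zero]
      · rw [h2, map_add, map_smul, 𝒬.σ_generator, 𝒬.σ_horLift, zero_add, smul_eq_mul, mul_one]
    rw [hY, ha]
    simp

variable {𝒬} in
-- By `mem_Lbar_pure` the vectors that test a basic function are the lifts `X^H + ⟨X ⊕ 0, β⟩ E` with
-- `X ⊕ 0` in `L`, described here by their projection and their value under `σ`.
lemma isBasic_iff [FiniteDimensional ℝ F] {U : TopologicalSpace.Opens P} {φ : 𝒬.Over U → ℂ} :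
    IsBasic φ ↔ IsSmooth φ ∧ ∀ (q : 𝒬.Over U) (a : L.fiber (𝒬.proj q.1))
      (v : TangentSpace 𝓘(ℝ, F) q.1), a.1.2 = 0 → 𝒬.dproj q.1 v = a.1.1 →
      𝒬.σ q.1 v = 𝒬.β _ a → der φ q v = 0 := by
  refine and_congr_right fun _ => ⟨fun h q a v h1 h2 h3 => ?_, fun h q X f hX => ?_⟩
  · simpa using h q v 0 (mem_Lbar_pure.2 ⟨rfl, a, h1, h2, h3⟩)
  · obtain ⟨rfl, a, h1, h2, h3⟩ := mem_Lbar_pure.1 hX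
    simpa using h q a X h1 h2 h3

end Prequantization

/-! ### Locality of basic functions, and hamiltonian pairs of pull-backs -/

namespace Prequantization

variable {E : Type*} [NormedAddCommGroup E] [NormedSpace ℝ E]
  {P : Type*} [TopologicalSpace P] [ChartedSpace E P] [IsManifold 𝓘(ℝ, E) ∞ P]
  {F : Type*} [NormedAddCommGroup F] [NormedSpace ℝ F]
  {Q : Type*} [TopologicalSpace Q] [ChartedSpace F Q] [IsManifold 𝓘(ℝ, F) ∞ Q]
  [MulAction Circle Q] {L : DiracStructure E P} {𝒬 : Prequantization L F Q}
  {U V : TopologicalSpace.Opens P}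

lemma der_resFun (h : V ≤ U) (φ : 𝒬.Over U → ℂ) (q : 𝒬.Over V) :
    der (resFun h φ) q = der φ (⟨q.1, h q.2⟩ : 𝒬.Over U) :=
  der_eq_of_forall (g := ext φ) (fun r => (ext_apply φ ⟨r.1, h r.2⟩).symm) q

/-- Basic functions can be recognized locally on `P`. -/
lemma isBasic_of_cover {𝒰 : Set (TopologicalSpace.Opens P)} {φ : 𝒬.Over (sSup 𝒰) → ℂ}
    (h : ∀ U (hU : U ∈ 𝒰), IsBasic (resFun (le_sSup hU) φ)) : IsBasic φ := by
  have hcov : ∀ q : 𝒬.Over (sSup 𝒰), ∃ U ∈ 𝒰, 𝒬.proj q.1 ∈ U := fun q =>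
    TopologicalSpace.Opens.mem_sSup.1 q.2
  constructor
  · intro q hq
    obtain ⟨U, hU, hqU⟩ := hcov ⟨q, hq⟩
    have h1 : ContMDiffOn 𝓘(ℝ, F) 𝓘(ℝ, ℂ) ∞ (ext φ) (𝒬.proj ⁻¹' U) :=
      ContMDiffOn.congr (h U hU).1 fun r hr =>
        ((ext_eqOn (φ := resFun (le_sSup hU) φ) (g := ext φ)
          fun s => (ext_apply φ ⟨s.1, le_sSup hU s.2⟩).symm) hr).symm
    exact (h1.contMDiffAt (𝒬.isOpen_over.mem_nhds hqU)).contMDiffWithinAt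
  · intro q X f hX
    obtain ⟨U, hU, hqU⟩ := hcov q
    have e := congrArg (fun T : F →L[ℝ] ℂ => T X) (der_resFun (le_sSup hU) φ ⟨q.1, hqU⟩)
    exact (congrArg (fun z => z + φ q * f) e.symm).trans ((h U hU).2 ⟨q.1, hqU⟩ X f hX)

variable [FiniteDimensional ℝ F]
variable {g : P → ℝ} {X : ∀ p : P, TangentSpace 𝓘(ℝ, E) p}

variable (𝒬) in
/-- The hamiltonian vector field `X_g^H + (⟨X_g ⊕ dg, β⟩ - g) E` of `π^*g`. -/
def hamLift (hX : L.IsHamiltonian X g) (hg : ContMDiff 𝓘(ℝ, E) 𝓘(ℝ, ℝ) ∞ g) (q : Q) :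
    TangentSpace 𝓘(ℝ, F) q :=
  𝒬.lift X (fun q => 𝒬.betaFun (hX.section hg) (𝒬.proj q) + -g (𝒬.proj q)) q

variable (hX : L.IsHamiltonian X g) (hg : ContMDiff 𝓘(ℝ, E) 𝓘(ℝ, ℝ) ∞ g)

lemma isLift_hamLift : 𝒬.IsLift (𝒬.hamLift hX hg) X
    (fun q => 𝒬.betaFun (hX.section hg) (𝒬.proj q) + -g (𝒬.proj q)) :=
  𝒬.isLift_lift _ _

lemma smooth_hamLift : SmoothFieldOn (𝒬.hamLift hX hg) Set.univ :=
  (isLift_hamLift hX hg).smooth hX.1 (((contMDiff_betaFun _).add hg.neg).comp 𝒬.contMDiff_proj)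

omit [FiniteDimensional ℝ F] in
-- The vector is the element of the first family given by `X_g ⊕ dg`, plus `g` times `(-E, 0) ⊕ (0,
-- 1)`. The third family does not enter, whence the function of the pair is zero.
lemma hamLift_mem_Lbar (q : Q) :
    (((𝒬.hamLift hX hg q, 0), (mvfderiv 𝓘(ℝ, F) (fun q => g (𝒬.proj q)) q, g (𝒬.proj q))) :
      ExtGeneralized F q) ∈ 𝒬.Lbar q := by
  refine Submodule.mem_sup_left ?_
  have h1 : ((𝒬.horLift q (X (𝒬.proj q)) + 𝒬.betaFun (hX.section hg) (𝒬.proj q) • generator F q,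
      (0 : ℝ)), ((mvfderiv 𝓘(ℝ, E) g (𝒬.proj q)).comp (𝒬.dproj q), (0 : ℝ))) ∈
      Submodule.span ℝ {w : ExtGeneralized F q | ∃ a : L.fiber (𝒬.proj q),
        w = ((𝒬.horLift q a.1.1 + 𝒬.β _ a • generator F q, 0), (a.1.2.comp (𝒬.dproj q), 0))} :=
    Submodule.subset_span ⟨(hX.section hg).val (𝒬.proj q), rfl⟩
  have h2 : (((-generator F q, 0), (0, 1)) : ExtGeneralized F q) ∈
      Submodule.span ℝ {(((-generator F q, 0), (0, 1)) : ExtGeneralized F q)} :=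
    Submodule.mem_span_singleton_self _
  have h := Submodule.add_mem_sup h1 (Submodule.smul_mem _ (g (𝒬.proj q)) h2)
  convert h using 1
  refine Prod.ext (Prod.ext ?_ ?_) (Prod.ext ?_ ?_)
  · simp only [hamLift, lift, Prod.fst_add, Prod.smul_fst]
    module
  · simp
  · simp only [Prod.fst_add, Prod.snd_add, Prod.smul_snd, Prod.smul_fst, smul_zero, add_zero]
    refine ContinuousLinearMap.ext fun v => ?_
    exact 𝒬.mvfderiv_comp_proj ((hg _).mdifferentiableAt (by simp)) v
  · simp

lemma isHamiltonianPair_hamLift :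
    𝒬.IsHamiltonianPair (𝒬.hamLift hX hg) (fun _ => 0) (fun q => g (𝒬.proj q)) :=
  ⟨smooth_hamLift hX hg, contMDiff_const, hamLift_mem_Lbar hX hg⟩

omit [FiniteDimensional ℝ F] in
/-- The action of a hamiltonian pair on basic functions does not depend on the pair. -/
lemma der_hamLift {Y : ∀ q : Q, TangentSpace 𝓘(ℝ, F) q} {u : Q → ℝ}
    (hY : 𝒬.IsHamiltonianPair Y u (fun q => g (𝒬.proj q))) {φ : 𝒬.Over U → ℂ} (hφ : IsBasic φ)
    (q : 𝒬.Over U) : der φ q (𝒬.hamLift hX hg q.1) = der φ q (Y q.1) + φ q * u q.1 := by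
  -- The cotangent parts of the two pairs agree, so their difference lies in `L̄ ∩ (TQ × ℝ)` and
  -- annihilates `φ`.
  have h := hφ.2 q (Y q.1 - 𝒬.hamLift hX hg q.1) (u q.1 - 0) (by
    convert Submodule.sub_mem _ (hY.2.2 q.1) (hamLift_mem_Lbar hX hg q.1) using 1
    exact Prod.ext rfl (Prod.ext (sub_self _).symm (sub_self _).symm))
  rw [map_sub] at h
  push_cast at h
  linear_combination -h

end Prequantization

/-! ### Linear differential equations and transport of kernels -/

section LinearODE

variable {R W : Type*} [NormedAddCommGroup R] [NormedSpace ℝ R]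
  [NormedAddCommGroup W] [NormedSpace ℝ W]

/-- Local solvability of linear differential equations with continuous coefficients. -/
lemma exists_linear_ode_solution [CompleteSpace R] {A : ℝ → R →L[ℝ] R} {δ : ℝ} (hδ : 0 < δ)
    (hA : ContinuousOn A (Set.Icc 0 δ)) (x₀ : R) :
    ∃ ε, 0 < ε ∧ ε ≤ δ ∧ ∃ a : ℝ → R, a 0 = x₀ ∧
      ∀ t ∈ Set.Icc 0 ε, HasDerivWithinAt a (A t (a t)) (Set.Icc 0 ε) t := by
  obtain ⟨M, hM⟩ := isCompact_Icc.exists_bound_of_continuousOn hA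
  have hM0 : 0 ≤ M := (norm_nonneg _).trans (hM 0 ⟨le_rfl, hδ.le⟩)
  -- `K` is a Lipschitz constant of the field and `B` bounds it on the unit ball about `x₀`. The
  -- choice of `ε` ensures `B ε ≤ 1`, so that solutions stay in this ball; the `+ 1` keeps the
  -- denominator positive.
  let K : NNReal := ⟨M, hM0⟩
  let B : NNReal := K * (‖x₀‖₊ + 1)
  let ε : ℝ := min δ (1 / (B + 1))
  have hB : (0 : ℝ) < B + 1 := by positivity
  have hε : 0 < ε := lt_min hδ (by positivity)
  have hsub : Set.Icc 0 ε ⊆ Set.Icc 0 δ := Set.Icc_subset_Icc_right (min_le_left _ _)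
  have hP : IsPicardLindelof (fun t x => A t x) (tmin := 0) (tmax := ε) ⟨0, le_rfl, hε.le⟩ x₀
      1 0 B K := by
    refine ⟨fun t ht => ?_, fun x _ => ?_, fun t ht x hx => ?_, ?_⟩
    · exact ((A t).lipschitz.weaken (hM t (hsub ht))).lipschitzOnWith
    · exact (hA.mono hsub).clm_apply continuousOn_const
    · have h1 : ‖x‖ ≤ ‖x₀‖ + 1 := by
        have : ‖x - x₀‖ ≤ 1 := by simpa [dist_eq_norm] using hx
        calc ‖x‖ = ‖x₀ + (x - x₀)‖ := by rw [add_sub_cancel]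
          _ ≤ ‖x₀‖ + ‖x - x₀‖ := norm_add_le _ _
          _ ≤ ‖x₀‖ + 1 := by gcongr
      exact ((A t).le_of_opNorm_le (hM t (hsub ht)) x).trans
        (mul_le_mul_of_nonneg_left h1 hM0)
    · have h1 : ε ≤ 1 / (B + 1) := min_le_right _ _
      have h2 : (B : ℝ) * ε ≤ 1 := by
        rw [le_div_iff₀ hB] at h1
        nlinarith
      simpa [hε.le] using h2
  obtain ⟨a, ha, hode⟩ := hP.exists_eq_forall_mem_Icc_hasDerivWithinAt₀
  exact ⟨ε, hε, min_le_left _ _, a, ha, hode⟩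

/-- Solutions of a linear differential equation that start at zero vanish. -/
lemma linear_ode_eq_zero {D : ℝ → W →L[ℝ] W} {ε : ℝ} (hD : ContinuousOn D (Set.Icc 0 ε))
    {θ : ℝ → W} (h0 : θ 0 = 0)
    (hθ : ∀ t ∈ Set.Icc 0 ε, HasDerivWithinAt θ (D t (θ t)) (Set.Icc 0 ε) t) :
    ∀ t ∈ Set.Icc 0 ε, θ t = 0 := by
  obtain ⟨M, hM⟩ := isCompact_Icc.exists_bound_of_continuousOn hD
  intro t ht
  have h := norm_le_gronwallBound_of_norm_deriv_right_le (f := θ) (f' := fun t => D t (θ t))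
    (δ := 0) (K := M) (ε := 0) (a := 0) (b := ε)
    (fun t ht => (hθ t ht).continuousWithinAt)
    (fun t ht => (hθ t ⟨ht.1, ht.2.le⟩).mono_of_mem_nhdsWithin
      (Icc_mem_nhdsGE_of_mem ht)) (by rw [h0, norm_zero])
    (fun t ht => by
      rw [add_zero]
      exact (D t).le_of_opNorm_le (hM t ⟨ht.1, ht.2.le⟩) _) t ht
  simp only [gronwallBound, zero_mul, zero_div, add_zero, ite_self] at h
  exact norm_le_zero_iff.1 h

/-- If `ker H(t) ⊆ ker v(t)`, where `H' = H C + D H` and `v' = w + v C` at `0`,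
then `ker H(0) ⊆ ker w`. -/
lemma transport_kernel [CompleteSpace R] {Z : Type*} [NormedAddCommGroup Z] [NormedSpace ℝ Z]
    {C : ℝ → R →L[ℝ] R} {D : ℝ → W →L[ℝ] W} {H : ℝ → R →L[ℝ] W} {v : ℝ → R →L[ℝ] Z}
    {w : R →L[ℝ] Z} (hC : ∀ᶠ t in 𝓝 0, ContinuousAt C t) (hD : ∀ᶠ t in 𝓝 0, ContinuousAt D t)
    (hH : ∀ᶠ t in 𝓝 0, HasDerivAt H ((H t).comp (C t) + (D t).comp (H t)) t)
    (hv : HasDerivAt v (w + (v 0).comp (C 0)) 0)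
    (hker : ∀ᶠ t in 𝓝 0, ∀ a, H t a = 0 → v t a = 0) {x₀ : R} (hx₀ : H 0 x₀ = 0) : w x₀ = 0 := by
  obtain ⟨δ, hδ, hball⟩ := Metric.eventually_nhds_iff_ball.1 (hC.and (hD.and (hH.and hker)))
  have hsub : ∀ t ∈ Set.Icc (0 : ℝ) (δ / 2), t ∈ Metric.ball (0 : ℝ) δ := by
    rintro t ⟨h1, h2⟩
    rw [Metric.mem_ball, dist_zero_right, Real.norm_of_nonneg h1]
    linarith
  -- Transport `x₀` by `a' = -C a`. Then `(H a)' = D (H a)`, so `H a` stays zero and with it `v a`.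
  obtain ⟨ε, hε, hεδ, a, ha0, ha⟩ := exists_linear_ode_solution (A := fun t => -C t) (half_pos hδ)
    (fun t ht => (hball t (hsub t ht)).1.neg.continuousWithinAt) x₀
  have hsub' : ∀ t ∈ Set.Icc (0 : ℝ) ε, t ∈ Metric.ball (0 : ℝ) δ := fun t ht =>
    hsub t ⟨ht.1, ht.2.trans hεδ⟩
  have hθ := linear_ode_eq_zero (D := D) (ε := ε) (θ := fun t => H t (a t))
    (fun t ht => (hball t (hsub' t ht)).2.1.continuousWithinAt) (by rw [ha0, hx₀])
    (fun t ht => by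
      convert (hball t (hsub' t ht)).2.2.1.hasDerivWithinAt.clm_apply (ha t ht) using 1
      simp)
  have hva : ∀ t ∈ Set.Icc 0 ε, v t (a t) = 0 := fun t ht =>
    (hball t (hsub' t ht)).2.2.2 _ (hθ t ht)
  have h0 : (0 : ℝ) ∈ Set.Icc 0 ε := ⟨le_rfl, hε.le⟩
  -- The one-sided derivative of `v a` at `0` is `(w + v C) x₀ - v C x₀ = w x₀`, and it vanishes.
  have h1 := (hv.hasDerivWithinAt (s := Set.Icc 0 ε)).clm_apply (ha 0 h0)
  have h2 : HasDerivWithinAt (fun t => v t (a t)) (0 : Z) (Set.Icc 0 ε) 0 :=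
    (hasDerivWithinAt_const _ _ _).congr hva (hva 0 h0)
  have h3 := (uniqueDiffOn_Icc hε).uniqueDiffWithinAt h0 |>.eq_deriv _ h1 h2
  simpa [ha0] using h3

end LinearODE

/-! ### Frames, global sections and coordinates -/

section Frames

variable {ι : Type*} [Fintype ι] {K : Type*} [NormedAddCommGroup K] [NormedSpace ℝ K]

/-- The linear combinations of a family of vectors, as a continuous linear function of the
family. -/
def comboL (ι : Type*) [Fintype ι] (K : Type*) [NormedAddCommGroup K] [NormedSpace ℝ K] :
    (ι → K) →L[ℝ] ((ι → ℝ) →L[ℝ] K) :=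
  ∑ i, (ContinuousLinearMap.smulRightL ℝ (ι → ℝ) K (ContinuousLinearMap.proj i)).comp
    (ContinuousLinearMap.proj i)

lemma comboL_apply (h : ι → K) (a : ι → ℝ) : comboL ι K h a = ∑ i, a i • h i := by
  simp [comboL]

/-- The coefficients of a continuous map with respect to a continuous frame are continuous. -/
lemma exists_continuous_coefficients {P : Type*} [TopologicalSpace P] {p₀ : P} {a : P → ι → K}
    {b : P → K} (ha : ∀ᶠ p in 𝓝 p₀, ContinuousAt a p) (hb : ∀ᶠ p in 𝓝 p₀, ContinuousAt b p)
    [FiniteDimensional ℝ K]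
    (hli : LinearIndependent ℝ (a p₀)) (hspan : ∀ᶠ p in 𝓝 p₀, ∃ x : ι → ℝ, b p = ∑ i, x i • a p i) :
    ∃ c : P → ι → ℝ, ∀ᶠ p in 𝓝 p₀, ContinuousAt c p ∧ b p = ∑ i, c p i • a p i := by
  let T : P → (ι → ℝ) →L[ℝ] K := fun p => comboL ι K (a p)
  have hinj : (T p₀ : (ι → ℝ) →ₗ[ℝ] K).ker = ⊥ := by
    rw [LinearMap.ker_eq_bot']
    intro x hx
    funext i
    exact (Fintype.linearIndependent_iff.1 hli) x ((comboL_apply _ _).symm.trans hx) i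
  -- A left inverse `S` of the frame at `p₀` composes with the frame at `p` to an endomorphism that
  -- is the identity at `p₀`, hence invertible nearby; its inverse yields continuous coefficients.
  obtain ⟨g, hg⟩ := LinearMap.exists_leftInverse_of_injective _ hinj
  let S : K →L[ℝ] (ι → ℝ) := LinearMap.toContinuousLinearMap g
  let M : P → (ι → ℝ) →L[ℝ] (ι → ℝ) := fun p => S.comp (T p)
  have hM0 : M p₀ = 1 := by
    ext1 x
    exact congrArg (fun f : (ι → ℝ) →ₗ[ℝ] (ι → ℝ) => f x) hg
  have hM : ∀ p, ContinuousAt a p → ContinuousAt M p := fun p hp =>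
    (ContinuousLinearMap.compL ℝ (ι → ℝ) K (ι → ℝ) S).continuous.continuousAt.comp
      ((comboL ι K).continuous.continuousAt.comp hp)
  have hunit : ∀ᶠ p in 𝓝 p₀, IsUnit (M p) := by
    have h1 : {x : (ι → ℝ) →L[ℝ] (ι → ℝ) | IsUnit x} ∈ 𝓝 (M p₀) := by
      rw [hM0]
      exact Units.isOpen.mem_nhds isUnit_one
    exact (hM p₀ ha.self_of_nhds).eventually h1
  refine ⟨fun p => Ring.inverse (M p) (S (b p)), ?_⟩
  filter_upwards [ha, hb, hspan, hunit] with p hap hbp hsp hup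
  constructor
  · obtain ⟨u, hu⟩ := hup
    have h1 : ContinuousAt Ring.inverse (M p) := hu ▸ NormedRing.inverse_continuousAt u
    exact (h1.comp (hM p hap)).clm_apply (S.continuous.continuousAt.comp hbp)
  · obtain ⟨x, hx⟩ := hsp
    have h1 : b p = T p x := hx.trans (comboL_apply _ _).symm
    have h2 : Ring.inverse (M p) (S (b p)) = x := by
      rw [h1]
      have := Ring.inverse_mul_cancel (M p) hup
      exact congrArg (fun f : (ι → ℝ) →L[ℝ] (ι → ℝ) => f x) this
    rw [h2, hx]

end Frames

namespace DiracStructure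

variable {E : Type*} [NormedAddCommGroup E] [NormedSpace ℝ E] [FiniteDimensional ℝ E]
  {P : Type*} [TopologicalSpace P] [T2Space P] [ChartedSpace E P] [IsManifold 𝓘(ℝ, E) ∞ P]
  (L : DiracStructure E P)

/-- Near every point, `L` has a frame of global sections. -/
lemma exists_sections_frame (p₀ : P) : ∃ a : Fin (Module.finrank ℝ E) → L.Sections,
    ∀ᶠ p in 𝓝 p₀, LinearIndependent ℝ (fun i => (a i).1 p) ∧
      Submodule.span ℝ (Set.range fun i => (a i).1 p) = L.fiber p := by
  obtain ⟨S, hS, hp₀, e, he, hfr⟩ := L.exists_frame p₀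
  -- Closure under the Courant bracket and the condition on `β` concern global sections, so the
  -- local frame is cut off by a bump function that is one near `p₀`.
  obtain ⟨χ, -, hχ⟩ := (SmoothBumpFunction.nhds_basis_tsupport (I := 𝓘(ℝ, E)) p₀).mem_iff.1
    (hS.mem_nhds hp₀)
  have hsm : ∀ i, SmoothGenOn (fun p => χ p • e i p) Set.univ := by
    intro i
    constructor
    · exact (ContMDiffOn.smul_section_of_tsupport (V := (TangentSpace 𝓘(ℝ, E) : P → Type _))
        (s := fun p => (e i p).1) (ψ := χ) χ.contMDiff.contMDiffOn hS hχ (he i).1).contMDiffOn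
    · exact (ContMDiffOn.smul_section_of_tsupport
        (V := fun q : P => TangentSpace 𝓘(ℝ, E) q →L[ℝ] ℝ)
        (s := fun p => (e i p).2) (ψ := χ) χ.contMDiff.contMDiffOn hS hχ (he i).2).contMDiffOn
  have hmem : ∀ i p, χ p • e i p ∈ L.fiber p := by
    intro i p
    by_cases hp : p ∈ S
    · refine Submodule.smul_mem _ _ ?_
      rw [← (hfr p hp).2]
      exact Submodule.subset_span ⟨i, rfl⟩
    · rw [image_eq_zero_of_notMem_tsupport fun h => hp (hχ h), zero_smul]
      exact Submodule.zero_mem _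
  refine ⟨fun i => ⟨fun p => χ p • e i p, hsm i, hmem i⟩, ?_⟩
  filter_upwards [hS.mem_nhds hp₀, χ.eventuallyEq_one] with p hp hone
  have h1 : (fun i => χ p • e i p) = fun i => e i p := by
    funext i
    rw [hone]
    exact one_smul _ _
  change LinearIndependent ℝ (fun i => χ p • e i p) ∧
    Submodule.span ℝ (Set.range fun i => χ p • e i p) = L.fiber p
  rw [h1]
  exact hfr p hp

end DiracStructure

section Coordinates

variable {E : Type*} [NormedAddCommGroup E] [NormedSpace ℝ E] [FiniteDimensional ℝ E]
  {P : Type*} [TopologicalSpace P] [ChartedSpace E P]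

/-- The coordinate vector fields of a chart. -/
def coordFrame (E : Type*) [NormedAddCommGroup E] [NormedSpace ℝ E] [FiniteDimensional ℝ E]
    {P : Type*} [TopologicalSpace P] [ChartedSpace E P] (x : P) (k : Fin (Module.finrank ℝ E))
    (p : P) : TangentSpace 𝓘(ℝ, E) p :=
  coordField x (Module.finBasis ℝ E k) p

/-- The coordinates of a tangent vector. -/
def coordVec (x : P) {p : P} (v : TangentSpace 𝓘(ℝ, E) p) (k : Fin (Module.finrank ℝ E)) : ℝ :=
  (Module.finBasis ℝ E).repr (chartDer E x p v) k

/-- The coordinates of a 1-form. -/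
def coordForm (x : P) {p : P} (ξ : Cotangent E p) (k : Fin (Module.finrank ℝ E)) : ℝ :=
  ξ (coordFrame E x k p)

variable [IsManifold 𝓘(ℝ, E) ∞ P]

lemma sum_coordVec {x p : P} (hp : p ∈ (extChartAt 𝓘(ℝ, E) x).source)
    (v : TangentSpace 𝓘(ℝ, E) p) : ∑ k, coordVec x v k • coordFrame E x k p = v := by
  refine Eq.trans ?_ (coordField_chartDer hp v)
  change ∑ k, (Module.finBasis ℝ E).repr (chartDer E x p v) k •
    chartSymmDer E x (extChartAt 𝓘(ℝ, E) x p) (Module.finBasis ℝ E k) =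
      chartSymmDer E x (extChartAt 𝓘(ℝ, E) x p) (chartDer E x p v)
  conv_rhs => rw [← (Module.finBasis ℝ E).sum_repr (chartDer E x p v), map_sum]
  simp_rw [map_smul]

lemma eq_zero_of_coordForm {x p : P} (hp : p ∈ (extChartAt 𝓘(ℝ, E) x).source)
    {ξ : Cotangent E p} (h : ∀ k, coordForm x ξ k = 0) : ξ = 0 := by
  ext v
  rw [← sum_coordVec hp v, map_sum]
  refine (Finset.sum_eq_zero fun k _ => ?_)
  rw [map_smul]
  exact (congrArg _ (h k)).trans (smul_zero _)

lemma smooth_coordFrame (x : P) (k : Fin (Module.finrank ℝ E)) :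
    SmoothFieldOn (coordFrame E x k) (extChartAt 𝓘(ℝ, E) x).source :=
  smoothFieldOn_coordField x _

lemma continuousOn_coordVec {x : P} {X : ∀ p : P, TangentSpace 𝓘(ℝ, E) p}
    (hX : SmoothFieldOn X (extChartAt 𝓘(ℝ, E) x).source) :
    ContinuousOn (fun p => coordVec x (X p)) (extChartAt 𝓘(ℝ, E) x).source := by
  have h1 := ((smoothFieldOn_iff (isOpen_extChartAt_source x) subset_rfl).1 hX).continuousOn
  exact (LinearMap.toContinuousLinearMap
    (Module.finBasis ℝ E).equivFun.toLinearMap).continuous.comp_continuousOn h1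

lemma contMDiffOn_coordForm {x : P} {ξ : ∀ p : P, Cotangent E p}
    (hξ : SmoothFormOn ξ (extChartAt 𝓘(ℝ, E) x).source) (k : Fin (Module.finrank ℝ E)) :
    ContMDiffOn 𝓘(ℝ, E) 𝓘(ℝ, ℝ) ∞ (fun p => coordForm x (ξ p) k)
      (extChartAt 𝓘(ℝ, E) x).source :=
  hξ.apply (smooth_coordFrame x k)

/-- The coordinates of an element of `TP ⊕ T*P`. -/
def coordGen (x : P) {p : P} (a : Generalized E p) :
    (Fin (Module.finrank ℝ E) → ℝ) × (Fin (Module.finrank ℝ E) → ℝ) :=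
  (coordVec x a.1, coordForm x a.2)

omit [IsManifold 𝓘(ℝ, E) ∞ P] in
lemma coordGen_sum {n : ℕ} (x : P) {p : P} (a : Fin n → Generalized E p) (s : Fin n → ℝ) :
    coordGen x (∑ i, s i • a i) = ∑ i, s i • coordGen x (a i) := by
  let A : E →ₗ[ℝ] (Fin (Module.finrank ℝ E) → ℝ) :=
    (Module.finBasis ℝ E).equivFun.toLinearMap ∘ₗ (chartDer E x p : E →ₗ[ℝ] E)
  let T : Generalized E p →ₗ[ℝ]
      (Fin (Module.finrank ℝ E) → ℝ) × (Fin (Module.finrank ℝ E) → ℝ) :=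
    { toFun := coordGen x
      map_add' := fun a b => by
        refine Prod.ext (funext fun k => ?_) (funext fun k => ?_)
        · exact congrFun (map_add A a.1 b.1) k
        · rfl
      map_smul' := fun r a => by
        refine Prod.ext (funext fun k => ?_) (funext fun k => ?_)
        · exact congrFun (map_smul A r a.1) k
        · rfl }
  change T _ = ∑ i, s i • T (a i)
  rw [map_sum]
  simp_rw [map_smul]

lemma coordGen_injective {x p : P} (hp : p ∈ (extChartAt 𝓘(ℝ, E) x).source)
    {a b : Generalized E p} (h : coordGen x a = coordGen x b) : a = b := by
  refine Prod.ext ?_ ?_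
  · have h1 : coordVec x a.1 = coordVec x b.1 := congrArg Prod.fst h
    rw [← sum_coordVec hp a.1, ← sum_coordVec hp b.1, h1]
  · have h1 : coordForm x a.2 = coordForm x b.2 := congrArg Prod.snd h
    refine sub_eq_zero.1 (eq_zero_of_coordForm hp fun k => ?_)
    exact sub_eq_zero.2 (congrFun h1 k)

end Coordinates

/-! ### Transport of linear relations in a frame -/

section Transport

variable {ι κ : Type*} [Fintype ι] [Fintype κ]

/-- The relations between the rows of `h` also hold between the entries of `w`, if they hold
between the entries of `y` and `h' = c h + h dᵀ`, `y' = w + c y`. -/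
lemma transport_frame {c : ℝ → ι → ι → ℝ} {d : ℝ → κ → κ → ℝ} {h : ℝ → ι → κ → ℝ}
    {Z : Type*} [NormedAddCommGroup Z] [NormedSpace ℝ Z] {y : ℝ → ι → Z} {w : ι → Z}
    (hc : ∀ᶠ t in 𝓝 0, ContinuousAt c t) (hd : ∀ᶠ t in 𝓝 0, ContinuousAt d t)
    (hh : ∀ᶠ t in 𝓝 0, ∀ i k, HasDerivAt (fun t => h t i k)
      (∑ j, c t i j * h t j k + ∑ l, h t i l * d t k l) t)
    (hy : ∀ i, HasDerivAt (fun t => y t i) (w i + ∑ j, c 0 i j • y 0 j) 0)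
    (hker : ∀ᶠ t in 𝓝 0, ∀ s : ι → ℝ, (∀ k, ∑ i, s i * h t i k = 0) → ∑ i, s i • y t i = 0)
    {s : ι → ℝ} (hs : ∀ k, ∑ i, s i * h 0 i k = 0) : ∑ i, s i • w i = 0 := by
  have hcomb : ∀ (t : ℝ) (s : ι → ℝ), (∀ k, ∑ i, s i * h t i k = 0) ↔
      comboL ι (κ → ℝ) (h t) s = 0 := by
    intro t s
    rw [comboL_apply, funext_iff]
    simp only [Finset.sum_apply, Pi.smul_apply, smul_eq_mul, Pi.zero_apply]
  rw [← comboL_apply]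
  refine transport_kernel (C := fun t => comboL ι (ι → ℝ) (c t))
    (D := fun t => comboL κ (κ → ℝ) (fun l k => d t k l))
    (H := fun t => comboL ι (κ → ℝ) (h t)) (v := fun t => comboL ι Z (y t)) (w := comboL ι Z w)
    ?_ ?_ ?_ ?_ ?_ ((hcomb 0 s).1 hs)
  · filter_upwards [hc] with t ht
    exact (comboL ι (ι → ℝ)).continuous.continuousAt.comp ht
  · filter_upwards [hd] with t ht
    refine (comboL κ (κ → ℝ)).continuous.continuousAt.comp (continuousAt_pi.2 fun l =>
      continuousAt_pi.2 fun k => ?_)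
    exact continuousAt_pi.1 (continuousAt_pi.1 ht k) l
  · filter_upwards [hh] with t ht
    have h1 : HasDerivAt h
        (fun i k => ∑ j, c t i j * h t j k + ∑ l, h t i l * d t k l) t :=
      hasDerivAt_pi.2 fun i => hasDerivAt_pi.2 fun k => ht i k
    refine ((comboL ι (κ → ℝ)).hasFDerivAt.comp_hasDerivAt t h1).congr_deriv ?_
    refine ContinuousLinearMap.ext fun x => funext fun k => ?_
    simp only [comboL_apply, add_apply, ContinuousLinearMap.comp_apply, Finset.sum_apply,
      Pi.smul_apply, smul_eq_mul, Pi.add_apply, mul_add, Finset.sum_add_distrib, Finset.mul_sum,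
      Finset.sum_mul]
    congr 1
    · rw [Finset.sum_comm]
      exact Finset.sum_congr rfl fun i _ => Finset.sum_congr rfl fun j _ => by ring
    · rw [Finset.sum_comm]
      exact Finset.sum_congr rfl fun i _ => Finset.sum_congr rfl fun j _ => by ring
  · have h1 : HasDerivAt y (fun i => w i + ∑ j, c 0 i j • y 0 j) 0 := hasDerivAt_pi.2 hy
    refine ((comboL ι Z).hasFDerivAt.comp_hasDerivAt 0 h1).congr_deriv ?_
    refine ContinuousLinearMap.ext fun x => ?_
    simp only [comboL_apply, add_apply, ContinuousLinearMap.comp_apply, Finset.sum_apply,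
      Pi.smul_apply, smul_eq_mul, smul_add, Finset.sum_add_distrib, Finset.smul_sum,
      Finset.sum_smul, smul_smul]
    congr 1
    rw [Finset.sum_comm]
  · filter_upwards [hker] with t ht x hx
    rw [comboL_apply]
    exact ht x ((hcomb t x).2 hx)

end Transport

/-! ### Derivatives along curves, and the bracket coefficients of a frame -/

section Curves

variable {F : Type*} [NormedAddCommGroup F] [NormedSpace ℝ F]
  {Q : Type*} [TopologicalSpace Q] [ChartedSpace F Q]

lemma hasDerivAt_comp_curve {G : Type*} [NormedAddCommGroup G] [NormedSpace ℝ G] {f : Q → G}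
    {γ : ℝ → Q} {t : ℝ} {w : TangentSpace 𝓘(ℝ, F) (γ t)}
    (hγ : HasMFDerivAt 𝓘(ℝ, ℝ) 𝓘(ℝ, F) γ t ((1 : ℝ →L[ℝ] ℝ).smulRight w))
    (hf : MDifferentiableAt 𝓘(ℝ, F) 𝓘(ℝ, G) f (γ t)) :
    HasDerivAt (fun s => f (γ s)) (mvfderiv 𝓘(ℝ, F) f (γ t) w) t := by
  let A : F →L[ℝ] G := mfderiv 𝓘(ℝ, F) 𝓘(ℝ, G) f (γ t)
  let w' : F := w
  have h : HasFDerivAt (fun s => f (γ s)) (A.comp ((1 : ℝ →L[ℝ] ℝ).smulRight w')) t :=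
    hasMFDerivAt_iff_hasFDerivAt.1 (hf.hasMFDerivAt.comp t hγ)
  have h1 : (A.comp ((1 : ℝ →L[ℝ] ℝ).smulRight w')) 1 = A w' := by simp
  have h2 := h.hasDerivAt
  rw [h1] at h2
  exact h2

end Curves

section Coordinates

variable {E : Type*} [NormedAddCommGroup E] [NormedSpace ℝ E] [FiniteDimensional ℝ E]
  {P : Type*} [TopologicalSpace P] [ChartedSpace E P] [IsManifold 𝓘(ℝ, E) ∞ P]

/-- The derivative along `X` of the coordinates of a 1-form. -/
lemma mvfderiv_coordForm {X : ∀ p : P, TangentSpace 𝓘(ℝ, E) p} {ξ : ∀ p : P, Cotangent E p} {x p : P}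
    (hX : SmoothFieldOn X (extChartAt 𝓘(ℝ, E) x).source)
    (hξ : SmoothFormOn ξ (extChartAt 𝓘(ℝ, E) x).source)
    (hp : p ∈ (extChartAt 𝓘(ℝ, E) x).source) (k : Fin (Module.finrank ℝ E)) :
    mvfderiv 𝓘(ℝ, E) (fun p => coordForm x (ξ p) k) p (X p) = coordForm x (lieDerForm X ξ p) k
      + ∑ l, coordForm x (ξ p) l *
        coordVec x (VectorField.mlieBracket 𝓘(ℝ, E) X (coordFrame E x k) p) l := by
  have h := lieDerForm_apply (isOpen_extChartAt_source x) hξ hX (smooth_coordFrame x k) hp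
  have h2 : ξ p (VectorField.mlieBracket 𝓘(ℝ, E) X (coordFrame E x k) p)
      = ∑ l, coordForm x (ξ p) l *
        coordVec x (VectorField.mlieBracket 𝓘(ℝ, E) X (coordFrame E x k) p) l := by
    conv_lhs => rw [← sum_coordVec hp (VectorField.mlieBracket 𝓘(ℝ, E) X (coordFrame E x k) p)]
    rw [map_sum]
    refine Finset.sum_congr rfl fun l _ => ?_
    rw [map_smul, smul_eq_mul, mul_comm]
    rfl
  rw [← h2]
  exact (sub_eq_iff_eq_add.1 h.symm)

/-- By `lieDerForm_apply` the coordinates of `L_X ξ` are built from a derivative along `X` and a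
value of `ξ` on a bracket, both of which are smooth functions. -/
lemma continuousOn_coordForm_lieDerForm {X : ∀ p : P, TangentSpace 𝓘(ℝ, E) p}
    {ξ : ∀ p : P, Cotangent E p} {x : P} (hX : SmoothFieldOn X (extChartAt 𝓘(ℝ, E) x).source)
    (hξ : SmoothFormOn ξ (extChartAt 𝓘(ℝ, E) x).source) :
    ContinuousOn (fun p => coordForm x (lieDerForm X ξ p)) (extChartAt 𝓘(ℝ, E) x).source := by
  have : CompleteSpace E := FiniteDimensional.complete ℝ E
  refine continuousOn_pi.2 fun k => ?_
  have hs := isOpen_extChartAt_source (I := 𝓘(ℝ, E)) x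
  have hZ := smooth_coordFrame (E := E) x k
  have h1 := (hX.contMDiffOn_mvfderiv hs (hξ.apply hZ)).continuousOn
  have h2 := (hξ.apply (hX.mlieBracket hs hZ)).continuousOn
  exact (h1.sub h2).congr fun p hp => lieDerForm_apply hs hξ hX hZ hp

end Coordinates

namespace DiracStructure

variable {E : Type*} [NormedAddCommGroup E] [NormedSpace ℝ E] [FiniteDimensional ℝ E]
  {P : Type*} [TopologicalSpace P] [ChartedSpace E P] [IsManifold 𝓘(ℝ, E) ∞ P]
  {L : DiracStructure E P}

omit [FiniteDimensional ℝ E] in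
/-- Every element of `L_p` is a combination of the values of a frame. -/
lemma exists_coefficients {n : ℕ} {a : Fin n → L.Sections} {p : P}
    (h : Submodule.span ℝ (Set.range fun i => (a i).1 p) = L.fiber p) {b : Generalized E p}
    (hb : b ∈ L.fiber p) : ∃ s : Fin n → ℝ, b = ∑ i, s i • (a i).1 p := by
  rw [← h] at hb
  obtain ⟨s, hs⟩ := (Submodule.mem_span_range_iff_exists_fun ℝ).1 hb
  exact ⟨s, hs.symm⟩

/-- The brackets of `X ⊕ dg` with the members of a frame, in terms of that frame. -/
lemma IsHamiltonian.exists_bracket_coefficients {X : ∀ p : P, TangentSpace 𝓘(ℝ, E) p} {g : P → ℝ}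
    (hX : L.IsHamiltonian X g) (hg : ContMDiff 𝓘(ℝ, E) 𝓘(ℝ, ℝ) ∞ g) {n : ℕ}
    {a : Fin n → L.Sections} {p₀ : P} (ha : ∀ᶠ p in 𝓝 p₀, LinearIndependent ℝ (fun i => (a i).1 p) ∧
      Submodule.span ℝ (Set.range fun i => (a i).1 p) = L.fiber p) :
    ∃ c : Fin n → P → Fin n → ℝ, ∀ᶠ p in 𝓝 p₀, ∀ i, ContinuousAt (c i) p ∧
      courant (hX.section hg).1 (a i).1 p = ∑ j, c i p j • (a j).1 p := by
  have : CompleteSpace E := FiniteDimensional.complete ℝ E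
  have hs := isOpen_extChartAt_source (I := 𝓘(ℝ, E)) p₀
  have hmem := hs.mem_nhds (mem_extChartAt_source (I := 𝓘(ℝ, E)) p₀)
  have hsub := Set.subset_univ (extChartAt 𝓘(ℝ, E) p₀).source
  have hXs : SmoothFieldOn X (extChartAt 𝓘(ℝ, E) p₀).source := ContMDiffOn.mono hX.1 hsub
  have hY : ∀ i, SmoothFieldOn (fun p => ((a i).1 p).1) (extChartAt 𝓘(ℝ, E) p₀).source := fun i =>
    ContMDiffOn.mono (a i).2.1.1 hsub
  have hη : ∀ i, SmoothFormOn (fun p => ((a i).1 p).2) (extChartAt 𝓘(ℝ, E) p₀).source := fun i =>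
    ContMDiffOn.mono (a i).2.1.2 hsub
  have hcont : ∀ᶠ p in 𝓝 p₀, ContinuousAt (fun p i => coordGen p₀ ((a i).1 p)) p := by
    filter_upwards [hmem] with p hp
    refine continuousAt_pi.2 fun i => ?_
    exact ((continuousOn_coordVec (hY i)).continuousAt (hs.mem_nhds hp)).prodMk
      ((continuousOn_pi.2 fun k =>
        (contMDiffOn_coordForm (hη i) k).continuousOn).continuousAt (hs.mem_nhds hp))
  have hli : LinearIndependent ℝ (fun i => coordGen p₀ ((a i).1 p₀)) := by
    rw [Fintype.linearIndependent_iff]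
    intro s hs0 i
    rw [← coordGen_sum] at hs0
    refine (Fintype.linearIndependent_iff.1 ha.self_of_nhds.1) s
      (coordGen_injective (mem_extChartAt_source p₀) (hs0.trans ?_)) i
    have h0 := coordGen_sum (n := 0) p₀ (fun _ => (0 : Generalized E p₀)) (fun _ => 0)
    simpa using h0.symm
  have key : ∀ i, ∃ c : P → Fin n → ℝ, ∀ᶠ p in 𝓝 p₀, ContinuousAt c p ∧
      courant (hX.section hg).1 (a i).1 p = ∑ j, c p j • (a j).1 p := by
    intro i
    have hb : ∀ᶠ p in 𝓝 p₀, ContinuousAt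
        (fun p => coordGen p₀ (courant (hX.section hg).1 (a i).1 p)) p := by
      filter_upwards [hmem] with p hp
      simp_rw [hX.courant_eq hg (a i)]
      exact ((continuousOn_coordVec (hXs.mlieBracket hs (hY i))).continuousAt
        (hs.mem_nhds hp)).prodMk
        ((continuousOn_coordForm_lieDerForm hXs (hη i)).continuousAt (hs.mem_nhds hp))
    have hspan : ∀ᶠ p in 𝓝 p₀, ∃ x : Fin n → ℝ,
        coordGen p₀ (courant (hX.section hg).1 (a i).1 p) =
          ∑ j, x j • coordGen p₀ ((a j).1 p) := by
      filter_upwards [ha] with p hp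
      obtain ⟨x, hx⟩ := exists_coefficients hp.2 (Sections.bracket (hX.section hg) (a i) p).2
      exact ⟨x, (congrArg (coordGen p₀) hx).trans (coordGen_sum _ _ _)⟩
    obtain ⟨c, hc⟩ := exists_continuous_coefficients hcont hb hli hspan
    refine ⟨c, ?_⟩
    filter_upwards [hc, hmem] with p hp hps
    refine ⟨hp.1, coordGen_injective hps (hp.2.trans (coordGen_sum _ _ _).symm)⟩
  choose c hc using key
  exact ⟨c, Filter.eventually_all.2 hc⟩

end DiracStructure

/-! ### Hamiltonian lifts preserve basic functions -/

namespace Prequantization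

variable {E : Type*} [NormedAddCommGroup E] [NormedSpace ℝ E] [FiniteDimensional ℝ E]
  {P : Type*} [TopologicalSpace P] [T2Space P] [ChartedSpace E P] [IsManifold 𝓘(ℝ, E) ∞ P]
  {F : Type*} [NormedAddCommGroup F] [NormedSpace ℝ F] [FiniteDimensional ℝ F]
  {Q : Type*} [TopologicalSpace Q] [ChartedSpace F Q] [IsManifold 𝓘(ℝ, F) ∞ Q]
  [MulAction Circle Q] {L : DiracStructure E P} {𝒬 : Prequantization L F Q}
  {U V : TopologicalSpace.Opens P}
  {g : P → ℝ} {X : ∀ p : P, TangentSpace 𝓘(ℝ, E) p}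
  (hX : L.IsHamiltonian X g) (hg : ContMDiff 𝓘(ℝ, E) 𝓘(ℝ, ℝ) ∞ g)

variable (𝒬) in
/-- The lift `X^H + ⟨X ⊕ ξ, β⟩ E` of a section of `L`. -/
def secLift (a : L.Sections) (q : Q) : TangentSpace 𝓘(ℝ, F) q :=
  𝒬.lift (fun p => (a.1 p).1) (fun q => 𝒬.betaFun a (𝒬.proj q)) q

omit [FiniteDimensional ℝ E] [T2Space P] in
lemma isLift_secLift (a : L.Sections) : 𝒬.IsLift (𝒬.secLift a) (fun p => (a.1 p).1)
    (fun q => 𝒬.betaFun a (𝒬.proj q)) :=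
  𝒬.isLift_lift (fun p => (a.1 p).1) (fun q => 𝒬.betaFun a (𝒬.proj q))

omit [FiniteDimensional ℝ E] [T2Space P] in
lemma smooth_secLift (a : L.Sections) : SmoothFieldOn (𝒬.secLift a) Set.univ :=
  (isLift_secLift a).smooth a.2.1.1 ((contMDiff_betaFun a).comp 𝒬.contMDiff_proj)

omit [FiniteDimensional ℝ E] [T2Space P] in
/-- A vector over a combination of the values of sections of `L`, with the vertical part
given by `β`, is the combination of their lifts. -/
lemma eq_sum_secLift {n : ℕ} {a : Fin n → L.Sections} {q : Q} {b : L.fiber (𝒬.proj q)}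
    {s : Fin n → ℝ} (hb : b.1 = ∑ i, s i • (a i).1 (𝒬.proj q)) {v : TangentSpace 𝓘(ℝ, F) q}
    (h1 : 𝒬.dproj q v = b.1.1) (h2 : 𝒬.σ q v = 𝒬.β _ b) :
    v = ∑ i, s i • 𝒬.secLift (a i) q := by
  have hb' : b = ∑ i, s i • (a i).val (𝒬.proj q) := by
    apply Subtype.ext
    rw [hb, Submodule.coe_sum]
    rfl
  refine 𝒬.tangent_ext (q := q) ?_ ?_
  · rw [h1, hb, map_sum, Prod.fst_sum]
    refine Finset.sum_congr rfl fun i _ => ?_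
    rw [map_smul, (isLift_secLift (a i)).dproj]
    rfl
  · rw [h2, hb', map_sum, map_sum]
    refine Finset.sum_congr rfl fun i _ => ?_
    rw [map_smul, map_smul, (isLift_secLift (a i)).σ]
    rfl

omit [FiniteDimensional ℝ E] [T2Space P] in
/-- The bracket of a hamiltonian vector field with the lift of a section of `L`. -/
lemma isLift_mlieBracket_hamLift (a : L.Sections) :
    𝒬.IsLift (VectorField.mlieBracket 𝓘(ℝ, F) (𝒬.hamLift hX hg) (𝒬.secLift a))
      (fun p => (courant (hX.section hg).1 a.1 p).1)
      (fun q => 𝒬.β _ ((hX.section hg).bracket a (𝒬.proj q))) := by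
  have h := IsLift.mlieBracket_sections (f := fun p => -g p) (g := fun _ => 0) hg.neg
    contMDiff_const
    (a := hX.section hg) (V := 𝒬.hamLift hX hg) (isLift_hamLift hX hg) (b := a) (by simpa using isLift_secLift (𝒬 := 𝒬) a)
    (smooth_hamLift hX hg) (smooth_secLift a)
  refine ⟨h.dproj, fun q => (h.σ q).trans ?_⟩
  -- With `f = -g` and second function zero, the correction is `Y·g - Υ`, and isotropy gives `Υ =
  -- Y·g`. This is where the term `-g` of the hamiltonian lift is needed.
  have h1 := DiracStructure.pairing_eq_neg ((hX.section hg).2.2 (𝒬.proj q)) (a.2.2 (𝒬.proj q))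
  have h2 : mvfderiv 𝓘(ℝ, E) (fun p => -g p) (𝒬.proj q) (a.1 (𝒬.proj q)).1
      = - mvfderiv 𝓘(ℝ, E) g (𝒬.proj q) (a.1 (𝒬.proj q)).1 := by
    have := mvfderiv_neg (I := 𝓘(ℝ, E)) (g := g) (x := 𝒬.proj q)
    exact congrArg (fun T : E →L[ℝ] ℝ => T (a.1 (𝒬.proj q)).1) this
  have h3 : mvfderiv 𝓘(ℝ, E) (fun _ : P => (0 : ℝ)) (𝒬.proj q) = 0 := mvfderiv_const _
  rw [h2, h3, pairMinus]
  change _ + ((0 : ℝ) - _ - _) = _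
  change mvfderiv 𝓘(ℝ, E) g (𝒬.proj q) (a.1 (𝒬.proj q)).1 = _ at h1
  have h4 : (((hX.section hg).1 (𝒬.proj q)).2 (a.1 (𝒬.proj q)).1 : ℝ)
    = mvfderiv 𝓘(ℝ, E) g (𝒬.proj q) (a.1 (𝒬.proj q)).1 := rfl
  rw [h4]
  linarith

omit [FiniteDimensional ℝ E] [FiniteDimensional ℝ F] [T2Space P] in
lemma isSmooth_der {V : ∀ q : Q, TangentSpace 𝓘(ℝ, F) q} (hV : SmoothFieldOn V Set.univ)
    {φ : 𝒬.Over U → ℂ} (hφ : IsSmooth φ) : IsSmooth (fun q => der φ q (V q.1)) :=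
  (SmoothFieldOn.contMDiffOn_mvfderiv 𝒬.isOpen_over
    (ContMDiffOn.mono hV (Set.subset_univ _)) hφ).congr
    (ext_eqOn (g := fun q => mvfderiv 𝓘(ℝ, F) (ext φ) q (V q)) fun _ => rfl)

/-- Hamiltonian vector fields preserve basic functions. -/
lemma isBasic_der_hamLift {φ : 𝒬.Over U → ℂ} (hφ : IsBasic φ) :
    IsBasic (fun q => der φ q (𝒬.hamLift hX hg q.1)) := by
  have : CompleteSpace F := FiniteDimensional.complete ℝ F
  have : CompleteSpace E := FiniteDimensional.complete ℝ E
  have : IsManifold 𝓘(ℝ, F) 1 Q := .of_le (n := ∞) (by simp)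
  refine isBasic_iff.2 ⟨isSmooth_der (smooth_hamLift hX hg) hφ.1, fun q₀ b v hb hv1 hv2 => ?_⟩
  set V := 𝒬.hamLift hX hg with hVdef
  let p₀ : P := 𝒬.proj q₀.1
  have hVs : SmoothFieldOn V Set.univ := smooth_hamLift hX hg
  have hVl := isLift_hamLift (𝒬 := 𝒬) hX hg
  have hUo := 𝒬.isOpen_over (U := U)
  obtain ⟨a, ha⟩ := L.exists_sections_frame p₀
  obtain ⟨c, hc⟩ := hX.exists_bracket_coefficients hg ha
  -- The comparison of `L ∩ TP` at different points takes place along this integral curve, since its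
  -- rank need not be constant.
  obtain ⟨γ, hγ0, hγ⟩ := exists_isMIntegralCurveAt_of_contMDiffAt_boundaryless (I := 𝓘(ℝ, F))
    (v := V) (x₀ := q₀.1) 0 ((ContMDiffOn.contMDiffAt hVs Filter.univ_mem).of_le (by simp))
  have hγ' : ∀ᶠ t in 𝓝 0, HasMFDerivAt 𝓘(ℝ, ℝ) 𝓘(ℝ, F) γ t
    ((1 : ℝ →L[ℝ] ℝ).smulRight (V (γ t))) := hγ
  have hγc : ContinuousAt γ 0 := hγ'.self_of_nhds.continuousAt
  have hπγ : ContinuousAt (fun t => 𝒬.proj (γ t)) 0 :=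
    𝒬.contMDiff_proj.continuous.continuousAt.comp hγc
  have hπ0 : 𝒬.proj (γ 0) = p₀ := by rw [hγ0]
  have htends : Filter.Tendsto (fun t => 𝒬.proj (γ t)) (𝓝 0) (𝓝 p₀) := hπ0 ▸ hπγ
  have hs := isOpen_extChartAt_source (I := 𝓘(ℝ, E)) p₀
  have hsub := Set.subset_univ (extChartAt 𝓘(ℝ, E) p₀).source
  have hXs : SmoothFieldOn X (extChartAt 𝓘(ℝ, E) p₀).source := ContMDiffOn.mono hX.1 hsub
  have hη : ∀ i, SmoothFormOn (fun p => ((a i).1 p).2) (extChartAt 𝓘(ℝ, E) p₀).source := fun i =>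
    ContMDiffOn.mono (a i).2.1.2 hsub
  have hsrc : ∀ᶠ t in 𝓝 0, 𝒬.proj (γ t) ∈ (extChartAt 𝓘(ℝ, E) p₀).source :=
    htends.eventually (hs.mem_nhds (mem_extChartAt_source (I := 𝓘(ℝ, E)) p₀))
  have hov : ∀ᶠ t in 𝓝 0, 𝒬.proj (γ t) ∈ U := htends.eventually (U.isOpen.mem_nhds q₀.2)
  let Vφ : Q → ℂ := fun q => mvfderiv 𝓘(ℝ, F) (ext φ) q (V q)
  have hγcont : ∀ᶠ t in 𝓝 0, ContinuousAt (fun t => 𝒬.proj (γ t)) t := by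
    filter_upwards [hγ'] with t ht
    exact 𝒬.contMDiff_proj.continuous.continuousAt.comp ht.continuousAt
  have key : ∀ s : Fin (Module.finrank ℝ E) → ℝ,
      (∀ k, ∑ i, s i * coordForm p₀ ((a i).1 (𝒬.proj (γ 0))).2 k = 0) →
      ∑ i, s i • mvfderiv 𝓘(ℝ, F) Vφ (γ 0) (𝒬.secLift (a i) (γ 0)) = 0 := by
    intro s hs0
    -- The rows `h` hold the coordinates of the covectors of the frame, whose relations are the
    -- elements of `L ∩ TP`; the entries `y` are the derivatives of `φ` along the lifts of the
    -- frame.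
    refine transport_frame (c := fun t i => c i (𝒬.proj (γ t)))
      (d := fun t k => coordVec p₀
        (VectorField.mlieBracket 𝓘(ℝ, E) X (coordFrame E p₀ k) (𝒬.proj (γ t))))
      (h := fun t i => coordForm p₀ ((a i).1 (𝒬.proj (γ t))).2)
      (y := fun t i => mvfderiv 𝓘(ℝ, F) (ext φ) (γ t) (𝒬.secLift (a i) (γ t)))
      ?_ ?_ ?_ ?_ ?_ hs0
    · filter_upwards [htends.eventually hc, hγcont] with t ht htc
      refine continuousAt_pi.2 fun i => ?_
      exact ContinuousAt.comp (f := fun t => 𝒬.proj (γ t)) (ht i).1 htc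
    · filter_upwards [hsrc, hγcont] with t ht htc
      refine continuousAt_pi.2 fun k => ?_
      have h1 := (continuousOn_coordVec
        (hXs.mlieBracket hs (smooth_coordFrame p₀ k))).continuousAt (hs.mem_nhds ht)
      exact ContinuousAt.comp (f := fun t => 𝒬.proj (γ t)) h1 htc
    · filter_upwards [hγ', hsrc, htends.eventually hc] with t hγt ht hct i k
      have hd := contMDiffOn_mdifferentiableAt hs (contMDiffOn_coordForm (hη i) k) ht
      have h2 := hasDerivAt_comp_curve hγt (f := fun q => coordForm p₀ ((a i).1 (𝒬.proj q)).2 k)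
        (MDifferentiableAt.comp (γ t) hd (𝒬.mdifferentiableAt_proj _))
      rw [𝒬.mvfderiv_comp_proj hd, hVl.dproj, mvfderiv_coordForm hXs (hη i) ht] at h2
      refine h2.congr_deriv (congrArg₂ _ ?_ rfl)
      -- `L_X η_i` is the cotangent component of the Courant bracket with `X ⊕ dg`, so it expands
      -- with the coefficients `c`.
      have h3 : lieDerForm X (fun p => ((a i).1 p).2) (𝒬.proj (γ t)) = _ :=
        (congrArg Prod.snd ((hX.courant_eq hg (a i) _).symm.trans (hct i).2)).trans
          (Prod.snd_sum ..)
      rw [h3]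
      simp only [coordForm]
      exact (sum_apply ..).trans rfl
    · intro i
      have hS : SmoothFieldOn (𝒬.secLift (a i)) (𝒬.proj ⁻¹' U) :=
        ContMDiffOn.mono (smooth_secLift (a i)) (Set.subset_univ _)
      have hVU : SmoothFieldOn V (𝒬.proj ⁻¹' U) := ContMDiffOn.mono hVs (Set.subset_univ _)
      have h1 := hasDerivAt_comp_curve hγ'.self_of_nhds (contMDiffOn_mdifferentiableAt hUo
        (hS.contMDiffOn_mvfderiv hUo hφ.1) hov.self_of_nhds)
      refine h1.congr_deriv ?_
      have h2 := mvfderiv_mlieBracket hUo hVU hS hφ.1 hov.self_of_nhds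
      have h3 := isLift_mlieBracket_hamLift (𝒬 := 𝒬) hX hg (a i)
      -- The bracket of `V` with the lift of `a_i` is the lift of a bracket in `L`, so it has the
      -- same coefficients `c`; the remaining commutator term, the derivative of `V·φ`, is the
      -- source `w`.
      have h4 := eq_sum_secLift (𝒬 := 𝒬) (q := γ 0)
        (b := (hX.section hg).bracket (a i) (𝒬.proj (γ 0)))
        ((htends.eventually hc).self_of_nhds i).2 (h3.dproj (γ 0)) (h3.σ (γ 0))
      rw [h4, map_sum] at h2
      simp only [map_smul] at h2
      exact (sub_eq_iff_eq_add'.1 h2.symm)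
    · filter_upwards [hsrc, hov] with t ht hUt s hst
      let b : L.fiber (𝒬.proj (γ t)) := ∑ i, s i • (a i).val (𝒬.proj (γ t))
      have hb1 : b.1 = ∑ i, s i • (a i).1 (𝒬.proj (γ t)) := by
        simp only [b, Submodule.coe_sum]
        rfl
      have hb0 : b.1.2 = 0 := by
        refine eq_zero_of_coordForm ht fun k => ?_
        rw [hb1, Prod.snd_sum]
        exact (sum_apply ..).trans (hst k)
      have h1 := (isBasic_iff.1 hφ).2 ⟨γ t, hUt⟩ b (∑ i, s i • 𝒬.secLift (a i) (γ t)) hb0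
        (by
          rw [map_sum, hb1, Prod.fst_sum]
          refine Finset.sum_congr rfl fun i _ => ?_
          rw [map_smul, (isLift_secLift (a i)).dproj]
          rfl)
        (by
          rw [map_sum, map_sum]
          refine Finset.sum_congr rfl fun i _ => ?_
          rw [map_smul, map_smul, (isLift_secLift (a i)).σ]
          rfl)
      rw [map_sum] at h1
      simp only [map_smul] at h1
      exact h1
  -- Generalizing the point avoids rewriting `γ 0 = q₀` inside types that depend on it.
  have key' : ∀ q, γ 0 = q → ∀ s : Fin (Module.finrank ℝ E) → ℝ,
      (∀ k, ∑ i, s i * coordForm p₀ ((a i).1 (𝒬.proj q)).2 k = 0) →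
      ∑ i, s i • mvfderiv 𝓘(ℝ, F) Vφ q (𝒬.secLift (a i) q) = 0 := by
    rintro _ rfl
    exact key
  obtain ⟨s, hsb⟩ := DiracStructure.exists_coefficients ha.self_of_nhds.2 b.2
  have hv := eq_sum_secLift hsb hv1 hv2
  have hd : der (fun q : 𝒬.Over U => der φ q (V q.1)) q₀ = mvfderiv 𝓘(ℝ, F) Vφ q₀.1 :=
    der_eq_of_forall (g := Vφ) (fun _ => rfl) q₀
  rw [hd, hv, map_sum]
  simp only [map_smul]
  refine key' _ hγ0 s fun k => ?_
  have h1 := congrArg (fun x : Generalized E p₀ => coordForm p₀ x.2 k) hsb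
  simp only [hb, Prod.snd_sum] at h1
  exact ((sum_apply ..).symm.trans h1.symm).trans rfl

end Prequantization

/-! ### The representation of admissible functions -/

namespace Prequantization

open DiracStructure

variable {E : Type*} [NormedAddCommGroup E] [NormedSpace ℝ E] [FiniteDimensional ℝ E]
  {P : Type*} [TopologicalSpace P] [T2Space P] [ChartedSpace E P] [IsManifold 𝓘(ℝ, E) ∞ P]
  {F : Type*} [NormedAddCommGroup F] [NormedSpace ℝ F] [FiniteDimensional ℝ F]
  {Q : Type*} [TopologicalSpace Q] [ChartedSpace F Q] [IsManifold 𝓘(ℝ, F) ∞ Q]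
  [MulAction Circle Q] {L : DiracStructure E P} (𝒬 : Prequantization L F Q)
  {U V : TopologicalSpace.Opens P}

/-- The hamiltonian vector field of `π^*g`, for an admissible function `g`. -/
def admLift (g : L.Adm) (q : Q) : TangentSpace 𝓘(ℝ, F) q :=
  𝒬.hamLift (Adm.isHamiltonian_ham g) g.1.contMDiff q

omit [FiniteDimensional ℝ E] [T2Space P] in
lemma smooth_admLift (g : L.Adm) : SmoothFieldOn (𝒬.admLift g) Set.univ :=
  smooth_hamLift _ _

omit [FiniteDimensional ℝ E] [T2Space P] in
lemma isHamiltonianPair_admLift (g : L.Adm) :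
    𝒬.IsHamiltonianPair (𝒬.admLift g) (fun _ => 0) (fun q => g.1 (𝒬.proj q)) :=
  isHamiltonianPair_hamLift _ _

lemma isBasic_der_admLift (g : L.Adm) {φ : 𝒬.Over U → ℂ} (hφ : IsBasic φ) :
    IsBasic (fun q => der φ q (𝒬.admLift g q.1)) :=
  isBasic_der_hamLift _ _ hφ

omit [FiniteDimensional ℝ E] [T2Space P] [FiniteDimensional ℝ F] in
lemma der_const_mul {φ : 𝒬.Over U → ℂ} (hφ : IsSmooth φ) (c : ℂ) (q : 𝒬.Over U)
    (v : TangentSpace 𝓘(ℝ, F) q.1) : der (fun q => c * φ q) q v = c * der φ q v := by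
  refine (der_mul (isSmooth_const c) hφ q v).trans ?_
  rw [der_const]
  simp

/-- The derivation `{π^*g, ·}` of the algebra of basic functions on `π⁻¹(U)`. -/
def repDer (g : L.Adm) (U : TopologicalSpace.Opens P) : Derivation ℂ (𝒬.Bas U) (𝒬.Bas U) :=
  Derivation.mk'
    { toFun := fun φ => -⟨fun q => der φ.1 q (𝒬.admLift g q.1), 𝒬.isBasic_der_admLift g φ.2⟩
      map_add' := fun φ ψ => by
        apply Subtype.ext
        funext q
        have h := congrArg (fun T : F →L[ℝ] ℂ => T (𝒬.admLift g q.1)) (der_add φ.2.1 ψ.2.1 q)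
        change -(der (φ.1 + ψ.1) q _) = -(der φ.1 q _) + -(der ψ.1 q _)
        rw [← neg_add]
        exact congrArg Neg.neg h
      map_smul' := fun c φ => by
        apply Subtype.ext
        funext q
        have h := 𝒬.der_const_mul φ.2.1 c q (𝒬.admLift g q.1)
        change -(der (fun q => c * φ.1 q) q _) = c * -(der φ.1 q _)
        rw [h, mul_neg] }
    (fun φ ψ => by
      apply Subtype.ext
      funext q
      change -(der (φ.1 * ψ.1) q _) = φ.1 q * -(der ψ.1 q _) + ψ.1 q * -(der φ.1 q _)
      rw [der_mul φ.2.1 ψ.2.1]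
      ring)

lemma repDer_apply (g : L.Adm) (φ : 𝒬.Bas U) (q : 𝒬.Over U) :
    (𝒬.repDer g U φ).1 q = -der φ.1 q (𝒬.admLift g q.1) := rfl

/-- The representation `g ↦ {π^*g, ·}`. -/
def rep (g : L.Adm) : 𝒬.SheafDer where
  app U := 𝒬.repDer g U
  res_app U V h φ := by
    apply Subtype.ext
    funext q
    exact congrArg (fun T : F →L[ℝ] ℂ => -T (𝒬.admLift g q.1)) (der_resFun h φ.1 q)

lemma repDer_apply_of_pair {g : L.Adm} {X : ∀ q : Q, TangentSpace 𝓘(ℝ, F) q} {u : Q → ℝ}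
    (h : 𝒬.IsHamiltonianPair X u (fun q => g.1 (𝒬.proj q))) (φ : 𝒬.Bas U) (q : 𝒬.Over U) :
    (𝒬.repDer g U φ).1 q = -(der φ.1 q (X q.1) + φ.1 q * u q.1) := by
  rw [repDer_apply]
  exact congrArg Neg.neg (der_hamLift _ _ h φ.2 q)

omit [FiniteDimensional ℝ E] [T2Space P] [FiniteDimensional ℝ F] in
variable {𝒬} in
lemma IsHamiltonianPair.add {X Y : ∀ q : Q, TangentSpace 𝓘(ℝ, F) q} {u v h k : Q → ℝ}
    (hX : 𝒬.IsHamiltonianPair X u h) (hY : 𝒬.IsHamiltonianPair Y v k)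
    (hh : MDifferentiable 𝓘(ℝ, F) 𝓘(ℝ, ℝ) h) (hk : MDifferentiable 𝓘(ℝ, F) 𝓘(ℝ, ℝ) k) :
    𝒬.IsHamiltonianPair (fun q => X q + Y q) (fun q => u q + v q) (h + k) := by
  refine ⟨hX.1.add hY.1, hX.2.1.add hY.2.1, fun q => ?_⟩
  rw [mvfderiv_add (hh q) (hk q)]
  exact Submodule.add_mem _ (hX.2.2 q) (hY.2.2 q)

omit [FiniteDimensional ℝ E] [T2Space P] [FiniteDimensional ℝ F] in
variable {𝒬} in
lemma IsHamiltonianPair.const_smul {X : ∀ q : Q, TangentSpace 𝓘(ℝ, F) q} {u h : Q → ℝ}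
    (hX : 𝒬.IsHamiltonianPair X u h) (hh : MDifferentiable 𝓘(ℝ, F) 𝓘(ℝ, ℝ) h) (r : ℝ) :
    𝒬.IsHamiltonianPair (fun q => r • X q) (fun q => r * u q) (fun q => r * h q) := by
  refine ⟨hX.1.const_smul r, contMDiff_const.mul hX.2.1, fun q => ?_⟩
  have h1 : mvfderiv 𝓘(ℝ, F) (fun q => r * h q) q = r • mvfderiv 𝓘(ℝ, F) h q := by
    have h := mvfderiv_smul (I := 𝓘(ℝ, F)) (a := fun _ : Q => r) (x := q) (g := h)
      mdifferentiableAt_const (hh q)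
    rw [mvfderiv_const] at h
    refine Eq.trans h ?_
    ext
    simp
  rw [h1]
  exact Submodule.smul_mem _ r (hX.2.2 q)

omit [FiniteDimensional ℝ E] [T2Space P] [FiniteDimensional ℝ F] in
lemma mdifferentiable_adm_proj (g : L.Adm) :
    MDifferentiable 𝓘(ℝ, F) 𝓘(ℝ, ℝ) (fun q => g.1 (𝒬.proj q)) :=
  (g.1.contMDiff.comp 𝒬.contMDiff_proj).mdifferentiable (by simp)

/-- The chosen hamiltonian field of `f + g` need not be the sum of the chosen ones, but sums of
pairs are pairs and every pair computes the same operator. The same argument serves `repDer_smul`.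
-/
lemma repDer_add (f g : L.Adm) : 𝒬.repDer (f + g) U = 𝒬.repDer f U + 𝒬.repDer g U := by
  ext1 φ
  apply Subtype.ext
  funext q
  have h := (𝒬.isHamiltonianPair_admLift f).add (𝒬.isHamiltonianPair_admLift g)
    (𝒬.mdifferentiable_adm_proj f) (𝒬.mdifferentiable_adm_proj g)
  rw [𝒬.repDer_apply_of_pair (g := f + g) h, map_add]
  change _ = -der φ.1 q (𝒬.admLift f q.1) + -der φ.1 q (𝒬.admLift g q.1)
  push_cast
  ring

lemma repDer_smul (r : ℝ) (g : L.Adm) : 𝒬.repDer (r • g) U = (r : ℂ) • 𝒬.repDer g U := by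
  ext1 φ
  apply Subtype.ext
  funext q
  have h := (𝒬.isHamiltonianPair_admLift g).const_smul (𝒬.mdifferentiable_adm_proj g) r
  rw [𝒬.repDer_apply_of_pair (g := r • g) h, map_smul]
  change _ = (r : ℂ) * -der φ.1 q (𝒬.admLift g q.1)
  simp

omit [FiniteDimensional ℝ E] [T2Space P] in
/-- The Lie bracket of the lifts for `g` and `f` is the lift for `{f, g}`. -/
lemma mlieBracket_admLift [CompleteSpace E] (f g : L.Adm) (q : Q) :
    VectorField.mlieBracket 𝓘(ℝ, F) (𝒬.admLift g) (𝒬.admLift f) q =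
      𝒬.hamLift (Adm.isHamiltonian_bracket (Adm.isHamiltonian_ham g) (Adm.isHamiltonian_ham f))
        (Adm.bracket f g).1.contMDiff q := by
  have hg := Adm.isHamiltonian_ham g
  have hf := Adm.isHamiltonian_ham f
  have h := IsLift.mlieBracket_sections (a := hg.section g.1.contMDiff)
    (b := hf.section f.1.contMDiff) (f := fun p => -g.1 p)
    (g := fun p => -f.1 p) g.1.contMDiff.neg f.1.contMDiff.neg
    (isLift_hamLift (𝒬 := 𝒬) hg g.1.contMDiff) (isLift_hamLift hf f.1.contMDiff)
    (smooth_hamLift _ _) (smooth_hamLift _ _)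
  refine IsLift.unique ⟨h.dproj, fun q => (h.σ q).trans ?_⟩ (isLift_hamLift _ _) q
  set p := 𝒬.proj q
  have hneg : ∀ (k : L.Adm) (v : TangentSpace 𝓘(ℝ, E) p),
      mvfderiv 𝓘(ℝ, E) (fun p => -k.1 p) p v = -mvfderiv 𝓘(ℝ, E) k.1 p v := fun k v =>
    congrArg (fun T : E →L[ℝ] ℝ => T v) (mvfderiv_neg (I := 𝓘(ℝ, E)) (g := k.1) (x := p))
  have hβ : (hg.section g.1.contMDiff).bracket (hf.section f.1.contMDiff) p =
      ((Adm.isHamiltonian_bracket hg hf).section (Adm.bracket f g).1.contMDiff).val p := by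
    apply Subtype.ext
    refine (hg.courant_eq g.1.contMDiff (hf.section f.1.contMDiff) p).trans (Prod.ext rfl ?_)
    refine (lieDerForm_mvfderiv isOpen_univ f.1.contMDiff.contMDiffOn hg.1 (Set.mem_univ p)).trans ?_
    exact congrArg (fun k : P → ℝ => mvfderiv 𝓘(ℝ, E) k p)
      (funext fun p => (Adm.bracket_apply f g hg p).symm)
  rw [hβ]
  refine congrArg₂ _ rfl ?_
  -- With `b = {f, g} = X_g·f = -X_f·g`, the correction is `-b - b + b = -b`, the term required in
  -- the lift for `{f, g}`.
  rw [hneg, hneg, pairMinus]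
  have h1 : mvfderiv 𝓘(ℝ, E) f.1 p (Adm.ham g p) = (Adm.bracket f g).1 p :=
    (Adm.bracket_apply f g hg p).symm
  have h2 : mvfderiv 𝓘(ℝ, E) g.1 p (Adm.ham f p) = -(Adm.bracket f g).1 p :=
    (Adm.bracket_apply g f hf p).symm.trans (Adm.bracket_swap g f p)
  change -mvfderiv 𝓘(ℝ, E) f.1 p (Adm.ham g p) - -mvfderiv 𝓘(ℝ, E) g.1 p (Adm.ham f p)
    - 1 / 2 * (mvfderiv 𝓘(ℝ, E) g.1 p (Adm.ham f p) - mvfderiv 𝓘(ℝ, E) f.1 p (Adm.ham g p)) = _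
  rw [h1, h2]
  ring

/-- The field of `{f, g}` is `[X_g, X_f]`, in reversed order, and the minus sign in the action
compensates: `-[X_g, X_f] = [-X_f, -X_g]`. -/
lemma repDer_bracket [CompleteSpace E] (f g : L.Adm) :
    𝒬.repDer (Adm.bracket f g) U = ⁅𝒬.repDer f U, 𝒬.repDer g U⁆ := by
  ext1 φ
  apply Subtype.ext
  funext q
  rw [𝒬.repDer_apply_of_pair (isHamiltonianPair_hamLift (Adm.isHamiltonian_bracket
    (Adm.isHamiltonian_ham g) (Adm.isHamiltonian_ham f)) (Adm.bracket f g).1.contMDiff),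
    ← mlieBracket_admLift, Derivation.commutator_apply]
  have hUo := 𝒬.isOpen_over (U := U)
  have h1 := mvfderiv_mlieBracket hUo
    (ContMDiffOn.mono (𝒬.smooth_admLift g) (Set.subset_univ _))
    (ContMDiffOn.mono (𝒬.smooth_admLift f) (Set.subset_univ _)) φ.2.1 q.2
  have h2 : ∀ k l : L.Adm, (𝒬.repDer k U (𝒬.repDer l U φ)).1 q = mvfderiv 𝓘(ℝ, F)
      (fun q => mvfderiv 𝓘(ℝ, F) (ext φ.1) q (𝒬.admLift l q)) q.1 (𝒬.admLift k q.1) := by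
    intro k l
    have h3 : 𝒬.repDer k U (𝒬.repDer l U φ) =
      -𝒬.repDer k U ⟨fun q => der φ.1 q (𝒬.admLift l q.1), 𝒬.isBasic_der_admLift l φ.2⟩ :=
      map_neg (𝒬.repDer k U) _
    rw [h3]
    change - -der _ q _ = _
    rw [neg_neg]
    exact congrArg (fun T : F →L[ℝ] ℂ => T (𝒬.admLift k q.1)) (der_eq_of_forall
      (g := fun q => mvfderiv 𝓘(ℝ, F) (ext φ.1) q (𝒬.admLift l q)) (fun _ => rfl) q)
  change _ = (𝒬.repDer f U (𝒬.repDer g U φ)).1 q - (𝒬.repDer g U (𝒬.repDer f U φ)).1 q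
  rw [h2, h2]
  change -(mvfderiv 𝓘(ℝ, F) (ext φ.1) q.1 _ + _) = _
  rw [h1]
  simp

end Prequantization

/-! ### The circle action and the eigenfunctions of its generator -/

/-- The one-parameter group `t ↦ exp(2πit)` of `U(1)`. -/
def rot (t : ℝ) : Circle := Circle.exp (2 * Real.pi * t)

lemma rot_zero : rot 0 = 1 := by simp [rot]

lemma rot_one : rot 1 = 1 := by simp [rot]

lemma rot_add (s t : ℝ) : rot (s + t) = rot s * rot t := by
  rw [rot, mul_add, Circle.exp_add]
  rfl

lemma coe_rot (t : ℝ) : (rot t : ℂ) = Complex.exp (2 * Real.pi * Complex.I * t) := by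
  rw [rot, Circle.coe_exp]
  push_cast
  ring_nf

lemma exists_rot_eq (z : Circle) : ∃ t, rot t = z := by
  refine ⟨Complex.arg z / (2 * Real.pi), ?_⟩
  rw [rot, mul_div_cancel₀ _ Real.two_pi_pos.ne', Circle.exp_arg]

lemma contMDiff_rot : ContMDiff 𝓘(ℝ, ℝ) (𝓡 1) ∞ rot :=
  contMDiff_circleExp.comp (contDiff_const.mul contDiff_id).contMDiff

namespace Prequantization

open DiracStructure

variable {E : Type*} [NormedAddCommGroup E] [NormedSpace ℝ E]
  {P : Type*} [TopologicalSpace P] [ChartedSpace E P] [IsManifold 𝓘(ℝ, E) ∞ P]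
  {F : Type*} [NormedAddCommGroup F] [NormedSpace ℝ F]
  {Q : Type*} [TopologicalSpace Q] [ChartedSpace F Q] [IsManifold 𝓘(ℝ, F) ∞ Q]
  [MulAction Circle Q] {L : DiracStructure E P} (𝒬 : Prequantization L F Q)
  {U V : TopologicalSpace.Opens P}

include 𝒬 in
lemma contMDiff_orbit (q : Q) : ContMDiff 𝓘(ℝ, ℝ) 𝓘(ℝ, F) ∞ (fun t => rot t • q) :=
  𝒬.contMDiff_action.comp (contMDiff_rot.prodMk contMDiff_const)

include 𝒬 in
lemma contMDiff_smul (z : Circle) : ContMDiff 𝓘(ℝ, F) 𝓘(ℝ, F) ∞ (fun q : Q => z • q) :=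
  𝒬.contMDiff_action.comp (contMDiff_const.prodMk contMDiff_id)

include 𝒬 in
/-- The derivative of a function along an orbit. -/
lemma hasDerivAt_orbit {G : Type*} [NormedAddCommGroup G] [NormedSpace ℝ G] {f : Q → G} {q : Q}
    {t : ℝ} (hf : MDifferentiableAt 𝓘(ℝ, F) 𝓘(ℝ, G) f (rot t • q)) :
    HasDerivAt (fun s => f (rot s • q)) (mvfderiv 𝓘(ℝ, F) f (rot t • q)
      (generator F (rot t • q))) t := by
  -- The generator is defined by the derivative at time zero; the group law moves time `t` there.
  have key : ∀ r : Q, r = rot t • q → HasDerivAt (fun s => f (rot s • r))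
      (mvfderiv 𝓘(ℝ, F) f r (generator F r)) 0 := by
    rintro r rfl
    set r := rot t • q
    have h0 : rot 0 • r = r := by rw [rot_zero, one_smul]
    have hc : MDifferentiableAt 𝓘(ℝ, ℝ) 𝓘(ℝ, F) (fun s : ℝ => rot s • r) 0 :=
      (𝒬.contMDiff_orbit r 0).mdifferentiableAt (by simp)
    let A : F →L[ℝ] G := mfderiv 𝓘(ℝ, F) 𝓘(ℝ, G) f r
    let B : ℝ →L[ℝ] F := mfderiv 𝓘(ℝ, ℝ) 𝓘(ℝ, F) (fun s : ℝ => rot s • r) 0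
    have hA : HasMFDerivAt 𝓘(ℝ, F) 𝓘(ℝ, G) f (rot 0 • r) A := by
      rw [h0]
      exact hf.hasMFDerivAt
    have h : HasFDerivAt (fun s => f (rot s • r)) (A.comp B) 0 :=
      hasMFDerivAt_iff_hasFDerivAt.1 (hA.comp 0 hc.hasMFDerivAt)
    exact h.hasDerivAt
  have h1 := key _ rfl
  have h2 : HasDerivAt (fun s => f (rot (s - t) • rot t • q))
      (mvfderiv 𝓘(ℝ, F) f (rot t • q) (generator F (rot t • q))) t := by
    have h3 : t - t = 0 := sub_self t
    rw [← h3] at h1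
    exact h1.comp_sub_const t t
  refine h2.congr_of_eventuallyEq (Filter.Eventually.of_forall fun s => ?_)
  change f _ = f _
  rw [smul_smul, ← rot_add, sub_add_cancel]

variable {𝒬} in
/-- The action on `π⁻¹(U)`. -/
def act (z : Circle) (q : 𝒬.Over U) : 𝒬.Over U :=
  ⟨z • q.1, (𝒬.proj_smul z q.1).symm ▸ q.2⟩

variable {𝒬} in
lemma act_one (q : 𝒬.Over U) : act 1 q = q := Subtype.ext (one_smul Circle q.1)

variable {𝒬} in
lemma hasDerivAt_act {φ : 𝒬.Over U → ℂ} (hφ : IsSmooth φ) (q : 𝒬.Over U) (t : ℝ) :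
    HasDerivAt (fun s => φ (act (rot s) q))
      (der φ (act (rot t) q) (generator F (act (rot t) q).1)) t := by
  have h := 𝒬.hasDerivAt_orbit (hφ.mdifferentiableAt (act (rot t) q))
  exact h.congr_of_eventuallyEq (Filter.Eventually.of_forall fun s =>
    (ext_apply φ (act (rot s) q)).symm)

variable {𝒬} in
/-- Eigenfunctions of the generator are equivariant. -/
lemma apply_act_rot {φ : 𝒬.Over U → ℂ} (hφ : IsSmooth φ) {c : ℂ}
    (h : ∀ q : 𝒬.Over U, der φ q (generator F q.1) = c * φ q) (q : 𝒬.Over U) (t : ℝ) :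
    φ (act (rot t) q) = Complex.exp (c * t) * φ q := by
  -- An integrating factor: the eigenvalue equation makes this function constant.
  let f : ℝ → ℂ := fun s => Complex.exp (-(c * s)) * φ (act (rot s) q)
  have hf : ∀ s, HasDerivAt f 0 s := by
    intro s
    have h1 : HasDerivAt (fun s : ℝ => Complex.exp (-(c * s))) (Complex.exp (-(c * s)) * -c) s := by
      have h2 : HasDerivAt (fun s : ℝ => -(c * (s : ℂ))) (-c) s := by
        simpa [Pi.neg_def] using ((Complex.ofRealCLM.hasDerivAt (x := s)).const_mul c).neg
      exact h2.cexp
    have h3 := h1.mul (hasDerivAt_act hφ q s)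
    refine h3.congr_deriv ?_
    rw [h]
    ring
  have hconst := is_const_of_deriv_eq_zero (fun s => (hf s).differentiableAt)
    (fun s => (hf s).deriv) t 0
  simp only [f, rot_zero, act_one, Complex.ofReal_zero, mul_zero, neg_zero, Complex.exp_zero,
    one_mul] at hconst
  rw [← hconst, ← mul_assoc, ← Complex.exp_add, add_neg_cancel, Complex.exp_zero, one_mul]

variable {𝒬} in
/-- The eigenvalues of the generator are of the form `2πin`. -/
lemma exists_int_of_eigenvalue {φ : 𝒬.Over U → ℂ} (hφ : IsSmooth φ) (h0 : φ ≠ 0) {c : ℂ}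
    (h : ∀ q : 𝒬.Over U, der φ q (generator F q.1) = c * φ q) :
    ∃ n : ℤ, c = 2 * Real.pi * Complex.I * n := by
  obtain ⟨q, hq⟩ := Function.ne_iff.1 h0
  -- The orbits close up after time one, so `exp c = 1`.
  have h1 := apply_act_rot hφ h q 1
  rw [rot_one, act_one, Complex.ofReal_one, mul_one] at h1
  have h2 : Complex.exp c = 1 := mul_right_cancel₀ hq (by rw [← h1, one_mul])
  obtain ⟨n, hn⟩ := Complex.exp_eq_one_iff.1 h2
  exact ⟨n, by rw [hn]; ring⟩

variable {𝒬} in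
/-- Equivariant functions are eigenfunctions of the generator. -/
lemma der_generator_of_apply_act {φ : 𝒬.Over U → ℂ} (hφ : IsSmooth φ) {c : ℂ} {q : 𝒬.Over U}
    (h : ∀ t : ℝ, φ (act (rot t) q) = Complex.exp (c * t) * φ q) :
    der φ q (generator F q.1) = c * φ q := by
  have h1 := hasDerivAt_act hφ q 0
  have h2 : HasDerivAt (fun s : ℝ => Complex.exp (c * s) * φ q) (c * φ q) 0 := by
    have h3 : HasDerivAt (fun s : ℝ => c * (s : ℂ)) c 0 := by
      simpa using ((Complex.ofRealCLM.hasDerivAt (x := 0)).const_mul c)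
    have h4 := h3.cexp.mul_const (φ q)
    simpa using h4
  simp_rw [h] at h1
  have h5 := h1.unique h2
  have h6 : ∀ r : 𝒬.Over U, r = q → der φ r (generator F r.1) = c * φ q →
      der φ q (generator F q.1) = c * φ q := by
    rintro r rfl hr
    exact hr
  exact h6 _ (by rw [rot_zero, act_one]) h5

variable {𝒬} in
-- The eigenvalue equation is infinitesimal but determines the behaviour under all of `U(1)`, as
-- every element is some `rot t`.
lemma isAntiequivariant_iff {φ : 𝒬.Over U → ℂ} (hφ : IsSmooth φ) : IsAntiequivariant φ ↔
    ∀ q : 𝒬.Over U, der φ q (generator F q.1) = 2 * Real.pi * Complex.I * ((-1 : ℤ) : ℂ) * φ q := by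
  have hexp : ∀ t : ℝ, Complex.exp (2 * Real.pi * Complex.I * ((-1 : ℤ) : ℂ) * t)
      = (rot t : ℂ)⁻¹ := by
    intro t
    rw [coe_rot, ← Complex.exp_neg]
    congr 1
    push_cast
    ring
  constructor
  · intro h q
    refine der_generator_of_apply_act hφ fun t => ?_
    rw [hexp]
    exact h (rot t) q
  · intro h z q
    obtain ⟨t, rfl⟩ := exists_rot_eq z
    rw [← hexp]
    exact apply_act_rot hφ h q t

/-- The differential of the action of `z`. -/
def dact (F : Type*) [NormedAddCommGroup F] [NormedSpace ℝ F]
    {Q : Type*} [TopologicalSpace Q] [ChartedSpace F Q] [MulAction Circle Q] (z : Circle) (q : Q) :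
    F →L[ℝ] F :=
  let A : F →L[ℝ] F := mfderiv 𝓘(ℝ, F) 𝓘(ℝ, F) (fun r : Q => z • r) q
  A

include 𝒬 in
lemma mdifferentiableAt_smul (z : Circle) (q : Q) :
    MDifferentiableAt 𝓘(ℝ, F) 𝓘(ℝ, F) (fun r : Q => z • r) q :=
  (𝒬.contMDiff_smul z q).mdifferentiableAt (by simp)

lemma dproj_dact (z : Circle) (q : Q) (v : F) :
    (𝒬.dproj (z • q) (dact F z q v) : E) = 𝒬.dproj q v := by
  have h := mfderiv_comp q (𝒬.mdifferentiableAt_proj (z • q)) (𝒬.mdifferentiableAt_smul z q)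
  have he : (𝒬.proj ∘ fun r : Q => z • r) = 𝒬.proj := funext fun r => 𝒬.proj_smul z r
  rw [he] at h
  exact (congrArg (fun T : F →L[ℝ] E => T v) h).symm

lemma σ_dact (z : Circle) (q : Q) (v : F) : 𝒬.σ (z • q) (dact F z q v) = 𝒬.σ q v :=
  𝒬.isConnectionForm.invariant z q v

include 𝒬 in
lemma mvfderiv_comp_smul {G : Type*} [NormedAddCommGroup G] [NormedSpace ℝ G] {f : Q → G}
    {z : Circle} {q : Q} (hf : MDifferentiableAt 𝓘(ℝ, F) 𝓘(ℝ, G) f (z • q)) (v : F) :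
    mvfderiv 𝓘(ℝ, F) (fun r : Q => f (z • r)) q v
      = mvfderiv 𝓘(ℝ, F) f (z • q) (dact F z q v) := by
  have h := mfderiv_comp q hf (𝒬.mdifferentiableAt_smul z q)
  exact congrArg (fun T : F →L[ℝ] G => T v) h

variable {𝒬} in
/-- Lifts with an invariant vertical part are invariant. -/
lemma IsLift.dact {V : ∀ q : Q, TangentSpace 𝓘(ℝ, F) q}
    {X : ∀ p : P, TangentSpace 𝓘(ℝ, E) p} {u : Q → ℝ} (hV : 𝒬.IsLift V X u)
    (hu : ∀ (z : Circle) q, u (z • q) = u q) (z : Circle) (q : Q) :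
    dact F z q (V q) = V (z • q) := by
  refine 𝒬.tangent_ext (q := z • q) ?_ ?_
  · refine (𝒬.dproj_dact z q (V q)).trans ?_
    have h1 : (𝒬.dproj q (V q) : E) = X (𝒬.proj q) := hV.dproj q
    have h2 : (𝒬.dproj (z • q) (V (z • q)) : E) = X (𝒬.proj (z • q)) := hV.dproj _
    rw [h1, h2, 𝒬.proj_smul]
  · refine (𝒬.σ_dact z q (V q)).trans ?_
    rw [hV.σ, hV.σ, hu]

/-- `v` is a tangent vector that comes from `L ∩ TP`. -/
def IsPure (q : Q) (v : F) : Prop :=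
  ∃ a : L.fiber (𝒬.proj q), a.1.2 = 0 ∧ (𝒬.dproj q v : E) = a.1.1 ∧ 𝒬.σ q v = 𝒬.β _ a

variable {𝒬} in
-- The action covers the identity of `P` and preserves `σ`, and purity involves only the projection
-- and the value of `σ`.
lemma IsPure.dact {q : Q} {v : F} (h : 𝒬.IsPure q v) (z : Circle) :
    𝒬.IsPure (z • q) (dact F z q v) := by
  obtain ⟨a, h1, h2, h3⟩ := h
  have key : ∀ p : P, p = 𝒬.proj q → ∃ b : L.fiber p, b.1.2 = 0 ∧ (b.1.1 : E) = a.1.1 ∧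
      𝒬.β p b = 𝒬.β _ a := by
    rintro p rfl
    exact ⟨a, h1, rfl, rfl⟩
  obtain ⟨b, k1, k2, k3⟩ := key _ (𝒬.proj_smul z q)
  exact ⟨b, k1, (𝒬.dproj_dact z q v).trans (h2.trans k2.symm),
    (𝒬.σ_dact z q v).trans (h3.trans k3.symm)⟩

variable {𝒬} in
lemma isBasic_iff_isPure [FiniteDimensional ℝ E] [FiniteDimensional ℝ F] {φ : 𝒬.Over U → ℂ} :
    IsBasic φ ↔ IsSmooth φ ∧ ∀ (q : 𝒬.Over U) (v : F), 𝒬.IsPure q.1 v → der φ q v = 0 := by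
  rw [isBasic_iff]
  exact and_congr_right fun _ => ⟨fun h q v ⟨a, h1, h2, h3⟩ => h q a v h1 h2 h3,
    fun h q a v h1 h2 h3 => h q v ⟨a, h1, h2, h3⟩⟩

end Prequantization

/-! ### Integrals that depend smoothly on a parameter -/

section ParametricIntegral

variable {F : Type*} [NormedAddCommGroup F] [NormedSpace ℝ F] [FiniteDimensional ℝ F]
  {G : Type*} [NormedAddCommGroup G] [NormedSpace ℝ G] {Ω : Set F}

omit [NormedSpace ℝ F] [FiniteDimensional ℝ F] in
lemma continuous_of_prod {H : Type*} [TopologicalSpace H] {f : F × ℝ → H}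
    (hf : ContinuousOn f (Ω ×ˢ Set.univ)) {x : F} (hx : x ∈ Ω) : Continuous (fun t => f (x, t)) :=
  continuousOn_univ.1 (hf.comp (by fun_prop) fun t _ => ⟨hx, Set.mem_univ t⟩)

omit [FiniteDimensional ℝ F] in
lemma hasFDerivAt_partial (hΩ : IsOpen Ω) {f : F × ℝ → G}
    (hf : ContDiffOn ℝ ∞ f (Ω ×ˢ Set.univ)) {x : F} (hx : x ∈ Ω) (t : ℝ) :
    HasFDerivAt (fun y => f (y, t)) ((fderiv ℝ f (x, t)).comp (.inl ℝ F ℝ)) x := by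
  have h1 : HasFDerivAt f (fderiv ℝ f (x, t)) (x, t) :=
    ((hf.contDiffAt ((hΩ.prod isOpen_univ).mem_nhds ⟨hx, Set.mem_univ t⟩)).differentiableAt
      (by simp)).hasFDerivAt
  exact h1.comp x (hasFDerivAt_prodMk_left x t)

omit [FiniteDimensional ℝ F] in
lemma contDiffOn_partial (hΩ : IsOpen Ω) {f : F × ℝ → G}
    (hf : ContDiffOn ℝ ∞ f (Ω ×ˢ Set.univ)) :
    ContDiffOn ℝ ∞ (fun z => (fderiv ℝ f z).comp (.inl ℝ F ℝ)) (Ω ×ˢ Set.univ) :=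
  (hf.fderiv_of_isOpen (hΩ.prod isOpen_univ) (by simp)).clm_comp contDiffOn_const

/-- Differentiation under the integral sign. -/
lemma hasFDerivAt_integral_of_contDiffOn (hΩ : IsOpen Ω) {f : F × ℝ → G}
    (hf : ContDiffOn ℝ ∞ f (Ω ×ˢ Set.univ)) {x : F} (hx : x ∈ Ω) :
    HasFDerivAt (fun y => ∫ t in (0 : ℝ)..1, f (y, t))
      (∫ t in (0 : ℝ)..1, (fderiv ℝ f (x, t)).comp (.inl ℝ F ℝ)) x := by
  have hc := (contDiffOn_partial hΩ hf).continuousOn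
  -- Compactness of a closed ball times `[0, 1]` bounds the partial derivative by a constant, which
  -- is the dominating function.
  obtain ⟨ε, hε, hball⟩ := Metric.nhds_basis_closedBall.mem_iff.1 (hΩ.mem_nhds hx)
  have : ProperSpace F := FiniteDimensional.proper ℝ F
  obtain ⟨M, hM⟩ := ((isCompact_closedBall x ε).prod
    (isCompact_Icc (a := (0 : ℝ)) (b := 1))).exists_bound_of_continuousOn
    (hc.mono (Set.prod_mono hball (Set.subset_univ _)))
  refine intervalIntegral.hasFDerivAt_integral_of_dominated_of_fderiv_le (𝕜 := ℝ)
    (s := Metric.closedBall x ε) (bound := fun _ => M) (F := fun y t => f (y, t))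
    (F' := fun y t => (fderiv ℝ f (y, t)).comp (.inl ℝ F ℝ)) (Metric.closedBall_mem_nhds x hε)
    ?_ ?_ ?_ ?_ ?_ ?_
  · filter_upwards [hΩ.mem_nhds hx] with y hy
    exact (continuous_of_prod hf.continuousOn hy).aestronglyMeasurable
  · exact (continuous_of_prod hf.continuousOn hx).intervalIntegrable _ _
  · exact (continuous_of_prod hc hx).aestronglyMeasurable
  · refine Filter.Eventually.of_forall fun t ht y hy => hM (y, t) ⟨hy, ?_⟩
    rw [Set.uIoc_of_le zero_le_one] at ht
    exact ⟨ht.1.le, ht.2⟩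
  · exact intervalIntegrable_const
  · exact Filter.Eventually.of_forall fun t _ y hy => hasFDerivAt_partial hΩ hf (hball hy) t

/-- Induction on the order of differentiability: a directional derivative of the integral is the
integral of a directional derivative of `f`, again smooth, so the induction must run over all `f`.
-/
lemma contDiffOn_integral (hΩ : IsOpen Ω) {f : F × ℝ → G}
    (hf : ContDiffOn ℝ ∞ f (Ω ×ˢ Set.univ)) :
    ContDiffOn ℝ ∞ (fun y => ∫ t in (0 : ℝ)..1, f (y, t)) Ω := by
  refine contDiffOn_infty.2 fun n => ?_
  induction n generalizing f with
  | zero =>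
    exact contDiffOn_zero.2 fun x hx =>
      (hasFDerivAt_integral_of_contDiffOn hΩ hf hx).continuousAt.continuousWithinAt
  | succ n ih =>
    have hd := fun x (hx : x ∈ Ω) => hasFDerivAt_integral_of_contDiffOn hΩ hf hx
    push_cast
    refine (contDiffOn_succ_iff_fderiv_of_isOpen hΩ).2
      ⟨fun x hx => (hd x hx).differentiableAt.differentiableWithinAt, by simp, ?_⟩
    refine contDiffOn_clm_apply.2 fun v => ?_
    have hv : ContDiffOn ℝ ∞ (fun z => (fderiv ℝ f z).comp (.inl ℝ F ℝ) v) (Ω ×ˢ Set.univ) :=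
      (contDiffOn_partial hΩ hf).clm_apply contDiffOn_const
    refine (ih hv).congr fun x hx => ?_
    rw [(hd x hx).fderiv]
    exact ContinuousLinearMap.intervalIntegral_apply
      ((continuous_of_prod (contDiffOn_partial hΩ hf).continuousOn hx).intervalIntegrable _ _) v

end ParametricIntegral

section ManifoldParametricIntegral

variable {F : Type*} [NormedAddCommGroup F] [NormedSpace ℝ F] [FiniteDimensional ℝ F]
  {Q : Type*} [TopologicalSpace Q] [ChartedSpace F Q] [IsManifold 𝓘(ℝ, F) ∞ Q]
  {G : Type*} [NormedAddCommGroup G] [NormedSpace ℝ G] {S : Set Q} {f : Q × ℝ → G}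

omit [FiniteDimensional ℝ F] in
lemma contDiffOn_chart_prod (hf : ContMDiffOn (𝓘(ℝ, F).prod 𝓘(ℝ, ℝ)) 𝓘(ℝ, G) ∞ f (S ×ˢ Set.univ))
    (x : Q) : ContDiffOn ℝ ∞ (fun z : F × ℝ => f ((extChartAt 𝓘(ℝ, F) x).symm z.1, z.2))
      (chartDom x S ×ˢ Set.univ) := by
  have h1 : ContMDiffOn 𝓘(ℝ, F × ℝ) 𝓘(ℝ, F) ∞
      (fun z : F × ℝ => (extChartAt 𝓘(ℝ, F) x).symm z.1) (chartDom x S ×ˢ Set.univ) :=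
    (contMDiffOn_chart_symm x).comp (contMDiff_iff_contDiff.2 contDiff_fst).contMDiffOn
      fun z hz => hz.1.1
  have h2 : ContMDiffOn 𝓘(ℝ, F × ℝ) 𝓘(ℝ, ℝ) ∞ (fun z : F × ℝ => z.2)
      (chartDom x S ×ˢ Set.univ) := (contMDiff_iff_contDiff.2 contDiff_snd).contMDiffOn
  rw [← contMDiffOn_iff_contDiffOn]
  exact hf.comp (h1.prodMk h2) fun z hz => ⟨hz.1.2, Set.mem_univ _⟩

/-- Integrals of smooth functions that depend smoothly on a point of a manifold are smooth. -/
lemma contMDiffOn_integral (hS : IsOpen S)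
    (hf : ContMDiffOn (𝓘(ℝ, F).prod 𝓘(ℝ, ℝ)) 𝓘(ℝ, G) ∞ f (S ×ˢ Set.univ)) :
    ContMDiffOn 𝓘(ℝ, F) 𝓘(ℝ, G) ∞ (fun q => ∫ t in (0 : ℝ)..1, f (q, t)) S := by
  intro x hx
  have ho := hS.inter (isOpen_extChartAt_source (I := 𝓘(ℝ, F)) x)
  suffices H : ContMDiffOn 𝓘(ℝ, F) 𝓘(ℝ, G) ∞ (fun q => ∫ t in (0 : ℝ)..1, f (q, t))
      (S ∩ (extChartAt 𝓘(ℝ, F) x).source) from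
    (H.contMDiffAt (ho.mem_nhds ⟨hx, mem_extChartAt_source x⟩)).contMDiffWithinAt
  refine contMDiffOn_of_chart Set.inter_subset_right
    ((contDiffOn_integral (isOpen_chartDom x hS) (contDiffOn_chart_prod hf x)).mono
      (Set.inter_subset_inter_right _ (Set.preimage_mono Set.inter_subset_left))) fun q hq => ?_
  simp only
  rw [(extChartAt 𝓘(ℝ, F) x).left_inv hq.2]

omit [FiniteDimensional ℝ F] [IsManifold 𝓘(ℝ, F) ∞ Q] in
lemma contMDiffOn_slice (hf : ContMDiffOn (𝓘(ℝ, F).prod 𝓘(ℝ, ℝ)) 𝓘(ℝ, G) ∞ f (S ×ˢ Set.univ))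
    (t : ℝ) : ContMDiffOn 𝓘(ℝ, F) 𝓘(ℝ, G) ∞ (fun q => f (q, t)) S :=
  hf.comp (contMDiff_id.prodMk contMDiff_const).contMDiffOn fun _ hq => ⟨hq, Set.mem_univ t⟩

/-- Differentiation under the integral sign on a manifold. -/
lemma mvfderiv_integral (hS : IsOpen S)
    (hf : ContMDiffOn (𝓘(ℝ, F).prod 𝓘(ℝ, ℝ)) 𝓘(ℝ, G) ∞ f (S ×ˢ Set.univ)) {q : Q} (hq : q ∈ S)
    (v : TangentSpace 𝓘(ℝ, F) q) :
    mvfderiv 𝓘(ℝ, F) (fun q => ∫ t in (0 : ℝ)..1, f (q, t)) q v =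
      ∫ t in (0 : ℝ)..1, mvfderiv 𝓘(ℝ, F) (fun q => f (q, t)) q v := by
  have hqs := mem_extChartAt_source (I := 𝓘(ℝ, F)) q
  have hqd : extChartAt 𝓘(ℝ, F) q q ∈ chartDom q S := mem_chartDom hqs hq
  have hdom := isOpen_chartDom (E := F) q hS
  have hsm := contDiffOn_chart_prod hf q
  refine (pder_eq (contMDiffOn_mdifferentiableAt hS (contMDiffOn_integral hS hf) hq) hqs v).trans ?_
  have h1 : fderiv ℝ ((fun q => ∫ t in (0 : ℝ)..1, f (q, t)) ∘ (extChartAt 𝓘(ℝ, F) q).symm)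
      (extChartAt 𝓘(ℝ, F) q q) = _ := (hasFDerivAt_integral_of_contDiffOn hdom hsm hqd).fderiv
  rw [h1, ContinuousLinearMap.intervalIntegral_apply
    ((continuous_of_prod (contDiffOn_partial hdom hsm).continuousOn hqd).intervalIntegrable _ _)]
  refine intervalIntegral.integral_congr fun t _ => ?_
  refine Eq.symm ((pder_eq (contMDiffOn_mdifferentiableAt hS (contMDiffOn_slice hf t) hq)
    hqs v).trans ?_)
  exact congrArg (fun T : F →L[ℝ] G => T (chartDer F q q v))
    (hasFDerivAt_partial hdom hsm hqd t).fderiv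

end ManifoldParametricIntegral

/-! ### Fourier coefficients along the orbits -/

/-- The character `t ↦ exp(-2πint)`. -/
def character (n : ℤ) (t : ℝ) : ℂ := Complex.exp (-(2 * Real.pi * Complex.I * n * t))

lemma contDiff_character (n : ℤ) : ContDiff ℝ ∞ (character n) := by
  unfold character
  exact (contDiff_const.mul Complex.ofRealCLM.contDiff).neg.cexp

lemma hasDerivAt_character (n : ℤ) (t : ℝ) :
    HasDerivAt (character n) (-(2 * Real.pi * Complex.I * n) * character n t) t := by
  have h : HasDerivAt (fun t : ℝ => -(2 * Real.pi * Complex.I * n * (t : ℂ)))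
      (-(2 * Real.pi * Complex.I * n)) t := by
    simpa [Pi.neg_def] using
      ((Complex.ofRealCLM.hasDerivAt (x := t)).const_mul (2 * Real.pi * Complex.I * (n : ℂ))).neg
  exact h.cexp.congr_deriv (mul_comm _ _)

lemma norm_character (n : ℤ) (t : ℝ) : ‖character n t‖ = 1 := by
  rw [character, show -(2 * Real.pi * Complex.I * n * t) = ((-(2 * Real.pi * n * t) : ℝ) : ℂ) *
    Complex.I by push_cast; ring]
  exact Complex.norm_exp_ofReal_mul_I _

lemma character_zero (n : ℤ) : character n 0 = 1 := by simp [character]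

lemma character_one (n : ℤ) : character n 1 = 1 := by
  rw [character, Complex.exp_eq_one_iff]
  exact ⟨-n, by push_cast; ring⟩

lemma integral_character_mul (m n : ℤ) : ∫ t in (0 : ℝ)..1,
    character m t * Complex.exp (2 * Real.pi * Complex.I * n * t) = if n = m then 1 else 0 := by
  have h0 : ∀ t : ℝ, character m t * Complex.exp (2 * Real.pi * Complex.I * n * t) =
      character (m - n) t := by
    intro t
    rw [character, character, ← Complex.exp_add]
    congr 1
    push_cast
    ring
  simp_rw [h0]
  split_ifs with h
  · simp [h, character]
  · have hc : -(2 * Real.pi * Complex.I * ((m - n : ℤ) : ℂ)) ≠ 0 := by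
      refine neg_ne_zero.2 (mul_ne_zero Complex.two_pi_I_ne_zero ?_)
      exact_mod_cast sub_ne_zero.2 (Ne.symm h)
    have h1 := intervalIntegral.integral_eq_sub_of_hasDerivAt (a := 0) (b := 1)
      (fun t _ => hasDerivAt_character (m - n) t)
      ((continuous_const.mul (contDiff_character _).continuous).intervalIntegrable _ _)
    rw [character_one, character_zero, sub_self, intervalIntegral.integral_const_mul] at h1
    exact (mul_eq_zero.1 h1).resolve_left hc

namespace Prequantization

open DiracStructure

variable {E : Type*} [NormedAddCommGroup E] [NormedSpace ℝ E]
  {P : Type*} [TopologicalSpace P] [ChartedSpace E P] [IsManifold 𝓘(ℝ, E) ∞ P]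
  {F : Type*} [NormedAddCommGroup F] [NormedSpace ℝ F]
  {Q : Type*} [TopologicalSpace Q] [ChartedSpace F Q] [IsManifold 𝓘(ℝ, F) ∞ Q]
  [MulAction Circle Q] {L : DiracStructure E P} {𝒬 : Prequantization L F Q}
  {U V : TopologicalSpace.Opens P}

/-- The `n`-th Fourier coefficient of a function on `π⁻¹(U)` with respect to the circle action. -/
def coef (n : ℤ) (φ : 𝒬.Over U → ℂ) (q : 𝒬.Over U) : ℂ :=
  ∫ t in (0 : ℝ)..1, character n t * φ (act (rot t) q)

lemma continuous_act {φ : 𝒬.Over U → ℂ} (hφ : IsSmooth φ) (q : 𝒬.Over U) :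
    Continuous (fun t => φ (act (rot t) q)) :=
  continuous_iff_continuousAt.2 fun t => (hasDerivAt_act hφ q t).continuousAt

lemma contMDiffOn_coef_integrand (n : ℤ) {φ : 𝒬.Over U → ℂ} (hφ : IsSmooth φ) :
    ContMDiffOn (𝓘(ℝ, F).prod 𝓘(ℝ, ℝ)) 𝓘(ℝ, ℂ) ∞
      (fun z : Q × ℝ => character n z.2 * ext φ (rot z.2 • z.1))
      ((𝒬.proj ⁻¹' U) ×ˢ Set.univ) := by
  have h1 : ContMDiff (𝓘(ℝ, F).prod 𝓘(ℝ, ℝ)) 𝓘(ℝ, ℂ) ∞ (fun z : Q × ℝ => character n z.2) :=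
    (contMDiff_iff_contDiff.2 (contDiff_character n)).comp contMDiff_snd
  have h2 : ContMDiff (𝓘(ℝ, F).prod 𝓘(ℝ, ℝ)) 𝓘(ℝ, F) ∞ (fun z : Q × ℝ => rot z.2 • z.1) :=
    𝒬.contMDiff_action.comp ((contMDiff_rot.comp contMDiff_snd).prodMk contMDiff_fst)
  have h3 : ContMDiffOn (𝓘(ℝ, F).prod 𝓘(ℝ, ℝ)) 𝓘(ℝ, ℂ) ∞
      (fun z : Q × ℝ => ext φ (rot z.2 • z.1)) ((𝒬.proj ⁻¹' U) ×ˢ Set.univ) :=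
    ContMDiffOn.comp hφ h2.contMDiffOn fun z hz => (act (rot z.2) (⟨z.1, hz.1⟩ : 𝒬.Over U)).2
  exact (contDiff_mul (𝕜 := ℝ) (𝔸 := ℂ) (n := ∞)).contMDiff.comp_contMDiffOn
    (h1.contMDiffOn.prodMk_space h3)

lemma coef_eq_ext (n : ℤ) (φ : 𝒬.Over U → ℂ) (q : 𝒬.Over U) :
    coef n φ q = ∫ t in (0 : ℝ)..1, character n t * ext φ (rot t • q.1) :=
  intervalIntegral.integral_congr fun t _ =>
    congrArg (character n t * ·) (ext_apply φ (act (rot t) q)).symm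

section Smooth

variable [FiniteDimensional ℝ F]

lemma isSmooth_coef (n : ℤ) {φ : 𝒬.Over U → ℂ} (hφ : IsSmooth φ) : IsSmooth (coef n φ) :=
  (contMDiffOn_integral 𝒬.isOpen_over (contMDiffOn_coef_integrand n hφ)).congr
    (ext_eqOn (coef_eq_ext n φ))

lemma der_coef (n : ℤ) {φ : 𝒬.Over U → ℂ} (hφ : IsSmooth φ) (q : 𝒬.Over U)
    (v : TangentSpace 𝓘(ℝ, F) q.1) : der (coef n φ) q v =
      ∫ t in (0 : ℝ)..1, character n t * der φ (act (rot t) q) (dact F (rot t) q.1 v) := by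
  have h1 := congrArg (fun T : F →L[ℝ] ℂ => T v) (der_eq_of_forall
    (g := fun q => ∫ t in (0 : ℝ)..1, character n t * ext φ (rot t • q)) (coef_eq_ext n φ) q)
  refine h1.trans ((mvfderiv_integral 𝒬.isOpen_over (contMDiffOn_coef_integrand n hφ) q.2 v).trans
    (intervalIntegral.integral_congr fun t _ => ?_))
  have hd := hφ.mdifferentiableAt (act (rot t) q)
  have hd' : MDifferentiableAt 𝓘(ℝ, F) 𝓘(ℝ, ℂ) (fun r : Q => ext φ (rot t • r)) q.1 :=
    MDifferentiableAt.comp q.1 hd (𝒬.mdifferentiableAt_smul (rot t) q.1)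
  have h2 := ((mdifferentiableAt_const (c := character n t)).hasMFDerivAt.mul
    hd'.hasMFDerivAt).mfderiv
  have h3 := congrArg (fun T : F →L[ℝ] ℂ => T v) h2
  refine h3.trans ?_
  rw [mfderiv_const]
  have h4 := 𝒬.mvfderiv_comp_smul hd v
  change character n t * mvfderiv 𝓘(ℝ, F) (fun r : Q => ext φ (rot t • r)) q.1 v + _ * (0 : ℂ) = _
  rw [mul_zero, add_zero]
  exact congrArg _ h4

/-- Under the integral sign, a pure vector is moved by the action to pure vectors, and these
annihilate `φ`. -/
lemma isBasic_coef [FiniteDimensional ℝ E] (n : ℤ) {φ : 𝒬.Over U → ℂ} (hφ : IsBasic φ) :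
    IsBasic (coef n φ) := by
  refine isBasic_iff_isPure.2 ⟨isSmooth_coef n hφ.1, fun q v hv => ?_⟩
  refine (der_coef n hφ.1 q v).trans
    ((intervalIntegral.integral_congr (g := fun _ => 0) fun t _ => ?_).trans (by simp))
  exact (congrArg (character n t * ·) ((isBasic_iff_isPure.1 hφ).2 (act (rot t) q) _
    (hv.dact (rot t)))).trans (mul_zero _)

/-- Invariant vector fields commute with taking Fourier coefficients. -/
lemma der_coef_of_invariant (n : ℤ) {φ : 𝒬.Over U → ℂ} (hφ : IsSmooth φ)
    {V : ∀ q : Q, TangentSpace 𝓘(ℝ, F) q}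
    (hV : ∀ (z : Circle) q, dact F z q (V q) = V (z • q)) (q : 𝒬.Over U) :
    der (coef n φ) q (V q.1) = coef n (fun q => der φ q (V q.1)) q := by
  rw [der_coef n hφ]
  refine intervalIntegral.integral_congr fun t _ => ?_
  simp only
  rw [hV]
  rfl

omit [FiniteDimensional ℝ F] in
lemma isLift_generator (𝒬 : Prequantization L F Q) : 𝒬.IsLift (generator F) (fun _ => 0) (fun _ => 1) :=
  ⟨𝒬.dproj_generator, 𝒬.σ_generator⟩

lemma smooth_generator (𝒬 : Prequantization L F Q) : 
    SmoothFieldOn (generator F : ∀ q : Q, TangentSpace 𝓘(ℝ, F) q) Set.univ :=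
  (isLift_generator 𝒬).smooth smoothFieldOn_zero contMDiff_const

omit [FiniteDimensional ℝ F] in
lemma dact_generator (𝒬 : Prequantization L F Q) (z : Circle) (q : Q) :
    dact F z q (generator F q) = generator F (z • q) :=
  (isLift_generator 𝒬).dact (fun _ _ => rfl) z q

lemma isSmooth_der_generator {φ : 𝒬.Over U → ℂ} (hφ : IsSmooth φ) :
    IsSmooth (fun q => der φ q (generator F q.1)) :=
  isSmooth_der (smooth_generator 𝒬) hφ

/-- Integration by parts over one period; the boundary terms cancel because the character and the
orbit have period one. -/
lemma coef_der_generator (n : ℤ) {φ : 𝒬.Over U → ℂ} (hφ : IsSmooth φ) (q : 𝒬.Over U) :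
    coef n (fun q => der φ q (generator F q.1)) q = 2 * Real.pi * Complex.I * n * coef n φ q := by
  have hc := (contDiff_character n).continuous
  have h1 : IntervalIntegrable (fun t => character n t * φ (act (rot t) q))
      MeasureTheory.volume 0 1 := (hc.mul (continuous_act hφ q)).intervalIntegrable _ _
  have h2 : IntervalIntegrable (fun t => character n t * der φ (act (rot t) q)
      (generator F (act (rot t) q).1)) MeasureTheory.volume 0 1 :=
    (hc.mul (continuous_act (isSmooth_der_generator hφ) q)).intervalIntegrable _ _
  have h := intervalIntegral.integral_eq_sub_of_hasDerivAt (a := 0) (b := 1)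
    (fun t _ => ((hasDerivAt_character n t).mul (hasDerivAt_act hφ q t)).congr_deriv
      (by rw [mul_assoc])) ((h1.const_mul _).add h2)
  rw [intervalIntegral.integral_add (h1.const_mul _) h2, intervalIntegral.integral_const_mul] at h
  simp only [Pi.mul_apply, character_one, character_zero, rot_one, rot_zero, sub_self] at h
  change -(2 * Real.pi * Complex.I * n) * coef n φ q +
    coef n (fun q => der φ q (generator F q.1)) q = 0 at h
  linear_combination h

/-- The Fourier coefficients are eigenfunctions of the generator. -/
lemma der_coef_generator (n : ℤ) {φ : 𝒬.Over U → ℂ} (hφ : IsSmooth φ) (q : 𝒬.Over U) :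
    der (coef n φ) q (generator F q.1) = 2 * Real.pi * Complex.I * n * coef n φ q :=
  (der_coef_of_invariant n hφ (dact_generator 𝒬) q).trans (coef_der_generator n hφ q)

omit [FiniteDimensional ℝ F] in
lemma exists_norm_coef_le {φ : 𝒬.Over U → ℂ} (hφ : IsSmooth φ) (q : 𝒬.Over U) :
    ∃ M, ∀ n, ‖coef n φ q‖ ≤ M := by
  obtain ⟨M, hM⟩ := (isCompact_Icc (a := (0 : ℝ)) (b := 1)).exists_bound_of_continuousOn
    (continuous_act hφ q).continuousOn
  refine ⟨M, fun n => ?_⟩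
  have h := intervalIntegral.norm_integral_le_of_norm_le_const (a := 0) (b := 1) (C := M)
    (f := fun t => character n t * φ (act (rot t) q)) fun t ht => by
      rw [norm_mul, norm_character, one_mul]
      rw [Set.uIoc_of_le zero_le_one] at ht
      exact hM t ⟨ht.1.le, ht.2⟩
  simpa [coef] using h

/-- The Fourier coefficients of a smooth function are absolutely summable. -/
lemma summable_coef {φ : 𝒬.Over U → ℂ} (hφ : IsSmooth φ) (q : 𝒬.Over U) :
    Summable (fun n => coef n φ q) := by
  -- The coefficients of `E·E·φ` are `(2πin)²` times those of `φ` and are bounded, which gives a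
  -- bound of order `n⁻²` for `n ≠ 0`.
  have h1 := isSmooth_der_generator hφ
  obtain ⟨M, hM⟩ := exists_norm_coef_le (isSmooth_der_generator h1) q
  have hbound : ∀ n : ℤ, n ≠ 0 → ‖coef n φ q‖ ≤ M * (1 / (n : ℝ) ^ 2) := by
    intro n hn
    have h2 := hM n
    rw [coef_der_generator n h1 q, coef_der_generator n hφ q] at h2
    simp only [norm_mul, Complex.norm_I, Complex.norm_intCast, Complex.norm_real, mul_one,
      RCLike.norm_ofNat, Real.norm_of_nonneg Real.pi_pos.le] at h2
    have hn0 : (0 : ℝ) < (n : ℝ) ^ 2 := by positivity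
    rw [mul_one_div, le_div_iff₀ hn0]
    refine le_trans ?_ h2
    have h3 : (1 : ℝ) ≤ 2 * Real.pi := by linarith [Real.pi_gt_three]
    have h4 : (n : ℝ) ^ 2 = |(n : ℝ)| * |(n : ℝ)| := by rw [← sq, sq_abs]
    have h5 : |(n : ℝ)| ≤ 2 * Real.pi * |(n : ℝ)| := le_mul_of_one_le_left (abs_nonneg _) h3
    calc ‖coef n φ q‖ * (n : ℝ) ^ 2 = |(n : ℝ)| * (|(n : ℝ)| * ‖coef n φ q‖) := by rw [h4]; ring
      _ ≤ (2 * Real.pi * |(n : ℝ)|) * ((2 * Real.pi * |(n : ℝ)|) * ‖coef n φ q‖) := by gcongr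
  refine Summable.of_norm_bounded_eventually
    ((Real.summable_one_div_int_pow.2 one_lt_two).mul_left M) ?_
  filter_upwards [(Set.finite_singleton (0 : ℤ)).compl_mem_cofinite] with n hn
  exact hbound n hn

/-- A smooth function is the sum of its Fourier coefficients. -/
lemma hasSum_coef {φ : 𝒬.Over U → ℂ} (hφ : IsSmooth φ) (q : 𝒬.Over U) :
    HasSum (fun n => coef n φ q) (φ q) := by
  have hper : Function.Periodic (fun t => φ (act (rot t) q)) 1 := by
    intro t
    simp only [rot_add, rot_one, mul_one]
  -- The function on the orbit of `q`, as a function on `ℝ/ℤ`; the point `q` itself corresponds to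
  -- `0`.
  let f : C(AddCircle (1 : ℝ), ℂ) := ⟨hper.lift, (continuous_act hφ q).quotient_liftOn' _⟩
  have hcoef : ∀ n, fourierCoeff f n = coef n φ q := by
    intro n
    rw [fourierCoeff_eq_intervalIntegral f n 0, zero_add, div_one, one_smul]
    refine intervalIntegral.integral_congr fun t _ => ?_
    simp only [smul_eq_mul]
    congr 1
    rw [fourier_coe_apply, character]
    congr 1
    push_cast
    ring
  have hs : Summable (fourierCoeff f) := by
    simp_rw [funext hcoef]
    exact summable_coef hφ q
  have h := has_pointwise_sum_fourier_series_of_summable hs 0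
  simp only [hcoef, fourier_eval_zero, smul_eq_mul, mul_one] at h
  have h0 : f 0 = φ q := by
    have h1 : f ((0 : ℝ) : AddCircle (1 : ℝ)) = φ (act (rot 0) q) := rfl
    rw [rot_zero, act_one] at h1
    exact h1
  rwa [h0] at h

end Smooth

end Prequantization

/-! ### Decomposition into eigenfunctions, and the prequantization operator -/

namespace Prequantization

open DiracStructure

variable {E : Type*} [NormedAddCommGroup E] [NormedSpace ℝ E]
  {P : Type*} [TopologicalSpace P] [ChartedSpace E P] [IsManifold 𝓘(ℝ, E) ∞ P]
  {F : Type*} [NormedAddCommGroup F] [NormedSpace ℝ F]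
  {Q : Type*} [TopologicalSpace Q] [ChartedSpace F Q] [IsManifold 𝓘(ℝ, F) ∞ Q]
  [MulAction Circle Q] {L : DiracStructure E P} {𝒬 : Prequantization L F Q}
  {U V : TopologicalSpace.Opens P}

/-- The terms of a decomposition into eigenfunctions are the Fourier coefficients. -/
lemma coef_eq_of_hasSum {c : ℤ → 𝒬.Over U → ℂ} {φ : 𝒬.Over U → ℂ} (hc : ∀ n, IsSmooth (c n))
    (hE : ∀ n (q : 𝒬.Over U), der (c n) q (generator F q.1) =
      2 * Real.pi * Complex.I * n * c n q)
    (hsum : ∀ q, HasSum (fun n => c n q) (φ q)) (m : ℤ) (q : 𝒬.Over U) : coef m φ q = c m q := by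
  have heq : ∀ (n : ℤ) (t : ℝ), c n (act (rot t) q) =
      Complex.exp (2 * Real.pi * Complex.I * n * t) * c n q := fun n t =>
    apply_act_rot (hc n) (hE n) q t
  have hexp : ∀ (n : ℤ) (t : ℝ), Complex.exp (2 * Real.pi * Complex.I * n * t) =
      character (-n) t := by
    intro n t
    rw [character]
    congr 1
    push_cast
    ring
  have hcont : ∀ n : ℤ, Continuous
      (fun t : ℝ => character m t * Complex.exp (2 * Real.pi * Complex.I * n * t)) := by
    intro n
    simp_rw [hexp n]
    exact (contDiff_character m).continuous.mul (contDiff_character (-n)).continuous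
  -- The modulus of an eigenfunction is constant on orbits, so the dominating series is the constant
  -- `‖c n q‖`; it converges because unconditional and absolute convergence agree in `ℂ`.
  -- Orthogonality of characters then isolates the term `m`.
  have h := intervalIntegral.hasSum_integral_of_dominated_convergence (ι := ℤ) (a := 0) (b := 1)
    (μ := MeasureTheory.volume) (f := fun t => character m t * φ (act (rot t) q))
    (F := fun (n : ℤ) t => character m t * Complex.exp (2 * Real.pi * Complex.I * n * t) * c n q)
    (fun (n : ℤ) _ => ‖c n q‖)
    (fun n => ((hcont n).mul continuous_const).aestronglyMeasurable)
    (fun n => Filter.Eventually.of_forall fun t _ => by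
      rw [norm_mul, norm_mul, norm_character, hexp, norm_character, one_mul, one_mul])
    (Filter.Eventually.of_forall fun t _ => (hsum q).summable.norm)
    intervalIntegrable_const
    (Filter.Eventually.of_forall fun t _ => by
      have h1 := (hsum (act (rot t) q)).mul_left (character m t)
      simp_rw [heq] at h1
      simpa only [mul_assoc] using h1)
  have hint : ∀ n : ℤ, ∫ t in (0 : ℝ)..1,
      character m t * Complex.exp (2 * Real.pi * Complex.I * n * t) * c n q =
        if n = m then c m q else 0 := by
    intro n
    rw [intervalIntegral.integral_mul_const, integral_character_mul]
    split_ifs with hnm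
    · rw [hnm, one_mul]
    · rw [zero_mul]
  simp_rw [hint] at h
  exact h.unique (hasSum_ite_eq m (c m q))

lemma der_act {φ : 𝒬.Over U → ℂ} (hφ : IsSmooth φ) (z : Circle) (q : 𝒬.Over U) (v : F) :
    der φ (act z q) (dact F z q.1 v) = der (fun r => φ (act z r)) q v := by
  have h1 := 𝒬.mvfderiv_comp_smul (hφ.mdifferentiableAt (act z q)) v
  have h2 : der (fun r => φ (act z r)) q = mvfderiv 𝓘(ℝ, F) (fun r : Q => ext φ (z • r)) q.1 :=
    der_eq_of_forall (g := fun r : Q => ext φ (z • r))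
      (fun r => (ext_apply φ (act z r)).symm) q
  exact h1.symm.trans (congrArg (fun T : F →L[ℝ] ℂ => T v) h2).symm

section

variable [FiniteDimensional ℝ E] [T2Space P] [FiniteDimensional ℝ F]

omit [FiniteDimensional ℝ E] [T2Space P] in
-- The vertical part `⟨X_g ⊕ dg, β⟩ - g` is pulled back from `P`, hence invariant.
lemma dact_admLift (g : L.Adm) (z : Circle) (q : Q) :
    dact F z q (𝒬.admLift g q) = 𝒬.admLift g (z • q) :=
  (isLift_hamLift (Adm.isHamiltonian_ham g) g.1.contMDiff).dact
    (fun z q => by rw [𝒬.proj_smul]) z q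

/-- The representation preserves the eigenspaces of the generator. -/
lemma repDer_mem_eigenspace (g : L.Adm) {n : ℤ} {φ : 𝒬.Bas U} (hφ : φ ∈ 𝒬.eigenspace n U) :
    𝒬.repDer g U φ ∈ 𝒬.eigenspace n U := by
  refine Submodule.neg_mem _ fun q => ?_
  refine der_generator_of_apply_act (isSmooth_der (𝒬.smooth_admLift g) φ.2.1) fun t => ?_
  -- Rotating `φ` multiplies it by a constant, and the lift is invariant, so its derivative along
  -- the lift is multiplied by the same constant.
  have h1 : (fun r => φ.1 (act (rot t) r)) =
      fun r => Complex.exp (2 * Real.pi * Complex.I * n * t) * φ.1 r :=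
    funext fun r => apply_act_rot φ.2.1 hφ r t
  have h2 := der_act φ.2.1 (rot t) q (𝒬.admLift g q.1)
  rw [dact_admLift, h1, 𝒬.der_const_mul φ.2.1] at h2
  exact h2

/-- The representation commutes with taking Fourier coefficients. -/
lemma coef_repDer (g : L.Adm) (φ : 𝒬.Bas U) (n : ℤ) (q : 𝒬.Over U) :
    coef n (𝒬.repDer g U φ).1 q = -der (coef n φ.1) q (𝒬.admLift g q.1) := by
  rw [der_coef_of_invariant n φ.2.1 (dact_admLift g)]
  refine (intervalIntegral.integral_congr fun t _ => ?_).trans intervalIntegral.integral_neg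
  exact mul_neg _ _

omit [T2Space P] in
lemma exists_unique_decomposition (φ : 𝒬.Bas U) :
    ∃! c : ℤ → 𝒬.Bas U, (∀ n, c n ∈ 𝒬.eigenspace n U) ∧
      ∀ q, HasSum (fun n => (c n).1 q) (φ.1 q) := by
  refine ⟨fun n => ⟨coef n φ.1, isBasic_coef n φ.2⟩,
    ⟨fun n q => der_coef_generator n φ.2.1 q, hasSum_coef φ.2.1⟩, ?_⟩
  rintro c ⟨hc, hsum⟩
  funext n
  apply Subtype.ext
  funext q
  exact (coef_eq_of_hasSum (fun n => (c n).2.1) hc hsum n q).symm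

/-- The representation is compatible with the decomposition into eigenfunctions. -/
lemma hasSum_repDer (g : L.Adm) {φ : 𝒬.Bas U} {c : ℤ → 𝒬.Bas U}
    (hc : ∀ n, c n ∈ 𝒬.eigenspace n U) (hsum : ∀ q, HasSum (fun n => (c n).1 q) (φ.1 q))
    (q : 𝒬.Over U) : HasSum (fun n => (𝒬.repDer g U (c n)).1 q) ((𝒬.repDer g U φ).1 q) := by
  -- The series is not differentiated term by term: the Fourier series of the smooth function
  -- `{π^*g, φ}` converges to it, and its terms are the images of the terms of `φ`.
  refine (hasSum_coef (𝒬.repDer g U φ).2.1 q).congr_fun fun n => ?_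
  have h : coef n φ.1 = (c n).1 := funext fun q =>
    coef_eq_of_hasSum (fun n => (c n).2.1) hc hsum n q
  rw [coef_repDer, h]
  rfl

omit [FiniteDimensional ℝ E] [T2Space P] [FiniteDimensional ℝ F] in
/-- On antiequivariant functions, `D_a` is the derivative along the lift of `a`. -/
lemma connL_eq {φ : 𝒬.Over U → ℂ} (hE : ∀ q : 𝒬.Over U, der φ q (generator F q.1) =
      2 * Real.pi * Complex.I * ((-1 : ℤ) : ℂ) * φ q) (q : 𝒬.Over U) (a : L.fiber (𝒬.proj q.1)) :
    connL φ q a = der φ q (𝒬.horLift q.1 a.1.1 + 𝒬.β _ a • generator F q.1) := by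
  rw [map_add, map_smul, hE, connL, covDer, Complex.real_smul]
  push_cast
  ring

omit [T2Space P] in
/-- `H^{-1}` consists of the sections of `K` that are flat along `L ∩ TP`. -/
lemma mem_eigenspace_neg_one_iff (φ : 𝒬.Over U → ℂ) :
    (∃ h : φ ∈ 𝒬.Bas U, (⟨φ, h⟩ : 𝒬.Bas U) ∈ 𝒬.eigenspace (-1) U) ↔
      IsSmooth φ ∧ IsAntiequivariant φ ∧
        ∀ (q : 𝒬.Over U) (a : L.fiber (𝒬.proj q.1)), a.1.2 = 0 → connL φ q a = 0 := by
  constructor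
  · rintro ⟨h, hE⟩
    refine ⟨h.1, (isAntiequivariant_iff h.1).2 hE, fun q a ha => ?_⟩
    rw [connL_eq hE]
    refine (isBasic_iff.1 h).2 q a _ ha ?_ ?_
    · rw [map_add, map_smul, 𝒬.dproj_generator, 𝒬.dproj_horLift, smul_zero, add_zero]
    · rw [map_add, map_smul, 𝒬.σ_generator, 𝒬.σ_horLift, zero_add, smul_eq_mul, mul_one]
  · rintro ⟨hs, hanti, hflat⟩
    have hE := (isAntiequivariant_iff hs).1 hanti
    refine ⟨isBasic_iff.2 ⟨hs, fun q a v ha h1 h2 => ?_⟩, hE⟩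
    have hv : v = 𝒬.horLift q.1 a.1.1 + 𝒬.β _ a • generator F q.1 := by
      refine 𝒬.tangent_ext (q := q.1) ?_ ?_
      · rw [h1, map_add, map_smul, 𝒬.dproj_generator, 𝒬.dproj_horLift, smul_zero, add_zero]
      · rw [h2, map_add, map_smul, 𝒬.σ_generator, 𝒬.σ_horLift, zero_add, smul_eq_mul, mul_one]
    rw [hv, ← connL_eq hE]
    exact hflat q a ha

/-- The representation on `H^{-1}` is the prequantization operator. -/
lemma repDer_apply_eigenspace_neg_one (g : L.Adm) {X : ∀ p : P, TangentSpace 𝓘(ℝ, E) p}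
    (hX : L.IsHamiltonian X g.1) {φ : 𝒬.Bas U} (hφ : φ ∈ 𝒬.eigenspace (-1) U) (q : 𝒬.Over U) :
    (𝒬.repDer g U φ).1 q =
      -(connL φ.1 q ⟨(X (𝒬.proj q.1), mvfderiv 𝓘(ℝ, E) g.1 (𝒬.proj q.1)), hX.2 (𝒬.proj q.1)⟩
        + 2 * Real.pi * Complex.I * g.1 (𝒬.proj q.1) * φ.1 q) := by
  -- The action is computed with the pair built from the given `X` instead of the chosen one. It
  -- differs from the lift of `X ⊕ dg` by `-g E`, which acts on `φ` as `2πig`.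
  rw [𝒬.repDer_apply_of_pair (isHamiltonianPair_hamLift hX g.1.contMDiff), connL_eq hφ]
  rw [hamLift, lift, map_add, map_add, map_smul, map_smul, hφ q]
  simp only [Complex.real_smul]
  push_cast
  have hβ : 𝒬.betaFun (hX.section g.1.contMDiff) (𝒬.proj q.1) = 𝒬.β (𝒬.proj q.1)
      ⟨(X (𝒬.proj q.1), mvfderiv 𝓘(ℝ, E) g.1 (𝒬.proj q.1)), hX.2 (𝒬.proj q.1)⟩ := rfl
  rw [hβ]
  ring

end

end Prequantization

end DiracPrequantization

end

theorem proposition5p1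
    {E : Type*} [NormedAddCommGroup E] [NormedSpace ℝ E] [FiniteDimensional ℝ E]
    {P : Type*} [TopologicalSpace P] [T2Space P] [SigmaCompactSpace P]
    [ChartedSpace E P] [IsManifold 𝓘(ℝ, E) ∞ P]
    {F : Type*} [NormedAddCommGroup F] [NormedSpace ℝ F] [FiniteDimensional ℝ F]
    {Q : Type*} [TopologicalSpace Q] [T2Space Q] [SigmaCompactSpace Q]
    [ChartedSpace F Q] [IsManifold 𝓘(ℝ, F) ∞ Q] [MulAction Circle Q]
    (L : DiracStructure E P) (𝒬 : Prequantization L F Q) :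
    -- the bracket `{f, g} = X_g · f` makes the admissible functions a real Lie algebra
    ∃ br : L.Adm →ₗ[ℝ] L.Adm →ₗ[ℝ] L.Adm,
      (∀ (f g : L.Adm) (X : ∀ p : P, TangentSpace 𝓘(ℝ, E) p), L.IsHamiltonian X g.1 →
        ∀ p, (br f g).1 p = mvfderiv 𝓘(ℝ, E) f.1 p (X p)) ∧
      (∀ f, br f f = 0) ∧
      (∀ f g h, br f (br g h) = br (br f g) h + br g (br f h)) ∧
    -- the basic functions form a sheaf on `P`
      (∀ (𝒰 : Set (TopologicalSpace.Opens P)) (φ : 𝒬.Over (sSup 𝒰) → ℂ),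
        (∀ U (hU : U ∈ 𝒰), Prequantization.IsBasic (Prequantization.resFun (le_sSup hU) φ)) →
        Prequantization.IsBasic φ) ∧
    -- the pull-back of an admissible function is admissible
      (∀ g : L.Adm, ∃ X u, 𝒬.IsHamiltonianPair X u (fun q => g.1 (𝒬.proj q))) ∧
    -- the representation `g ↦ {π^*g, ·}`
      ∃ ρ : L.Adm → 𝒬.SheafDer,
        (∀ (g : L.Adm) (X : ∀ q : Q, TangentSpace 𝓘(ℝ, F) q) (u : Q → ℝ),
          𝒬.IsHamiltonianPair X u (fun q => g.1 (𝒬.proj q)) →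
          ∀ U (φ : 𝒬.Bas U) (q : 𝒬.Over U),
            ((ρ g).app U φ).1 q = -(Prequantization.der φ.1 q (X q.1) + φ.1 q * u q.1)) ∧
        (∀ f g U, (ρ (f + g)).app U = (ρ f).app U + (ρ g).app U) ∧
        (∀ (r : ℝ) g U, (ρ (r • g)).app U = (r : ℂ) • (ρ g).app U) ∧
        (∀ f g U, (ρ (br f g)).app U = ⁅(ρ f).app U, (ρ g).app U⁆) ∧
    -- eigenvalues of the generator, and the decomposition into eigenspaces
        (∀ U (φ : 𝒬.Bas U) (c : ℂ), φ ≠ 0 →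
          (∀ q : 𝒬.Over U, Prequantization.der φ.1 q (generator F q.1) = c * φ.1 q) →
          ∃ n : ℤ, c = 2 * Real.pi * Complex.I * n) ∧
        (∀ U (φ : 𝒬.Bas U), ∃! c : ℤ → 𝒬.Bas U, (∀ n, c n ∈ 𝒬.eigenspace n U) ∧
          ∀ q, HasSum (fun n => (c n).1 q) (φ.1 q)) ∧
    -- the representation is compatible with the decomposition
        (∀ (g : L.Adm) U (n : ℤ), ∀ φ ∈ 𝒬.eigenspace n U, (ρ g).app U φ ∈ 𝒬.eigenspace n U) ∧
        (∀ (g : L.Adm) U (φ : 𝒬.Bas U) (c : ℤ → 𝒬.Bas U),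
          (∀ n, c n ∈ 𝒬.eigenspace n U) → (∀ q, HasSum (fun n => (c n).1 q) (φ.1 q)) →
          ∀ q, HasSum (fun n => ((ρ g).app U (c n)).1 q) (((ρ g).app U φ).1 q)) ∧
    -- `H^{-1}` consists of the sections of `K` that are flat along `L ∩ TP`
        (∀ U (φ : 𝒬.Over U → ℂ),
          (∃ h : φ ∈ 𝒬.Bas U, (⟨φ, h⟩ : 𝒬.Bas U) ∈ 𝒬.eigenspace (-1) U) ↔
            Prequantization.IsSmooth φ ∧ Prequantization.IsAntiequivariant φ ∧
            ∀ (q : 𝒬.Over U) (a : L.fiber (𝒬.proj q.1)), a.1.2 = 0 →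
              Prequantization.connL φ q a = 0) ∧
    -- on `H^{-1}`, `g` acts by `-(D_{X_g ⊕ dg} + 2πig)`
        (∀ (g : L.Adm) (X : ∀ p : P, TangentSpace 𝓘(ℝ, E) p) (hX : L.IsHamiltonian X g.1),
          ∀ U, ∀ φ ∈ 𝒬.eigenspace (-1) U, ∀ q : 𝒬.Over U,
            ((ρ g).app U φ).1 q =
              -(Prequantization.connL φ.1 q ⟨(X (𝒬.proj q.1), mvfderiv 𝓘(ℝ, E) g.1 (𝒬.proj q.1)),
                  hX.2 (𝒬.proj q.1)⟩
                + 2 * Real.pi * Complex.I * g.1 (𝒬.proj q.1) * φ.1 q)) := by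
  have : CompleteSpace E := FiniteDimensional.complete ℝ E
  exact ⟨DiracStructure.Adm.bracket,
    fun f g X hX p => DiracStructure.Adm.bracket_apply f g hX p,
    DiracStructure.Adm.bracket_self, DiracStructure.Adm.bracket_jacobi,
    fun 𝒰 φ h => Prequantization.isBasic_of_cover h,
    fun g => ⟨_, _, 𝒬.isHamiltonianPair_admLift g⟩, 𝒬.rep,
    fun g X u h U φ q => 𝒬.repDer_apply_of_pair h φ q,
    fun f g U => 𝒬.repDer_add f g,
    fun r g U => 𝒬.repDer_smul r g,
    fun f g U => 𝒬.repDer_bracket f g,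
    fun U φ c h0 h => Prequantization.exists_int_of_eigenvalue φ.2.1
      (fun h1 => h0 (Subtype.ext h1)) h,
    fun U φ => Prequantization.exists_unique_decomposition φ,
    fun g U n φ hφ => Prequantization.repDer_mem_eigenspace g hφ,
    fun g U φ c hc hsum q => Prequantization.hasSum_repDer g hc hsum q,
    fun U φ => Prequantization.mem_eigenspace_neg_one_iff φ,
    fun g X hX U φ hφ q => Prequantization.repDer_apply_eigenspace_neg_one g hX hφ q⟩
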